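/- **Conventions.** Let $n\ge 1$, and let $M^n$ be a manifold with center $o$, i.e. $M$ carries polar coordinates: a diffeomorphism $\Phi:\mathbb R^n\to M$, $\Phi(0)=o$ (the exponential map at $o$). Write $r(\Phi(x))=|x|$, $B_a=\{r<a\}$ and $M\setminus\{o\}=\mathbb S^{n-1}\times\mathbb R^+$. Fix once and for all smooth functions $\rho_T,\rho_W:\mathbb R\to[0,1]$ with $\rho_T=0$ on $(-\infty,0]$, $\rho_T=1$ on $[1,\infty)$, and, for some $\delta>0$, $\rho_W=0$ on $(-\infty,\delta]$, $\rho_W=1$ on $[\frac12-\delta,\infty)$; and for each $n$ a finite atlas of $\mathbb S^{n-1}$ whose charts extend to neighbourhoods of the closures of their domains. The $C^2$-norm $|\cdot|$ is the supremum of all partial derivatives of order $\le 2$ of all components (in the atlas, for metrics on $\mathbb S^{n-1}$). A metric $g'$ on $\mathbb S^{n-1}$ is $c$-bounded ($c>1$) if $|g'|<c$ and $|\det g'|>1/c$ at all points, in the charts of the atlas. Let $\sigma_{\mathbb S^{n-1}}$ be the round metric. *Hyperbolic forcing.* For $g=g_r+dr^2$ let $\hat g_{r_0}=g_{r_0}/\sinh^2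 r_0$ (the spherical cut at $r_0$), $$\mathcal W_{r_0}g=(1-\rho_W(r-r_0))\big(\sinh^2(r)\,\hat g_{r_0}+dr^2\big)+\rho_W(r-r_0)\,g .$$ For $k=k_r+dr^2$ with $k_r=\sinh^2(r)\,k'$ where $r<a+\frac d2$, put $$\mathcal T_{a,d}k=(1-\rho_T(\tfrac{2(r-a)}d))\,\sinh^2(r)\,\sigma_{\mathbb S^{n-1}}+\rho_T(\tfrac{2(r-a)}d)\,k_r+dr^2 .$$ Then $\mathcal H_{r_0,d}\,g=\mathcal T_{r_0-d,d}(\mathcal W_{r_0}g)$. *Closeness.* Let $\mathbb T_\xi=\mathbb B^{n-1}\times(-(1+\xi),1+\xi)$, with $\mathbb B^{n-1}$ the open unit ball of $\mathbb R^{n-1}$ and metric $\sigma=e^{2t}\sigma_{\mathbb R^{n-1}}+dt^2$. A metric $g$ of the form $g_r+dr^2$ is radially $\epsilon$-close to hyperbolic on $S\subset M$, with charts of excess $\xi$, if for every $p\in S$ there is a chart $\phi$ from $\mathbb T_\xi$ to the part of $M\setminus\{o\}$ where $g$ is defined (a diffeomorphism onto an open set), with $\phi(0,0)=p$, $\phi(y,t)=(\phi_1(y),t+a)$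 for some map $\phi_1$ and some constant $a$, and $|\phi^*g-\sigma|<\epsilon$. A metric $h=h_r+dr^2$ on $M\setminus\{o\}$ is $(B_a,\epsilon)$-close to hyperbolic, with charts of excess $\xi$, if $h=\sinh^2(r)\sigma_{\mathbb S^{n-1}}+dr^2$ on $B_a\setminus\{o\}$ and $h$ is radially $\epsilon$-close to hyperbolic on $M\setminus B_{a-1-\xi}$, with charts of excess $\xi$. *Families.* A $\odot$-family (for $\xi$) consists of $\lambda_0>1+\xi$ and metrics $g_\lambda=(g_\lambda)_r+dr^2$, $\lambda\ge\lambda_0$, depending smoothly on all variables, $g_\lambda$ being defined for $r>R_\lambda$ with $0\le R_\lambda\le\lambda-(1+\xi)$ (so at least for $r>\lambda-(1+\xi)$). It has a cut limit at $b=0$ if $\widehat{(g_\lambda)}_\lambda$ converges, as $\lambda\to\infty$, in the $C^2$-norm to a $C^2$ Riemannian metric on $\mathbb S^{n-1}$. It is radially $\epsilon$-close to hyperbolic, with charts of excess $\xi$, if each $g_\lambda$, $\lambda\ge\lambda_0$, is so on $M\setminus B_{\lambda-(1+\xi)}$. **Corollary.** For every $\xi>1$ there is a constant $C_2=C_2(\xi)>0$,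 and for all $n$ and $c>1$ there is a constant $C_1=C_1(c,n,\xi)>0$, such that the following holds. Let $M^n$ have center $o$, and let $\{g_\lambda\}_{\lambda\ge\lambda_0}$ be a $\odot$-family on $M$ that has a cut limit at $b=0$ and is radially $\epsilon$-close to hyperbolic, with charts of excess $\xi$. Then there is $c>1$ such that all spherical cuts $\widehat{(g_\lambda)}_\lambda$, $\lambda\ge\lambda_0$, are $c$-bounded; and for every such $c$, every $\epsilon'>0$, every $\lambda\ge\lambda_0$ and every $d\ge4(1+\xi)$ with $\lambda-d\ge2\xi$, the metric $\mathcal H_{\lambda,d}\,g_\lambda$ is a smooth Riemannian metric on $M\setminus\{o\}$ which is $(B_{\lambda-d},\,\epsilon'+C_2\epsilon)$-close to hyperbolic, with charts of excess $\xi-1$, provided (i) $\lambda-d>\ln\left(\frac{2C_1}{\epsilon'}\right)$, and (ii) $d\ge\frac{2C_1}{\epsilon'}$, where $C_1=C_1(c,n,\xi)$. -/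

import Mathlib

open scoped Manifold ContDiff

universe u

noncomputable section

/-- The unit sphere `S^m` of `ℝ^(m+1)`; for manifolds of dimension `n` we have `m = n - 1`. -/
abbrev Sph (m : ℕ) : Type := Metric.sphere (0 : EuclideanSpace ℝ (Fin (m + 1))) 1

/-- Fields of bilinear forms on the tangent spaces of `S^m` (no regularity). -/
abbrev SphForm (m : ℕ) : Type :=
  ∀ x : Sph m, TangentSpace (𝓡 m) x →L[ℝ] TangentSpace (𝓡 m) x →L[ℝ] ℝ

/-- The derivative at `x` of the inclusion of `S^m` into `ℝ^(m+1)`. -/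
def sphereInclDeriv (m : ℕ) (x : Sph m) :
    TangentSpace (𝓡 m) x →L[ℝ] EuclideanSpace ℝ (Fin (m + 1)) :=
  mvfderiv (𝓡 m) (fun y : Sph m => (y : EuclideanSpace ℝ (Fin (m + 1)))) x

/-- The round metric of `S^m`. -/
def roundMetric (m : ℕ) : SphForm m := fun x =>
  let D : EuclideanSpace ℝ (Fin m) →L[ℝ] EuclideanSpace ℝ (Fin (m + 1)) := sphereInclDeriv m x
  (((innerSL ℝ : EuclideanSpace ℝ (Fin (m + 1)) →L[ℝ]
    EuclideanSpace ℝ (Fin (m + 1)) →L[ℝ] ℝ).bilinearComp D D :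
      EuclideanSpace ℝ (Fin m) →L[ℝ] EuclideanSpace ℝ (Fin m) →L[ℝ] ℝ))

/-- A family `γ q` of forms on `S^m`, with parameter `q` in a normed space, depends smoothly on
`(q, x)` for `q ∈ D`. -/
def SmoothFamily {m : ℕ} {P : Type} [NormedAddCommGroup P] [NormedSpace ℝ P]
    (D : Set P) (γ : P → SphForm m) : Prop :=
  ContMDiffOn (𝓘(ℝ, P).prod (𝓡 m))
    ((𝓡 m).prod 𝓘(ℝ, EuclideanSpace ℝ (Fin m) →L[ℝ] EuclideanSpace ℝ (Fin m) →L[ℝ] ℝ)) ∞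
    (fun q : P × Sph m =>
      Bundle.TotalSpace.mk' (EuclideanSpace ℝ (Fin m) →L[ℝ] EuclideanSpace ℝ (Fin m) →L[ℝ] ℝ)
        (E := fun x : Sph m => TangentSpace (𝓡 m) x →L[ℝ] TangentSpace (𝓡 m) x →L[ℝ] ℝ)
        q.2 (γ q.1 q.2))
    (D ×ˢ Set.univ)

/-- Symmetric and positive definite at every point. -/
def IsInnerForm {m : ℕ} (g : SphForm m) : Prop :=
  (∀ x v w, g x v w = g x w v) ∧ ∀ x v, v ≠ 0 → 0 < g x v v

/-! ### Uniform `C²`-norms -/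

/-- The uniform `C²`-norm on `s` of the vector-valued function with components `F a`, `a : A`
(the supremum of the absolute values of all partial derivatives of order at most `2`, in the
coordinate directions `b j`, of all components) is less than `c`. -/
def C2NormLT {V J A : Type} [NormedAddCommGroup V] [NormedSpace ℝ V]
    (b : J → V) (s : Set V) (F : A → V → ℝ) (c : ℝ) : Prop :=
  ∃ c' < c, ∀ z ∈ s, ∀ a : A, ∀ k ≤ 2, ∀ j : Fin k → J,
    |iteratedFDeriv ℝ k (F a) z (fun l => b (j l))| ≤ c'

/-- A fixed finite atlas of `S^m` with extendable charts: the chart domains `dom i` cover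
the sphere, and the `i`-th chart extends to the chart `chart i` (of the maximal smooth atlas)
defined on a neighbourhood of the closure of `dom i`. -/
structure SphereAtlas (m : ℕ) where
  N : ℕ
  chart : Fin N → OpenPartialHomeomorph (Sph m) (EuclideanSpace ℝ (Fin m))
  chart_mem : ∀ i, chart i ∈ IsManifold.maximalAtlas (𝓡 m) ∞ (Sph m)
  dom : Fin N → Set (Sph m)
  isOpen_dom : ∀ i, IsOpen (dom i)
  closure_dom : ∀ i, closure (dom i) ⊆ (chart i).source
  cover : (⋃ i, dom i) = Set.univ

namespace SphereAtlas

variable {m : ℕ} (𝒜 : SphereAtlas m)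

/-- The components `g_{jk}` of `g` in the `i`-th chart. -/
def coeff (i : Fin 𝒜.N) (g : SphForm m) (jk : Fin m × Fin m) (z : EuclideanSpace ℝ (Fin m)) : ℝ :=
  g ((𝒜.chart i).symm z)
    (mfderiv 𝓘(ℝ, EuclideanSpace ℝ (Fin m)) (𝓡 m) (𝒜.chart i).symm z
      (EuclideanSpace.single jk.1 (1 : ℝ)))
    (mfderiv 𝓘(ℝ, EuclideanSpace ℝ (Fin m)) (𝓡 m) (𝒜.chart i).symm z
      (EuclideanSpace.single jk.2 (1 : ℝ)))

/-- `|g| < c`, for the uniform `C²`-norm with respect to the atlas. -/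
def NormLT (g : SphForm m) (c : ℝ) : Prop :=
  ∀ i, C2NormLT (fun j : Fin m => EuclideanSpace.single j (1 : ℝ))
    (𝒜.chart i '' 𝒜.dom i) (𝒜.coeff i g) c

/-- `g` is `c`-bounded: `|g| < c`, and `|det g| > 1/c` in all charts of the atlas. -/
def CBounded (c : ℝ) (g : SphForm m) : Prop :=
  𝒜.NormLT g c ∧ ∀ i, ∀ z ∈ 𝒜.chart i '' 𝒜.dom i,
    1 / c < |(Matrix.of fun j k : Fin m => 𝒜.coeff i g (j, k) z).det|

end SphereAtlas

/-! ### Warp forcing, two variable warping trick, hyperbolic forcing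

A metric `g = g_r + dr²` is given by the function `r ↦ g_r`, with values in the metrics of the
sphere. -/

/-- The (unwarped) spherical cut `g_r / sinh² r`. -/
def sphericalCut {m : ℕ} (g : ℝ → SphForm m) (r : ℝ) : SphForm m :=
  fun x => (1 / Real.sinh r ^ 2) • g r x

/-- The cutoff function used for the two variable warping trick. -/
structure IsTrickCutoff (ρ : ℝ → ℝ) : Prop where
  smooth : ContDiff ℝ ∞ ρ
  mem : ∀ t, ρ t ∈ Set.Icc (0 : ℝ) 1
  zero : ∀ t ≤ 0, ρ t = 0
  one : ∀ t, 1 ≤ t → ρ t = 1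

/-- The cutoff function used for warp forcing. -/
structure IsForcingCutoff (ρ : ℝ → ℝ) : Prop where
  smooth : ContDiff ℝ ∞ ρ
  mem : ∀ t, ρ t ∈ Set.Icc (0 : ℝ) 1
  flat : ∃ δ > 0, (∀ t ≤ δ, ρ t = 0) ∧ ∀ t, 1 / 2 - δ ≤ t → ρ t = 1

/-- Warp forcing `𝒲_{r₀} g = (1 - ρ(r - r₀)) (sinh² r ĝ_{r₀} + dr²) + ρ(r - r₀) g`. -/
def warpForcing {m : ℕ} (ρ : ℝ → ℝ) (r₀ : ℝ) (g : ℝ → SphForm m) : ℝ → SphForm m := fun r x =>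
  ((1 - ρ (r - r₀)) * Real.sinh r ^ 2) • sphericalCut g r₀ x + ρ (r - r₀) • g r x

/-- The two variable warping trick: where `g = sinh² r h + dr²` the result is
`sinh² r ((1 - ρ_{a,d}(r)) σ + ρ_{a,d}(r) h) + dr²` with `ρ_{a,d}(r) = ρ(2 (r - a) / d)` and `σ` the
round metric, and `g` is unchanged for `r ≥ a + d/2`. (Here `sinh² r h = g_r`.) -/
def warpingTrick {m : ℕ} (ρ : ℝ → ℝ) (a d : ℝ) (g : ℝ → SphForm m) : ℝ → SphForm m :=
  fun r x =>
    ((1 - ρ (2 * (r - a) / d)) * Real.sinh r ^ 2) • roundMetric m x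
      + ρ (2 * (r - a) / d) • g r x

/-- Hyperbolic forcing `ℋ_{r₀,d} g = 𝒯_{r₀-d,d} (𝒲_{r₀} g)`. -/
def hypForcing {m : ℕ} (ρT ρW : ℝ → ℝ) (r₀ d : ℝ) (g : ℝ → SphForm m) : ℝ → SphForm m :=
  warpingTrick ρT (r₀ - d) d (warpForcing ρW r₀ g)

/-! ### Manifolds with center

A manifold `M` with center `o` carries the diffeomorphism `exp_o : T_oM = ℝ^n → M`. It is the
diffeomorphism `Φ` below, and `o = Φ 0`. It gives `M ∖ {o} = S^{n-1} × ℝ⁺`. -/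

section Center

variable {m : ℕ} {M : Type u} [TopologicalSpace M]
  [ChartedSpace (EuclideanSpace ℝ (Fin (m + 1))) M]
  (Φ : EuclideanSpace ℝ (Fin (m + 1)) ≃ₘ⟮𝓡 (m + 1), 𝓡 (m + 1)⟯ M)

/-- The distance to the center. -/
def radius (p : M) : ℝ := ‖Φ.symm p‖

/-- The projection of `M ∖ {o} = S^{n-1} × ℝ⁺` to the sphere (with an arbitrary value at `o`). -/
def angle (p : M) : Sph m :=
  open Classical in
  if h : Φ.symm p = 0 then ⟨EuclideanSpace.single 0 1, by simp⟩
  else ⟨‖Φ.symm p‖⁻¹ • Φ.symm p, by simp [norm_smul, h]⟩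

/-- The bilinear form `g_r + dr²` on `T_pM`, `p ≠ o`. -/
def polarForm (g : ℝ → SphForm m) (p : M) (v w : TangentSpace (𝓡 (m + 1)) p) : ℝ :=
  g (radius Φ p) (angle Φ p)
      (mfderiv (𝓡 (m + 1)) (𝓡 m) (angle Φ) p v) (mfderiv (𝓡 (m + 1)) (𝓡 m) (angle Φ) p w)
    + mvfderiv (𝓡 (m + 1)) (radius Φ) p v * mvfderiv (𝓡 (m + 1)) (radius Φ) p w

/-- The basic model `𝕋_ξ = 𝔹 × (-(1+ξ), 1+ξ)`. -/
def modelT (m : ℕ) (ξ : ℝ) : Set (EuclideanSpace ℝ (Fin m) × ℝ) :=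
  Metric.ball 0 1 ×ˢ Set.Ioo (-(1 + ξ)) (1 + ξ)

/-- The canonical basis of `ℝ^n = ℝ^m × ℝ`. -/
def modelBasis (m : ℕ) : Fin m ⊕ Unit → EuclideanSpace ℝ (Fin m) × ℝ :=
  Sum.elim (fun j => (EuclideanSpace.single j 1, 0)) (fun _ => (0, 1))

/-- The components of the hyperbolic metric `e^{2t} σ_{ℝ^m} + dt²` of the model. -/
def modelMetric (m : ℕ) (jk : (Fin m ⊕ Unit) × (Fin m ⊕ Unit))
    (z : EuclideanSpace ℝ (Fin m) × ℝ) : ℝ :=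
  Real.exp (2 * z.2) * inner ℝ (modelBasis m jk.1).1 (modelBasis m jk.2).1
    + (modelBasis m jk.1).2 * (modelBasis m jk.2).2

/-- The components of `φ^* (g_r + dr²)` on the model. -/
def pullbackCoeff (g : ℝ → SphForm m) (φ : EuclideanSpace ℝ (Fin m) × ℝ → M)
    (jk : (Fin m ⊕ Unit) × (Fin m ⊕ Unit)) (z : EuclideanSpace ℝ (Fin m) × ℝ) : ℝ :=
  polarForm Φ g (φ z)
    (mfderiv 𝓘(ℝ, EuclideanSpace ℝ (Fin m) × ℝ) (𝓡 (m + 1)) φ z (modelBasis m jk.1))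
    (mfderiv 𝓘(ℝ, EuclideanSpace ℝ (Fin m) × ℝ) (𝓡 (m + 1)) φ z (modelBasis m jk.2))

/-- `φ : 𝕋_ξ → M` is a radially `ε`-close to hyperbolic chart with center `p` for the metric
`g_r + dr²`, which is defined on `{r > R}`. -/
structure IsRadialHypChart (R : ℝ) (g : ℝ → SphForm m) (ε ξ : ℝ) (p : M)
    (φ : EuclideanSpace ℝ (Fin m) × ℝ → M) : Prop where
  smooth : ContMDiffOn 𝓘(ℝ, EuclideanSpace ℝ (Fin m) × ℝ) (𝓡 (m + 1)) ∞ φ (modelT m ξ)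
  injOn : Set.InjOn φ (modelT m ξ)
  immersion : ∀ z ∈ modelT m ξ, Function.Injective
    (mfderiv 𝓘(ℝ, EuclideanSpace ℝ (Fin m) × ℝ) (𝓡 (m + 1)) φ z)
  center : φ (0, 0) = p
  range : ∀ z ∈ modelT m ξ, R < radius Φ (φ z)
  radial : ∃ (φ₁ : EuclideanSpace ℝ (Fin m) → Sph m) (a : ℝ), ∀ z ∈ modelT m ξ,
    angle Φ (φ z) = φ₁ z.1 ∧ radius Φ (φ z) = z.2 + a
  close : C2NormLT (modelBasis m) (modelT m ξ)
    (fun jk z => pullbackCoeff Φ g φ jk z - modelMetric m jk z) ε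

/-- The metric `g_r + dr²`, defined on `{r > R}`, is radially `ε`-close to hyperbolic on `S`,
with charts of excess `ξ`. -/
def RadiallyClose (R : ℝ) (g : ℝ → SphForm m) (ε ξ : ℝ) (S : Set M) : Prop :=
  ∀ p ∈ S, ∃ φ, IsRadialHypChart Φ R g ε ξ p φ

/-- The complement of the ball `B_a` of radius `a` centered at `o`. -/
def outsideBall (a : ℝ) : Set M := {p | a ≤ radius Φ p}

/-- `h_r + dr²` is a (smooth Riemannian) metric on `M ∖ {o}` which is `(B_a, ε)`-close to
hyperbolic, with charts of excess `ξ`. -/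
structure BallCloseToHyperbolic (h : ℝ → SphForm m) (a ε ξ : ℝ) : Prop where
  smooth : SmoothFamily (Set.Ioi (0 : ℝ)) h
  inner_form : ∀ r > 0, IsInnerForm (h r)
  hyperbolic : ∀ p : M, 0 < radius Φ p → radius Φ p < a →
    polarForm Φ h p = polarForm Φ (fun r x => (Real.sinh r ^ 2) • roundMetric m x) p
  close : RadiallyClose Φ 0 h ε ξ (outsideBall Φ (a - 1 - ξ))

end Center

/-! ### One-parameter families -/

/-- A `⊙`-family `g_λ = (g_λ)_r + dr²`, `λ ≥ lam₀`, of metrics: `g_λ` is defined for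
`r > R λ`, hence at least for `r > λ - (1 + ξ)`, and depends smoothly on all variables. -/
structure IsOdotFamily {m : ℕ} (ξ lam₀ : ℝ) (R : ℝ → ℝ) (g : ℝ → ℝ → SphForm m) : Prop where
  lam₀_gt : 1 + ξ < lam₀
  domain : ∀ lam ≥ lam₀, 0 ≤ R lam ∧ R lam ≤ lam - (1 + ξ)
  smooth : SmoothFamily {q : ℝ × ℝ | lam₀ ≤ q.1 ∧ R q.1 < q.2} (fun q => g q.1 q.2)
  inner_form : ∀ lam ≥ lam₀, ∀ r > R lam, IsInnerForm (g lam r)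

/-- The family has a cut limit at `b = 0`: the spherical cuts of `g_λ` at `λ` converge in the
`C²`-norm to a `C²` metric of the sphere. -/
def HasCutLimitAtZero {m : ℕ} (𝒜 : SphereAtlas m) (g : ℝ → ℝ → SphForm m) : Prop :=
  ∃ gInf : Bundle.ContMDiffRiemannianMetric (𝓡 m) 2 (EuclideanSpace ℝ (Fin m))
      (fun x : Sph m => TangentSpace (𝓡 m) x),
    ∀ δ > 0, ∃ L : ℝ, ∀ lam ≥ L, 𝒜.NormLT (fun x => sphericalCut (g lam) lam x - gInf.inner x) δ

end

/-! Write σ for the round metric and ĝ for the spherical cut of g_λ at λ. In a radial chart (y, t) ↦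
(φ₁(y), t + a) a metric h_r + dr² pulls back to φ₁^* h_{t+a} + dt². The dt-components agree with
those of the model, so closeness to hyperbolic means that the functions φ₁^* h_{t+a} are C²-close to
e^{2t} times the Euclidean metric. The charts of the result have |t| < ξ. Let a be the radius of
their center p; two regimes meet at a = λ - ξ.

If a ≥ λ - ξ, the trick cutoff is already 1 on the chart and the given chart of g_λ at p is reused.
If the smaller chart reaches the forcing zone, the larger one contains the sphere r = λ, at t₀ = λ -
a. Where g_λ reads e^{2t}δ + u, forcing replaces it by a convex combination of itself and (sinh r /
sinh λ)² (e^{2t₀}δ + u(y, t₀)). Since sinh(x + λ)/sinh λ = e^x + O(e^{-λ}), the terms in δ recombine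
to e^{2t}δ up to O(e^{-λ}), and u contributes O(ε). The constant comes from one-variable functions
alone, so it depends neither on the dimension nor on c; this is C₂ (`exists_c2Le_forced`,
`exists_isRadialHypChart_hypForcing_of_le`).

If a ≤ λ - ξ, the chart stays in r < λ, where the forced metric is sinh²(r) ((1 - θ) σ + θ ĝ) + dr²
with θ varying at rate O(1/d). A new chart is built: in an atlas chart take a frame orthonormal for
the interpolated form at p and shrink it by s ≈ 2e^{-a}. Then s² sinh²(t + a) = e^{2t}(1 +
O(e^{-a})), the y-oscillation of the coefficients is O(s), and their t-oscillation is O(1/d). Being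
c-bounded controls the coefficients and the frame, so the error is at most B(c) (e^{-a} + 1/d)
(`exists_close_of_cBounded`). As a ≥ λ - d - ξ, conditions (i) and (ii) bound this by ε' for C₁ = C₂
+ e^ξ B(c).

Smoothness and positivity hold because hyperbolic forcing is a nested convex combination in which
g_r only enters for r > λ. A common c exists by compactness of [λ₀, L] together with closeness to
the limit metric beyond L. -/

noncomputable section

/-! ### Functions with bounded `C²`-norm -/

/-- `f` is `C²` at the points of `s`, and its partial derivatives of order at most two in the
directions `b j` are bounded by `K` on `s`. -/
structure C2Le {V J : Type*} [NormedAddCommGroup V] [NormedSpace ℝ V]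
    (b : J → V) (s : Set V) (f : V → ℝ) (K : ℝ) : Prop where
  contDiffAt : ∀ z ∈ s, ContDiffAt ℝ 2 f z
  val : ∀ z ∈ s, |f z| ≤ K
  fst : ∀ z ∈ s, ∀ j, |fderiv ℝ f z (b j)| ≤ K
  snd : ∀ z ∈ s, ∀ j k, |fderiv ℝ (fderiv ℝ f) z (b j) (b k)| ≤ K

section C2

variable {V J : Type*} [NormedAddCommGroup V] [NormedSpace ℝ V]
  {b : J → V} {s : Set V} {f g : V → ℝ} {K L : ℝ}

theorem ContDiffAt.differentiableAt_fderiv_of_two {F : Type*} [NormedAddCommGroup F]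
    [NormedSpace ℝ F] {f : V → F} {z : V} (h : ContDiffAt ℝ 2 f z) :
    DifferentiableAt ℝ (fderiv ℝ f) z :=
  (h.fderiv_right (m := 1) (by norm_num)).differentiableAt (by norm_num)

theorem C2Le.of_iteratedFDeriv (h : ∀ z ∈ s, ContDiffAt ℝ 2 f z)
    (hK : ∀ z ∈ s, ∀ k ≤ 2, ∀ j : Fin k → J,
      |iteratedFDeriv ℝ k f z (fun l => b (j l))| ≤ K) : C2Le b s f K where
  contDiffAt := h
  val z hz := by simpa using hK z hz 0 (by norm_num) Fin.elim0
  fst z hz j := by simpa using hK z hz 1 (by norm_num) (fun _ => j)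
  snd z hz j k := by simpa [iteratedFDeriv_two_apply] using hK z hz 2 le_rfl ![j, k]

theorem C2Le.iteratedFDeriv_le (h : C2Le b s f K) :
    ∀ z ∈ s, ∀ k ≤ 2, ∀ j : Fin k → J, |iteratedFDeriv ℝ k f z (fun l => b (j l))| ≤ K := by
  intro z hz k hk j
  interval_cases k
  · simpa using h.val z hz
  · simpa using h.fst z hz (j 0)
  · simpa [iteratedFDeriv_two_apply] using h.snd z hz (j 0) (j 1)

theorem C2Le.mono (h : C2Le b s f K) (hKL : K ≤ L) : C2Le b s f L :=
  ⟨h.1, fun z hz => (h.2 z hz).trans hKL, fun z hz j => (h.3 z hz j).trans hKL,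
    fun z hz j k => (h.4 z hz j k).trans hKL⟩

theorem C2Le.mono_set {t : Set V} (h : C2Le b s f K) (hts : t ⊆ s) : C2Le b t f K :=
  ⟨fun z hz => h.1 z (hts hz), fun z hz => h.2 z (hts hz), fun z hz => h.3 z (hts hz),
    fun z hz => h.4 z (hts hz)⟩

/-- Openness of s is needed: the derivatives at a point see a whole neighbourhood. -/
theorem C2Le.congr (h : C2Le b s f K) (hs : IsOpen s) (hfg : ∀ z ∈ s, g z = f z) :
    C2Le b s g K := by
  have key : ∀ z ∈ s, g =ᶠ[nhds z] f := fun z hz =>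
    Filter.eventuallyEq_of_mem (hs.mem_nhds hz) hfg
  refine ⟨fun z hz => (h.1 z hz).congr_of_eventuallyEq (key z hz), fun z hz => ?_,
    fun z hz j => ?_, fun z hz j k => ?_⟩
  · rw [hfg z hz]; exact h.2 z hz
  · rw [(key z hz).fderiv_eq]; exact h.3 z hz j
  · rw [(key z hz).fderiv.fderiv_eq]; exact h.4 z hz j k

theorem C2Le.const (c : ℝ) : C2Le b s (fun _ => c) |c| := by
  refine ⟨fun z _ => contDiffAt_const, fun z _ => le_rfl, fun z _ j => ?_, fun z _ j k => ?_⟩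
  · simp
  · have : fderiv ℝ (fun _ : V => c) = fun _ => 0 := by ext; simp
    simp [this]

theorem C2Le.add (hf : C2Le b s f K) (hg : C2Le b s g L) :
    C2Le b s (fun z => f z + g z) (K + L) := by
  have d : ∀ z ∈ s, ∀ᶠ w in nhds z, fderiv ℝ (fun z => f z + g z) w = fderiv ℝ f w + fderiv ℝ g w := by
    intro z hz
    filter_upwards [(hf.1 z hz).eventually (by simp), (hg.1 z hz).eventually (by simp)] with w h1 h2
    exact fderiv_fun_add (h1.differentiableAt (by norm_num)) (h2.differentiableAt (by norm_num))
  refine ⟨fun z hz => (hf.1 z hz).add (hg.1 z hz), fun z hz => ?_, fun z hz j => ?_,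
    fun z hz j k => ?_⟩
  · exact (abs_add_le _ _).trans (add_le_add (hf.2 z hz) (hg.2 z hz))
  · rw [(d z hz).self_of_nhds]
    exact (abs_add_le _ _).trans (add_le_add (hf.3 z hz j) (hg.3 z hz j))
  · rw [Filter.EventuallyEq.fderiv_eq (d z hz),
      fderiv_fun_add (hf.1 z hz).differentiableAt_fderiv_of_two
        (hg.1 z hz).differentiableAt_fderiv_of_two]
    exact (abs_add_le _ _).trans (add_le_add (hf.4 z hz j k) (hg.4 z hz j k))

/-- The factor 4 counts the terms in the second derivative of a product. -/
theorem C2Le.mul (hf : C2Le b s f K) (hg : C2Le b s g L) :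
    C2Le b s (fun z => f z * g z) (4 * K * L) := by
  have d : ∀ z ∈ s, ∀ᶠ w in nhds z,
      fderiv ℝ (fun z => f z * g z) w = f w • fderiv ℝ g w + g w • fderiv ℝ f w := by
    intro z hz
    filter_upwards [(hf.1 z hz).eventually (by simp), (hg.1 z hz).eventually (by simp)] with w h1 h2
    exact fderiv_fun_mul (h1.differentiableAt (by norm_num)) (h2.differentiableAt (by norm_num))
  have bd : ∀ x y : ℝ, |x| ≤ K → |y| ≤ L → |x * y| ≤ K * L := fun x y hx hy => by
    rw [abs_mul]; exact mul_le_mul hx hy (abs_nonneg _) ((abs_nonneg _).trans hx)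
  have bd' : ∀ x y : ℝ, |x| ≤ L → |y| ≤ K → |x * y| ≤ K * L := fun x y hx hy => by
    rw [mul_comm]; exact bd _ _ hy hx
  -- Neither constant is assumed nonnegative; the sign follows only at an actual point of s.
  have nn : ∀ z ∈ s, 0 ≤ K * L := fun z hz =>
    (abs_nonneg _).trans (bd _ _ (hf.2 z hz) (hg.2 z hz))
  refine ⟨fun z hz => (hf.1 z hz).mul (hg.1 z hz), fun z hz => ?_, fun z hz j => ?_,
    fun z hz j k => ?_⟩
  · have := bd _ _ (hf.2 z hz) (hg.2 z hz)
    have := nn z hz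
    linarith
  · rw [(d z hz).self_of_nhds]
    have h1 := bd _ _ (hf.2 z hz) (hg.3 z hz j)
    have h2 := bd' _ _ (hg.2 z hz) (hf.3 z hz j)
    have h3 := abs_add_le (f z * fderiv ℝ g z (b j)) (g z * fderiv ℝ f z (b j))
    have := nn z hz
    simp only [add_apply, smul_apply, smul_eq_mul]
    linarith
  · have f1 := (hf.1 z hz).differentiableAt (by norm_num)
    have g1 := (hg.1 z hz).differentiableAt (by norm_num)
    have f2 := (hf.1 z hz).differentiableAt_fderiv_of_two
    have g2 := (hg.1 z hz).differentiableAt_fderiv_of_two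
    rw [Filter.EventuallyEq.fderiv_eq (d z hz), fderiv_fun_add (f1.fun_smul g2) (g1.fun_smul f2),
      fderiv_fun_smul f1 g2, fderiv_fun_smul g1 f2]
    simp only [add_apply, smul_apply, smul_eq_mul,
      ContinuousLinearMap.smulRight_apply]
    have h1 := bd _ _ (hf.2 z hz) (hg.4 z hz j k)
    have h2 := bd _ _ (hf.3 z hz j) (hg.3 z hz k)
    have h3 := bd' _ _ (hg.2 z hz) (hf.4 z hz j k)
    have h4 := bd' _ _ (hg.3 z hz j) (hf.3 z hz k)
    rw [abs_le] at *
    constructor <;> linarith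

theorem C2Le.const_mul (c : ℝ) (hf : C2Le b s f K) : C2Le b s (fun z => c * f z) (|c| * K) := by
  have d : ∀ z ∈ s, ∀ᶠ w in nhds z, fderiv ℝ (fun z => c * f z) w = c • fderiv ℝ f w := by
    intro z hz
    filter_upwards [(hf.1 z hz).eventually (by simp)] with w h1
    exact fderiv_const_mul (h1.differentiableAt (by norm_num)) c
  refine ⟨fun z hz => contDiffAt_const.mul (hf.1 z hz), fun z hz => ?_, fun z hz j => ?_,
    fun z hz j k => ?_⟩
  · rw [abs_mul]; exact mul_le_mul_of_nonneg_left (hf.2 z hz) (abs_nonneg c)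
  · rw [(d z hz).self_of_nhds]
    simpa [abs_mul] using mul_le_mul_of_nonneg_left (hf.3 z hz j) (abs_nonneg c)
  · rw [Filter.EventuallyEq.fderiv_eq (d z hz),
      fderiv_fun_const_smul (hf.1 z hz).differentiableAt_fderiv_of_two]
    simpa [abs_mul] using mul_le_mul_of_nonneg_left (hf.4 z hz j k) (abs_nonneg c)

theorem C2Le.sub (hf : C2Le b s f K) (hg : C2Le b s g L) :
    C2Le b s (fun z => f z - g z) (K + L) := by
  have := hf.add (hg.const_mul (-1))
  simpa [sub_eq_add_neg] using this

theorem C2Le.sum {ι : Type*} (t : Finset ι) {f : ι → V → ℝ} {K : ι → ℝ}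
    (h : ∀ i ∈ t, C2Le b s (f i) (K i)) :
    C2Le b s (fun z => ∑ i ∈ t, f i z) (∑ i ∈ t, K i) := by
  classical
  induction t using Finset.induction_on with
  | empty => simpa using C2Le.const (b := b) (s := s) 0
  | insert i t hi ih =>
    simp only [Finset.sum_insert hi]
    exact (h i (by simp)).add (ih fun j hj => h j (by simp [hj]))

end C2

/-! ### Composition with affine maps -/

section Comp

variable {V W J I : Type*} [NormedAddCommGroup V] [NormedSpace ℝ V] [NormedAddCommGroup W]
  [NormedSpace ℝ W] {b : J → V} {T : Set V} {f : V → ℝ} {K κ : ℝ} {b' : I → W} {s : Set W}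

theorem fderiv_comp_affine {F : Type*} [NormedAddCommGroup F] [NormedSpace ℝ F] {f : V → F}
    (z₀ : V) (L : W →L[ℝ] V) {z : W} (hf : DifferentiableAt ℝ f (z₀ + L z)) :
    fderiv ℝ (fun w => f (z₀ + L w)) z = (fderiv ℝ f (z₀ + L z)).comp L := by
  have h := hf.hasFDerivAt.comp z (L.hasFDerivAt.const_add z₀)
  exact h.fderiv

theorem fderiv_fderiv_comp_affine (z₀ : V) (L : W →L[ℝ] V) {z : W}
    (hf : ContDiffAt ℝ 2 f (z₀ + L z)) (v w : W) :
    fderiv ℝ (fderiv ℝ (fun w => f (z₀ + L w))) z v w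
      = fderiv ℝ (fderiv ℝ f) (z₀ + L z) (L v) (L w) := by
  have hc : ContinuousAt (fun w => z₀ + L w) z := by fun_prop
  have : fderiv ℝ (fun w => f (z₀ + L w)) =ᶠ[nhds z]
      fun w => (ContinuousLinearMap.compL ℝ W V ℝ).flip L (fderiv ℝ f (z₀ + L w)) := by
    filter_upwards [hc.eventually (hf.eventually (by simp))] with w hw
    rw [fderiv_comp_affine z₀ L (hw.differentiableAt (by norm_num))]
    rfl
  rw [this.fderiv_eq]
  have h2 := hf.differentiableAt_fderiv_of_two
  have h3 := ((ContinuousLinearMap.compL ℝ W V ℝ).flip L).hasFDerivAt.comp z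
    (h2.hasFDerivAt.comp z (L.hasFDerivAt.const_add z₀))
  rw [show (fun w => (ContinuousLinearMap.compL ℝ W V ℝ).flip L (fderiv ℝ f (z₀ + L w))) =
    ((ContinuousLinearMap.compL ℝ W V ℝ).flip L) ∘ (fderiv ℝ f ∘ fun w => z₀ + L w) from rfl,
    h3.fderiv]
  rfl

/-- Duality of ℓ¹ and ℓ^∞: only the sum of the |α j| matters, not the number of basis vectors. This
keeps later constants free of the dimension. -/
theorem abs_sum_smul_le [Fintype J] {α : J → ℝ} (A : V →ₗ[ℝ] ℝ) (hA : ∀ j, |A (b j)| ≤ K)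
    (hα : ∑ j, |α j| ≤ κ) (hK : 0 ≤ K) : |A (∑ j, α j • b j)| ≤ κ * K := by
  rw [map_sum]
  refine (Finset.abs_sum_le_sum_abs _ _).trans ?_
  calc ∑ j, |A (α j • b j)| ≤ ∑ j, |α j| * K := by
        refine Finset.sum_le_sum fun j _ => ?_
        rw [map_smul, smul_eq_mul, abs_mul]
        exact mul_le_mul_of_nonneg_left (hA j) (abs_nonneg _)
    _ ≤ κ * K := by rw [← Finset.sum_mul]; exact mul_le_mul_of_nonneg_right hα hK

variable [Fintype J] (hf : C2Le b T f K) (z₀ : V) (L : W →L[ℝ] V) (hL : ∀ z ∈ s, z₀ + L z ∈ T)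
  (α : I → J → ℝ) (hα : ∀ i, L (b' i) = ∑ j, α i j • b j)

include hf hL hα in
theorem C2Le.comp_affine_fst (hκ : ∀ i, ∑ j, |α i j| ≤ κ) :
    ∀ z ∈ s, ∀ i, |fderiv ℝ (fun z => f (z₀ + L z)) z (b' i)| ≤ κ * K := by
  intro z hz i
  have hT := hL z hz
  rw [fderiv_comp_affine z₀ L ((hf.1 _ hT).differentiableAt (by norm_num)),
    ContinuousLinearMap.comp_apply, hα]
  exact abs_sum_smul_le (fderiv ℝ f (z₀ + L z)).toLinearMap (hf.3 _ hT) (hκ i)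
    ((abs_nonneg _).trans (hf.2 _ hT))

include hf hL hα in
theorem C2Le.comp_affine_snd (hκ : ∀ i, ∑ j, |α i j| ≤ κ) :
    ∀ z ∈ s, ∀ i j, |fderiv ℝ (fderiv ℝ (fun z => f (z₀ + L z))) z (b' i) (b' j)|
      ≤ κ * (κ * K) := by
  intro z hz i j
  have hT := hL z hz
  have hK := (abs_nonneg _).trans (hf.2 _ hT)
  have hκ0 : 0 ≤ κ := (Finset.sum_nonneg fun j _ => abs_nonneg _).trans (hκ i)
  rw [fderiv_fderiv_comp_affine z₀ L (hf.1 _ hT), hα i, hα j]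
  refine abs_sum_smul_le (((fderiv ℝ (fderiv ℝ f) (z₀ + L z)).flip
    (∑ x, α j x • b x))).toLinearMap (fun l => ?_) (hκ i) (by positivity)
  exact abs_sum_smul_le (fderiv ℝ (fderiv ℝ f) (z₀ + L z) (b l)).toLinearMap
    (fun k => hf.4 _ hT l k) (hκ j) hK

include hf hL hα in
-- Each basis vector goes to a combination with coefficients of ℓ¹-norm at most 1, so each
-- derivative costs a factor at most 1 and K is unchanged.
theorem C2Le.comp_affine (hκ : ∀ i, ∑ j, |α i j| ≤ 1) :
    C2Le b' s (fun z => f (z₀ + L z)) K := by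
  refine ⟨fun z hz => (hf.1 _ (hL z hz)).comp z (by fun_prop), fun z hz => hf.2 _ (hL z hz),
    fun z hz i => ?_, fun z hz i j => ?_⟩
  · simpa using hf.comp_affine_fst z₀ L hL α hα hκ z hz i
  · simpa using hf.comp_affine_snd z₀ L hL α hα hκ z hz i j

end Comp

/-! ### Smooth families of forms on the sphere -/

/-- The version of `SmoothFamily` for `C^n` dependence. -/
def CkFamily {m : ℕ} {P : Type} [NormedAddCommGroup P] [NormedSpace ℝ P] (n : WithTop ℕ∞)
    (D : Set P) (γ : P → SphForm m) : Prop :=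
  ContMDiffOn (𝓘(ℝ, P).prod (𝓡 m))
    ((𝓡 m).prod 𝓘(ℝ, EuclideanSpace ℝ (Fin m) →L[ℝ] EuclideanSpace ℝ (Fin m) →L[ℝ] ℝ)) n
    (fun q : P × Sph m =>
      Bundle.TotalSpace.mk' (EuclideanSpace ℝ (Fin m) →L[ℝ] EuclideanSpace ℝ (Fin m) →L[ℝ] ℝ)
        (E := fun x : Sph m => TangentSpace (𝓡 m) x →L[ℝ] TangentSpace (𝓡 m) x →L[ℝ] ℝ)
        q.2 (γ q.1 q.2))
    (D ×ˢ Set.univ)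

/-! ### Sections of a vector bundle along a map -/

section Along

open Bundle

variable {B F M : Type*} {n : WithTop ℕ∞} {E : B → Type*} [NormedAddCommGroup F] [NormedSpace ℝ F]
  [TopologicalSpace (TotalSpace F E)] [∀ x, TopologicalSpace (E x)] [∀ x, AddCommGroup (E x)]
  [∀ x, Module ℝ (E x)] {EB : Type*} [NormedAddCommGroup EB] [NormedSpace ℝ EB]
  {HB : Type*} [TopologicalSpace HB] {IB : ModelWithCorners ℝ EB HB} [TopologicalSpace B]
  [ChartedSpace HB B] {EM : Type*} [NormedAddCommGroup EM] [NormedSpace ℝ EM] {HM : Type*}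
  [TopologicalSpace HM] {IM : ModelWithCorners ℝ EM HM} [TopologicalSpace M] [ChartedSpace HM M]
  [FiberBundle F E] [VectorBundle ℝ F E] {β : M → B} {u v : ∀ x, E (β x)} {s : Set M} {x : M}

/-- Regularity is tested in the trivialization at β x, which is linear on the fibres over nearby
base points. -/
theorem ContMDiffWithinAt.add_along
    (hu : ContMDiffWithinAt IM (IB.prod 𝓘(ℝ, F)) n (fun y => TotalSpace.mk' F (β y) (u y)) s x)
    (hv : ContMDiffWithinAt IM (IB.prod 𝓘(ℝ, F)) n (fun y => TotalSpace.mk' F (β y) (v y)) s x) :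
    ContMDiffWithinAt IM (IB.prod 𝓘(ℝ, F)) n
      (fun y => TotalSpace.mk' F (β y) (u y + v y)) s x := by
  rw [contMDiffWithinAt_totalSpace] at hu hv ⊢
  refine ⟨hu.1, (hu.2.add hv.2).congr_of_eventuallyEq ?_ ?_⟩
  · filter_upwards [hu.1.continuousWithinAt.eventually
      ((trivializationAt F E (β x)).open_baseSet.mem_nhds (mem_baseSet_trivializationAt F E _))]
      with y hy
    exact ((trivializationAt F E (β x)).linear ℝ hy).map_add _ _
  · exact ((trivializationAt F E (β x)).linear ℝ (mem_baseSet_trivializationAt F E _)).map_add _ _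

theorem ContMDiffWithinAt.smul_along {f : M → ℝ} (hf : ContMDiffWithinAt IM 𝓘(ℝ, ℝ) n f s x)
    (hu : ContMDiffWithinAt IM (IB.prod 𝓘(ℝ, F)) n (fun y => TotalSpace.mk' F (β y) (u y)) s x) :
    ContMDiffWithinAt IM (IB.prod 𝓘(ℝ, F)) n
      (fun y => TotalSpace.mk' F (β y) (f y • u y)) s x := by
  rw [contMDiffWithinAt_totalSpace] at hu ⊢
  refine ⟨hu.1, (hf.smul hu.2).congr_of_eventuallyEq ?_ ?_⟩
  · filter_upwards [hu.1.continuousWithinAt.eventually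
      ((trivializationAt F E (β x)).open_baseSet.mem_nhds (mem_baseSet_trivializationAt F E _))]
      with y hy
    exact ((trivializationAt F E (β x)).linear ℝ hy).map_smul _ _
  · exact ((trivializationAt F E (β x)).linear ℝ (mem_baseSet_trivializationAt F E _)).map_smul _ _

end Along

section Families

variable {m : ℕ} {P Q : Type} [NormedAddCommGroup P] [NormedSpace ℝ P]
  [NormedAddCommGroup Q] [NormedSpace ℝ Q] {n : WithTop ℕ∞} {D : Set P} {γ γ' : P → SphForm m}

theorem CkFamily.mono (h : CkFamily n D γ) {D' : Set P} (hD : D' ⊆ D) : CkFamily n D' γ :=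
  ContMDiffOn.mono h (Set.prod_mono hD subset_rfl)

theorem CkFamily.comp (h : CkFamily n D γ) {D' : Set Q} {f : Q → P} (hf : ContDiffOn ℝ n f D')
    (hD : Set.MapsTo f D' D) : CkFamily n D' (fun q => γ (f q)) := by
  have h1 : ContMDiffOn (𝓘(ℝ, Q).prod (𝓡 m)) (𝓘(ℝ, P).prod (𝓡 m)) n
      (fun q : Q × Sph m => (f q.1, q.2)) (D' ×ˢ Set.univ) :=
    (hf.contMDiffOn.comp contMDiffOn_fst fun q hq => hq.1).prodMk contMDiffOn_snd
  exact ContMDiffOn.comp (t := D ×ˢ Set.univ) h h1 fun q hq => ⟨hD hq.1, trivial⟩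

/-- This is the tangent map of ψ composed with the constant section v, at the cost of one order of
differentiability. -/
theorem contMDiffOn_mfderiv_section {W : Type*} [NormedAddCommGroup W] [NormedSpace ℝ W]
    {ψ : W → Sph m} {U : Set W} {n' : WithTop ℕ∞} (hU : IsOpen U)
    (hψ : ContMDiffOn 𝓘(ℝ, W) (𝓡 m) n' ψ U) (hn : n + 1 ≤ n') (v : W) :
    ContMDiffOn 𝓘(ℝ, W) ((𝓡 m).prod 𝓘(ℝ, EuclideanSpace ℝ (Fin m))) n
      (fun y => Bundle.TotalSpace.mk' (EuclideanSpace ℝ (Fin m))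
        (E := fun x : Sph m => TangentSpace (𝓡 m) x) (ψ y) (mfderiv 𝓘(ℝ, W) (𝓡 m) ψ y v)) U := by
  have h1 := hψ.contMDiffOn_tangentMapWithin hn hU.uniqueMDiffOn
  have h2 : ContMDiffOn 𝓘(ℝ, W) (𝓘(ℝ, W).prod 𝓘(ℝ, W)) n
      (fun y => (⟨y, v⟩ : TangentBundle 𝓘(ℝ, W) W)) U := by
    exact contMDiffOn_vectorSpace_iff_contDiffOn.2 (contDiffOn_const (c := v))
  refine (h1.comp h2 fun y hy => hy).congr fun y hy => ?_
  simp only [tangentMapWithin, Function.comp]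
  rw [mfderivWithin_of_isOpen hU hy]

/-- Bridge from the bundle formulation to calculus: pulled-back components are ordinary functions of
parameter and point, with the regularity of the family. -/
theorem CkFamily.contDiffOn_pullback (h : CkFamily n D γ) {W : Type*} [NormedAddCommGroup W]
    [NormedSpace ℝ W] {ψ : W → Sph m} {U : Set W} {n' : WithTop ℕ∞} (hU : IsOpen U)
    (hψ : ContMDiffOn 𝓘(ℝ, W) (𝓡 m) n' ψ U) (hn : n + 1 ≤ n') (v w : W) :
    ContDiffOn ℝ n (fun q : P × W => γ q.1 (ψ q.2) (mfderiv 𝓘(ℝ, W) (𝓡 m) ψ q.2 v)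
      (mfderiv 𝓘(ℝ, W) (𝓡 m) ψ q.2 w)) (D ×ˢ U) := by
  have hsnd : ContMDiffOn 𝓘(ℝ, P × W) 𝓘(ℝ, W) n (Prod.snd : P × W → W) (D ×ˢ U) :=
    contDiff_snd.contDiffOn.contMDiffOn
  have hv := (contMDiffOn_mfderiv_section hU hψ hn v).comp hsnd fun q hq => hq.2
  have hw := (contMDiffOn_mfderiv_section hU hψ hn w).comp hsnd fun q hq => hq.2
  have hfst : ContMDiffOn 𝓘(ℝ, P × W) 𝓘(ℝ, P) n (Prod.fst : P × W → P) (D ×ˢ U) :=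
    contDiff_fst.contDiffOn.contMDiffOn
  have hψ' : ContMDiffOn 𝓘(ℝ, P × W) (𝓡 m) n (fun q : P × W => ψ q.2) (D ×ˢ U) :=
    (hψ.of_le (le_self_add.trans hn)).comp hsnd fun q hq => hq.2
  have hγ := ContMDiffOn.comp h (hfst.prodMk hψ') fun q hq => ⟨hq.1, trivial⟩
  have key := ContMDiffOn.clm_bundle_apply₂ (F₁ := EuclideanSpace ℝ (Fin m))
    (F₂ := EuclideanSpace ℝ (Fin m)) (F₃ := ℝ)
    (E₁ := fun x : Sph m => TangentSpace (𝓡 m) x) (E₂ := fun x : Sph m => TangentSpace (𝓡 m) x)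
    (E₃ := fun _ : Sph m => ℝ) (b := fun q : P × W => ψ q.2)
    (ψ := fun q => γ q.1 (ψ q.2)) hγ hv hw
  rw [← contMDiffOn_iff_contDiffOn]
  intro q hq
  have := (Bundle.contMDiffWithinAt_totalSpace.1 (key q hq)).2
  simpa using this

theorem CkFamily.add (h : CkFamily n D γ) (h' : CkFamily n D γ') :
    CkFamily n D (fun q x => γ q x + γ' q x) :=
  fun q hq => ContMDiffWithinAt.add_along (h q hq) (h' q hq)

theorem CkFamily.smul (h : CkFamily n D γ) {f : P → ℝ} (hf : ContDiffOn ℝ n f D) :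
    CkFamily n D (fun q x => f q • γ q x) := by
  intro q hq
  have h2 : ContMDiffWithinAt (𝓘(ℝ, P).prod (𝓡 m)) 𝓘(ℝ, ℝ) n (fun q : P × Sph m => f q.1)
      (D ×ˢ Set.univ) q :=
    (hf.contMDiffOn.comp contMDiffOn_fst fun q hq => hq.1) q hq
  exact ContMDiffWithinAt.smul_along h2 (h q hq)

theorem CkFamily.of_locally (h : ∀ q ∈ D, ∃ u : Set P, IsOpen u ∧ q ∈ u ∧
    CkFamily n (D ∩ u) γ) : CkFamily n D γ := by
  intro q hq
  obtain ⟨u, hu, hqu, h1⟩ := h q.1 hq.1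
  have h2 := h1 q ⟨⟨hq.1, hqu⟩, trivial⟩
  refine h2.mono_of_mem_nhdsWithin ?_
  refine mem_nhdsWithin.2 ⟨u ×ˢ Set.univ, hu.prod isOpen_univ, ⟨hqu, trivial⟩, ?_⟩
  rintro ⟨a, b⟩ ⟨⟨h3, -⟩, h4, -⟩
  exact ⟨⟨h4, h3⟩, trivial⟩

theorem CkFamily.congr (h : CkFamily n D γ) (hγ : ∀ q ∈ D, γ' q = γ q) : CkFamily n D γ' :=
  ContMDiffOn.congr h fun q hq => by rw [hγ q.1 hq.1]

/-! ### The round metric -/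

theorem contMDiff_coe_sph (m : ℕ) (n : WithTop ℕ∞) :
    ContMDiff (𝓡 m) 𝓘(ℝ, EuclideanSpace ℝ (Fin (m + 1))) n
      (fun y : Sph m => (y : EuclideanSpace ℝ (Fin (m + 1)))) :=
  haveI : Fact (Module.finrank ℝ (EuclideanSpace ℝ (Fin (m + 1))) = m + 1) := ⟨by simp⟩
  contMDiff_coe_sphere

theorem injective_sphereInclDeriv (x : Sph m) : Function.Injective (sphereInclDeriv m x) :=
  haveI : Fact (Module.finrank ℝ (EuclideanSpace ℝ (Fin (m + 1))) = m + 1) := ⟨by simp⟩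
  injective_mvfderiv_subtypeVal_sphere x

theorem roundMetric_apply (x : Sph m) (v w : TangentSpace (𝓡 m) x) :
    roundMetric m x v w = inner ℝ (sphereInclDeriv m x v) (sphereInclDeriv m x w) := rfl

theorem isInnerForm_roundMetric (m : ℕ) : IsInnerForm (roundMetric m) := by
  refine ⟨fun x v w => ?_, fun x v hv => ?_⟩
  · rw [roundMetric_apply, roundMetric_apply, real_inner_comm]
  · rw [roundMetric_apply]
    refine real_inner_self_pos.2 fun h => hv ?_
    exact injective_sphereInclDeriv x (h.trans (map_zero _).symm)

instance (m : ℕ) : IsManifold (𝓡 m) ω (Sph m) :=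
  haveI : Fact (Module.finrank ℝ (EuclideanSpace ℝ (Fin (m + 1))) = m + 1) := ⟨by simp⟩
  EuclideanSpace.instIsManifoldSphere

/-- In bundle coordinates the round metric is the Euclidean inner product pulled back by the
derivative of the inclusion. That derivative is smooth in coordinates, and pulling back by D is
quadratic in D. -/
theorem contMDiff_roundMetric (m : ℕ) :
    ContMDiff (𝓡 m) ((𝓡 m).prod 𝓘(ℝ, EuclideanSpace ℝ (Fin m) →L[ℝ] EuclideanSpace ℝ (Fin m) →L[ℝ] ℝ)) ∞
      (fun x : Sph m => Bundle.TotalSpace.mk'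
        (EuclideanSpace ℝ (Fin m) →L[ℝ] EuclideanSpace ℝ (Fin m) →L[ℝ] ℝ)
        (E := fun x : Sph m => TangentSpace (𝓡 m) x →L[ℝ] TangentSpace (𝓡 m) x →L[ℝ] ℝ)
        x (roundMetric m x)) := by
  intro x₀
  rw [contMDiffAt_hom_bundle]
  refine ⟨contMDiffAt_id, ?_⟩
  have h1 := ContMDiffAt.mfderiv_const (m := ∞) (n := ∞) (contMDiff_coe_sph m ∞ x₀) (by simp)
  let B : (EuclideanSpace ℝ (Fin m) →L[ℝ] EuclideanSpace ℝ (Fin (m + 1))) →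
      (EuclideanSpace ℝ (Fin m) →L[ℝ] EuclideanSpace ℝ (Fin m) →L[ℝ] ℝ) := fun D =>
    (innerSL ℝ : EuclideanSpace ℝ (Fin (m + 1)) →L[ℝ]
      EuclideanSpace ℝ (Fin (m + 1)) →L[ℝ] ℝ).bilinearComp D D
  have hB : ContDiff ℝ ∞ B := by
    refine contDiff_clm_apply_iff.2 fun v => contDiff_clm_apply_iff.2 fun w => ?_
    exact (contDiff_id.clm_apply contDiff_const).inner ℝ (contDiff_id.clm_apply contDiff_const)
  refine (hB.contMDiff.contMDiffAt.comp x₀ h1).congr_of_eventuallyEq ?_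
  have hev : ∀ᶠ x in nhds x₀, x ∈ (trivializationAt (EuclideanSpace ℝ (Fin m) →L[ℝ] ℝ)
      (fun b : Sph m => TangentSpace (𝓡 m) b →L[ℝ] ℝ) x₀).baseSet :=
    (trivializationAt (EuclideanSpace ℝ (Fin m) →L[ℝ] ℝ)
      (fun b : Sph m => TangentSpace (𝓡 m) b →L[ℝ] ℝ) x₀).open_baseSet.mem_nhds
      (FiberBundle.mem_baseSet_trivializationAt' x₀)
  filter_upwards [hev] with x hx
  ext v w
  simp only [ContinuousLinearMap.inCoordinates, ContinuousLinearMap.comp_apply]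
  rw [Bundle.Trivialization.continuousLinearMapAt_apply,
    Bundle.Trivialization.linearMapAt_apply, if_pos hx, hom_trivializationAt_apply]
  simp [B, inTangentCoordinates, ContinuousLinearMap.inCoordinates]
  rfl

theorem ckFamily_roundMetric (m : ℕ) (D : Set P) : CkFamily ∞ D (fun _ => roundMetric m) :=
  (contMDiff_roundMetric m).comp_contMDiffOn contMDiffOn_snd

end Families

/-! ### Polar coordinates -/

section Polar

variable {m : ℕ}

/-- The radial projection of `ℝ^(m+1) ∖ {0}` to the sphere (with an arbitrary value at `0`). -/
def radialProj (x : EuclideanSpace ℝ (Fin (m + 1))) : Sph m :=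
  open Classical in
  if h : x = 0 then ⟨EuclideanSpace.single 0 1, by simp⟩
  else ⟨‖x‖⁻¹ • x, by simp [norm_smul, h]⟩

theorem coe_radialProj {x : EuclideanSpace ℝ (Fin (m + 1))} (hx : x ≠ 0) :
    (radialProj x : EuclideanSpace ℝ (Fin (m + 1))) = ‖x‖⁻¹ • x := by
  simp [radialProj, hx]

theorem contMDiffAt_radialProj {x : EuclideanSpace ℝ (Fin (m + 1))} (hx : x ≠ 0) :
    ContMDiffAt (𝓡 (m + 1)) (𝓡 m) ∞ (radialProj : _ → Sph m) x := by
  have : Fact (Module.finrank ℝ (EuclideanSpace ℝ (Fin (m + 1))) = m + 1) := ⟨by simp⟩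
  -- Restricting to a map on the manifold U makes it take values in the sphere everywhere, which a
  -- corestriction to the sphere requires.
  let U : TopologicalSpace.Opens (EuclideanSpace ℝ (Fin (m + 1))) := ⟨{0}ᶜ, isOpen_compl_singleton⟩
  have hU : ∀ y : U, (y : EuclideanSpace ℝ (Fin (m + 1))) ≠ 0 := fun y => y.2
  have h1 : ContMDiff (𝓡 (m + 1)) (𝓡 (m + 1)) ∞
      (fun y : U => ‖(y : EuclideanSpace ℝ (Fin (m + 1)))‖⁻¹ • (y : EuclideanSpace ℝ (Fin (m + 1)))) := by
    intro y
    refine (contMDiffAt_subtype_iff (U := U)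
      (f := fun y : EuclideanSpace ℝ (Fin (m + 1)) => ‖y‖⁻¹ • y)).2 ?_
    refine ContDiffAt.contMDiffAt ?_
    exact ((contDiffAt_norm ℝ (hU y)).inv (norm_ne_zero_iff.2 (hU y))).smul contDiffAt_id
  have h2 := ContMDiff.codRestrict_sphere (n := m) h1 fun y => by
    simp [norm_smul, hU y]
  refine (contMDiffAt_subtype_iff (U := U) (x := ⟨x, hx⟩)).1 ?_
  refine (h2 ⟨x, hx⟩).congr_of_eventuallyEq (Filter.Eventually.of_forall fun y => ?_)
  exact Subtype.ext (coe_radialProj (hU y))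

theorem radialProj_smul {t : ℝ} (ht : 0 < t) (x : Sph m) :
    radialProj (t • (x : EuclideanSpace ℝ (Fin (m + 1)))) = x := by
  have hx : (x : EuclideanSpace ℝ (Fin (m + 1))) ≠ 0 := ne_zero_of_mem_unit_sphere x
  refine Subtype.ext ?_
  rw [coe_radialProj (smul_ne_zero ht.ne' hx), norm_smul, norm_eq_of_mem_sphere x, smul_smul]
  simp [abs_of_pos ht, ht.ne']

variable {M : Type*} [TopologicalSpace M] [ChartedSpace (EuclideanSpace ℝ (Fin (m + 1))) M]
  (Φ : EuclideanSpace ℝ (Fin (m + 1)) ≃ₘ⟮𝓡 (m + 1), 𝓡 (m + 1)⟯ M)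

theorem angle_eq (p : M) : angle Φ p = radialProj (Φ.symm p) := rfl

theorem symm_ne_zero_of_radius_pos {p : M} (hp : 0 < radius Φ p) : Φ.symm p ≠ 0 :=
  norm_pos_iff.1 hp

theorem contMDiffAt_angle {p : M} (hp : 0 < radius Φ p) :
    ContMDiffAt (𝓡 (m + 1)) (𝓡 m) ∞ (angle Φ) p :=
  (contMDiffAt_radialProj (symm_ne_zero_of_radius_pos Φ hp)).comp p Φ.symm.contMDiff.contMDiffAt

theorem contMDiffAt_radius {p : M} (hp : 0 < radius Φ p) :
    ContMDiffAt (𝓡 (m + 1)) 𝓘(ℝ, ℝ) ∞ (radius Φ) p :=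
  (contDiffAt_norm ℝ (symm_ne_zero_of_radius_pos Φ hp)).contMDiffAt.comp p
    Φ.symm.contMDiff.contMDiffAt

theorem radius_smul_angle {p : M} (hp : 0 < radius Φ p) :
    radius Φ p • (angle Φ p : EuclideanSpace ℝ (Fin (m + 1))) = Φ.symm p := by
  have h := symm_ne_zero_of_radius_pos Φ hp
  rw [angle_eq, coe_radialProj h, radius, smul_smul, mul_inv_cancel₀ (norm_ne_zero_iff.2 h),
    one_smul]

/-! ### Radial charts -/

variable {W : Type*} [NormedAddCommGroup W] [NormedSpace ℝ W] {φ : W × ℝ → M} {φ₁ : W → Sph m}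
  {a : ℝ} {z : W × ℝ}

/-- No regularity of φ₁ is assumed; it is recovered from `angle Φ ∘ φ` on the slice t = z.2. -/
theorem mdifferentiableAt_of_radial (hz : 0 < radius Φ (φ z))
    (hφ : MDifferentiableAt 𝓘(ℝ, W × ℝ) (𝓡 (m + 1)) φ z)
    (hang : ∀ᶠ z' in nhds z, angle Φ (φ z') = φ₁ z'.1) :
    MDifferentiableAt 𝓘(ℝ, W) (𝓡 m) φ₁ z.1 := by
  have h1 : MDifferentiableAt 𝓘(ℝ, W) 𝓘(ℝ, W × ℝ) (fun y : W => (y, z.2)) z.1 :=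
    DifferentiableAt.mdifferentiableAt (by fun_prop)
  have h2 := ((contMDiffAt_angle Φ hz).mdifferentiableAt (by simp)).comp z hφ
  have h3 := MDifferentiableAt.comp z.1 (f := fun y : W => (y, z.2)) (g := angle Φ ∘ φ) h2 h1
  refine h3.congr_of_eventuallyEq ?_
  have hc : ContinuousAt (fun y : W => (y, z.2)) z.1 := by fun_prop
  filter_upwards [hc.eventually hang] with y hy
  exact hy.symm

theorem mfderiv_angle_of_radial (hz : 0 < radius Φ (φ z))
    (hφ : MDifferentiableAt 𝓘(ℝ, W × ℝ) (𝓡 (m + 1)) φ z)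
    (hang : ∀ᶠ z' in nhds z, angle Φ (φ z') = φ₁ z'.1) (v : W × ℝ) :
    (mfderiv (𝓡 (m + 1)) (𝓡 m) (angle Φ) (φ z) (mfderiv 𝓘(ℝ, W × ℝ) (𝓡 (m + 1)) φ z v) :
      EuclideanSpace ℝ (Fin m)) = mfderiv 𝓘(ℝ, W) (𝓡 m) φ₁ z.1 v.1 := by
  have h2 := (contMDiffAt_angle Φ hz).mdifferentiableAt (by simp)
  have h3 := mfderiv_comp z h2 hφ
  have h4 : (angle Φ ∘ φ) =ᶠ[nhds z] φ₁ ∘ Prod.fst := hang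
  have h5 : MDifferentiableAt 𝓘(ℝ, W × ℝ) 𝓘(ℝ, W) (Prod.fst : W × ℝ → W) z :=
    DifferentiableAt.mdifferentiableAt (by fun_prop)
  have h6 := mfderiv_comp z (mdifferentiableAt_of_radial Φ hz hφ hang) h5
  have h7 := h4.mfderiv_eq (I := 𝓘(ℝ, W × ℝ)) (I' := 𝓡 m)
  have h8 : mfderiv 𝓘(ℝ, W × ℝ) 𝓘(ℝ, W) (Prod.fst : W × ℝ → W) z = ContinuousLinearMap.fst ℝ W ℝ := by
    rw [mfderiv_eq_fderiv, fderiv_fst]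
  have h9 := (congrArg (fun L : (W × ℝ) →L[ℝ] EuclideanSpace ℝ (Fin m) => L v)
    (h3.symm.trans (h7.trans h6)))
  rw [h8] at h9
  exact h9

theorem mvfderiv_radius_of_radial (hz : 0 < radius Φ (φ z))
    (hφ : MDifferentiableAt 𝓘(ℝ, W × ℝ) (𝓡 (m + 1)) φ z)
    (hrad : ∀ᶠ z' in nhds z, radius Φ (φ z') = z'.2 + a) (v : W × ℝ) :
    mvfderiv (𝓡 (m + 1)) (radius Φ) (φ z) (mfderiv 𝓘(ℝ, W × ℝ) (𝓡 (m + 1)) φ z v) = v.2 := by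
  have h2 := (contMDiffAt_radius Φ hz).mdifferentiableAt (by simp)
  have h3 := mfderiv_comp z h2 hφ
  have h4 : (radius Φ ∘ φ) =ᶠ[nhds z] fun z => z.2 + a := hrad
  have h7 := h4.mfderiv_eq (I := 𝓘(ℝ, W × ℝ)) (I' := 𝓘(ℝ, ℝ))
  have h8 : mfderiv 𝓘(ℝ, W × ℝ) 𝓘(ℝ, ℝ) (fun z : W × ℝ => z.2 + a) z
      = ContinuousLinearMap.snd ℝ W ℝ := by
    rw [mfderiv_eq_fderiv, fderiv_add_const, fderiv_snd]
  have h9 := (congrArg (fun L : (W × ℝ) →L[ℝ] ℝ => L v) (h3.symm.trans h7))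
  rw [h8] at h9
  exact h9

theorem polarForm_of_radial (h : ℝ → SphForm m) (hz : 0 < radius Φ (φ z))
    (hφ : MDifferentiableAt 𝓘(ℝ, W × ℝ) (𝓡 (m + 1)) φ z)
    (hang : ∀ᶠ z' in nhds z, angle Φ (φ z') = φ₁ z'.1)
    (hrad : ∀ᶠ z' in nhds z, radius Φ (φ z') = z'.2 + a) (v w : W × ℝ) :
    polarForm Φ h (φ z) (mfderiv 𝓘(ℝ, W × ℝ) (𝓡 (m + 1)) φ z v)
        (mfderiv 𝓘(ℝ, W × ℝ) (𝓡 (m + 1)) φ z w)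
      = h (z.2 + a) (φ₁ z.1) (mfderiv 𝓘(ℝ, W) (𝓡 m) φ₁ z.1 v.1)
          (mfderiv 𝓘(ℝ, W) (𝓡 m) φ₁ z.1 w.1) + v.2 * w.2 := by
  have e1 := mfderiv_angle_of_radial Φ hz hφ hang v
  have e2 := mfderiv_angle_of_radial Φ hz hφ hang w
  unfold polarForm
  rw [mvfderiv_radius_of_radial Φ hz hφ hrad v, mvfderiv_radius_of_radial Φ hz hφ hrad w,
    hrad.self_of_nhds]
  -- The tangent vectors have types depending on the base point, so base point and vectors must be
  -- replaced together.
  have key : ∀ (x y : Sph m) (hxy : x = y) (v v' w w' : EuclideanSpace ℝ (Fin m)),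
      v = v' → w = w' → h (z.2 + a) x v w = h (z.2 + a) y v' w' := by
    rintro x _ rfl v _ w _ rfl rfl; rfl
  rw [key _ _ hang.self_of_nhds _ _ _ _ e1 e2]

/-- The components of the pullback of the family `h_r` on the sphere by `φ₁`, with `r = t + a`. -/
def radialCoeff (h : ℝ → SphForm m) (φ₁ : EuclideanSpace ℝ (Fin m) → Sph m) (a : ℝ)
    (v w : EuclideanSpace ℝ (Fin m)) (z : EuclideanSpace ℝ (Fin m) × ℝ) : ℝ :=
  h (z.2 + a) (φ₁ z.1) (mfderiv 𝓘(ℝ, EuclideanSpace ℝ (Fin m)) (𝓡 m) φ₁ z.1 v)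
    (mfderiv 𝓘(ℝ, EuclideanSpace ℝ (Fin m)) (𝓡 m) φ₁ z.1 w)

theorem isOpen_modelT (m : ℕ) (ξ : ℝ) : IsOpen (modelT m ξ) :=
  Metric.isOpen_ball.prod isOpen_Ioo

theorem modelT_mono (m : ℕ) {ξ ξ' : ℝ} (h : ξ ≤ ξ') : modelT m ξ ⊆ modelT m ξ' :=
  Set.prod_mono subset_rfl (Set.Ioo_subset_Ioo (by linarith) (by linarith))

theorem zero_mem_modelT (m : ℕ) {ξ : ℝ} (h : -1 < ξ) : (0, 0) ∈ modelT m ξ := by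
  refine ⟨by simp, ?_, ?_⟩ <;> simp <;> linarith

/-- The dt² terms of the pullback and of the model cancel; only the spherical components remain to
be estimated. -/
theorem pullbackCoeff_sub_modelMetric {φ : EuclideanSpace ℝ (Fin m) × ℝ → M}
    {φ₁ : EuclideanSpace ℝ (Fin m) → Sph m} {ξ : ℝ}
    (hφ : ContMDiffOn 𝓘(ℝ, EuclideanSpace ℝ (Fin m) × ℝ) (𝓡 (m + 1)) ∞ φ (modelT m ξ))
    (hpos : ∀ z ∈ modelT m ξ, 0 < radius Φ (φ z))
    (hrad : ∀ z ∈ modelT m ξ, angle Φ (φ z) = φ₁ z.1 ∧ radius Φ (φ z) = z.2 + a)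
    (h : ℝ → SphForm m) (jk : (Fin m ⊕ Unit) × (Fin m ⊕ Unit))
    {z : EuclideanSpace ℝ (Fin m) × ℝ} (hz : z ∈ modelT m ξ) :
    pullbackCoeff Φ h φ jk z - modelMetric m jk z =
      radialCoeff h φ₁ a (modelBasis m jk.1).1 (modelBasis m jk.2).1 z
        - Real.exp (2 * z.2) * inner ℝ (modelBasis m jk.1).1 (modelBasis m jk.2).1 := by
  have hz' := (isOpen_modelT m ξ).mem_nhds hz
  have h1 := polarForm_of_radial Φ h (hpos z hz) ((hφ.contMDiffAt hz').mdifferentiableAt (by simp))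
    (Filter.eventually_of_mem hz' fun z' hz' => (hrad z' hz').1)
    (Filter.eventually_of_mem hz' fun z' hz' => (hrad z' hz').2)
    (modelBasis m jk.1) (modelBasis m jk.2)
  rw [pullbackCoeff, h1, modelMetric, radialCoeff]
  ring

theorem contMDiffOn_of_radial {φ : EuclideanSpace ℝ (Fin m) × ℝ → M}
    {φ₁ : EuclideanSpace ℝ (Fin m) → Sph m} {ξ : ℝ} (hξ : -1 < ξ)
    (hφ : ContMDiffOn 𝓘(ℝ, EuclideanSpace ℝ (Fin m) × ℝ) (𝓡 (m + 1)) ∞ φ (modelT m ξ))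
    (hpos : ∀ z ∈ modelT m ξ, 0 < radius Φ (φ z))
    (hang : ∀ z ∈ modelT m ξ, angle Φ (φ z) = φ₁ z.1) :
    ContMDiffOn 𝓘(ℝ, EuclideanSpace ℝ (Fin m)) (𝓡 m) ∞ φ₁ (Metric.ball 0 1) := by
  have h0 : ∀ y ∈ Metric.ball (0 : EuclideanSpace ℝ (Fin m)) 1, (y, (0 : ℝ)) ∈ modelT m ξ :=
    fun y hy => ⟨hy, by simp; linarith, by simp; linarith⟩
  have h1 : ContMDiffOn 𝓘(ℝ, EuclideanSpace ℝ (Fin m)) (𝓡 m) ∞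
      (fun y => angle Φ (φ (y, (0 : ℝ)))) (Metric.ball 0 1) := by
    intro y hy
    have h2 : ContMDiffAt 𝓘(ℝ, EuclideanSpace ℝ (Fin m)) 𝓘(ℝ, EuclideanSpace ℝ (Fin m) × ℝ) ∞
        (fun y => (y, (0 : ℝ))) y := ContDiffAt.contMDiffAt (by fun_prop)
    have h3 := (contMDiffAt_angle Φ (hpos _ (h0 y hy))).comp (y, (0 : ℝ))
      (hφ.contMDiffAt ((isOpen_modelT m ξ).mem_nhds (h0 y hy)))
    exact (ContMDiffAt.comp y h3 h2).contMDiffWithinAt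
  exact h1.congr fun y hy => (hang _ (h0 y hy)).symm

theorem contDiffOn_radialCoeff {n : WithTop ℕ∞} (hn : n + 1 ≤ ∞) {h : ℝ → SphForm m} {I : Set ℝ}
    (hh : CkFamily n I h) {φ₁ : EuclideanSpace ℝ (Fin m) → Sph m} {U : Set (EuclideanSpace ℝ (Fin m))}
    (hU : IsOpen U) (hφ₁ : ContMDiffOn 𝓘(ℝ, EuclideanSpace ℝ (Fin m)) (𝓡 m) ∞ φ₁ U)
    (a : ℝ) (v w : EuclideanSpace ℝ (Fin m)) :
    ContDiffOn ℝ n (radialCoeff h φ₁ a v w) {z | z.1 ∈ U ∧ z.2 + a ∈ I} := by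
  have h1 := hh.contDiffOn_pullback hU hφ₁ hn v w
  have h2 : ContDiff ℝ n (fun z : EuclideanSpace ℝ (Fin m) × ℝ => (z.2 + a, z.1)) := by fun_prop
  exact h1.comp h2.contDiffOn fun z hz => ⟨hz.2, hz.1⟩

end Polar

/-! ### Uniform bounds for families on compact sets -/

section Compact

variable {P W : Type*} [NormedAddCommGroup P] [NormedSpace ℝ P] [NormedAddCommGroup W]
  [NormedSpace ℝ W] {F : P → W → ℝ} {D : Set P} {U : Set W} {n k : WithTop ℕ∞}

/-- Only the variable in the open set U is differentiated, so D may be arbitrary, for instance a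
closed interval or a point. The derivative is computed within U and then identified with the full
one. -/
theorem ContDiffOn.fderiv_param (hU : IsOpen U)
    (hF : ContDiffOn ℝ n (fun q : P × W => F q.1 q.2) (D ×ˢ U)) (hk : k + 1 ≤ n) (v : W) :
    ContDiffOn ℝ k (fun q : P × W => fderiv ℝ (F q.1) q.2 v) (D ×ˢ U) := by
  intro q hq
  have h0 : ContDiffOn ℝ n (fun r : (P × W) × W => F r.1.1 r.2) ((D ×ˢ U) ×ˢ U) :=
    hF.comp (f := fun r : (P × W) × W => (r.1.1, r.2)) (ContDiff.contDiffOn (by fun_prop))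
      fun r hr => ⟨hr.1.1, hr.2⟩
  have h1 : ContDiffWithinAt ℝ n (Function.uncurry fun (q : P × W) (z : W) => F q.1 z)
      ((D ×ˢ U) ×ˢ U) (q, q.2) := h0 (q, q.2) ⟨hq, hq.2⟩
  have h2 : ContDiffWithinAt ℝ k (fun q : P × W => fderivWithin ℝ (F q.1) U q.2) (D ×ˢ U) q :=
    ContDiffWithinAt.fderivWithin (f := fun (q : P × W) (z : W) => F q.1 z) (g := Prod.snd)
      (s := D ×ˢ U) (t := U) h1 contDiffWithinAt_snd hU.uniqueDiffOn hk hq fun r hr => hr.2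
  have h3 : ContDiffWithinAt ℝ k (fun q : P × W => fderiv ℝ (F q.1) q.2) (D ×ˢ U) q :=
    h2.congr (fun r hr => (fderivWithin_of_isOpen hU hr.2).symm)
      (fderivWithin_of_isOpen hU hq.2).symm
  exact h3.clm_apply contDiffWithinAt_const

theorem contDiffAt_of_param (hU : IsOpen U)
    (hF : ContDiffOn ℝ n (fun q : P × W => F q.1 q.2) (D ×ˢ U)) {p : P} (hp : p ∈ D) {z : W}
    (hz : z ∈ U) : ContDiffAt ℝ n (F p) z := by
  have h1 : ContDiff ℝ n (fun z : W => (p, z)) := by fun_prop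
  exact (hF.comp h1.contDiffOn (s := U) fun z hz => ⟨hp, hz⟩).contDiffAt (hU.mem_nhds hz)

theorem fderiv_fderiv_apply {f : W → ℝ} {z : W} (hf : ContDiffAt ℝ 2 f z) (v w : W) :
    fderiv ℝ (fderiv ℝ f) z v w = fderiv ℝ (fun y => fderiv ℝ f y w) z v := by
  rw [fderiv_clm_apply hf.differentiableAt_fderiv_of_two (by fun_prop)]
  simp

/-- The partial derivatives of order at most two in the W-variable are jointly continuous, hence
bounded on D × K; finiteness of the basis gives one constant. -/
theorem exists_c2Le_of_isCompact {J : Type*} [Finite J] (b : J → W) (hU : IsOpen U)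
    (hF : ContDiffOn ℝ 2 (fun q : P × W => F q.1 q.2) (D ×ˢ U)) (hD : IsCompact D) {K : Set W}
    (hK : IsCompact K) (hKU : K ⊆ U) : ∃ C, ∀ p ∈ D, C2Le b K (F p) C := by
  have hDK : D ×ˢ K ⊆ D ×ˢ U := Set.prod_mono subset_rfl hKU
  have bdd : ∀ f : P × W → ℝ, ContinuousOn f (D ×ˢ U) → ∃ C, ∀ q ∈ D ×ˢ K, |f q| ≤ C := by
    intro f hf
    obtain ⟨C, hC⟩ := (hD.prod hK).exists_bound_of_continuousOn (hf.mono hDK)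
    exact ⟨C, hC⟩
  have h1 : ∀ v, ContDiffOn ℝ 1 (fun q : P × W => fderiv ℝ (F q.1) q.2 v) (D ×ˢ U) := fun v =>
    hF.fderiv_param hU (by norm_num) v
  have h2 : ∀ v w, ContinuousOn
      (fun q : P × W => fderiv ℝ (fun y => fderiv ℝ (F q.1) y w) q.2 v) (D ×ˢ U) := fun v w =>
    ((h1 w).fderiv_param (F := fun p y => fderiv ℝ (F p) y w) (k := 0) hU (by norm_num) v).continuousOn
  obtain ⟨C0, hC0⟩ := bdd _ hF.continuousOn
  choose C1 hC1 using fun j => bdd _ (h1 (b j)).continuousOn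
  choose C2 hC2 using fun j k => bdd _ (h2 (b j) (b k))
  obtain ⟨B1, hB1⟩ := (Set.finite_range C1).bddAbove
  obtain ⟨B2, hB2⟩ := (Set.finite_range fun q : J × J => C2 q.1 q.2).bddAbove
  refine ⟨max C0 (max B1 B2), fun p hp => ⟨fun z hz => contDiffAt_of_param hU hF hp (hKU hz),
    fun z hz => ?_, fun z hz j => ?_, fun z hz j k => ?_⟩⟩
  · exact (hC0 (p, z) ⟨hp, hz⟩).trans (le_max_left _ _)
  · exact ((hC1 j (p, z) ⟨hp, hz⟩).trans (hB1 ⟨j, rfl⟩)).trans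
      ((le_max_left _ _).trans (le_max_right _ _))
  · rw [fderiv_fderiv_apply (contDiffAt_of_param hU hF hp (hKU hz))]
    exact ((hC2 j k (p, z) ⟨hp, hz⟩).trans (hB2 ⟨(j, k), rfl⟩)).trans
      ((le_max_right _ _).trans (le_max_right _ _))

end Compact

theorem C2NormLT.of_c2Le {V J A : Type} [NormedAddCommGroup V] [NormedSpace ℝ V]
    {b : J → V} {s : Set V} {F : A → V → ℝ} {c K : ℝ} (h : ∀ a, C2Le b s (F a) K) (hK : K < c) :
    C2NormLT b s F c :=
  ⟨K, hK, fun z hz a => (h a).iteratedFDeriv_le z hz⟩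

theorem C2NormLT.exists_c2Le {V J A : Type} [NormedAddCommGroup V] [NormedSpace ℝ V]
    {b : J → V} {s : Set V} {F : A → V → ℝ} {c : ℝ} (h : C2NormLT b s F c)
    (hF : ∀ a, ∀ z ∈ s, ContDiffAt ℝ 2 (F a) z) : ∃ K < c, ∀ a, C2Le b s (F a) K := by
  obtain ⟨K, hK, h⟩ := h
  exact ⟨K, hK, fun a => C2Le.of_iteratedFDeriv (hF a) fun z hz => h z hz a⟩

/-! ### Components in charts of the sphere -/

/-- The standard basis of `ℝ^m`. -/
def stdB (m : ℕ) (j : Fin m) : EuclideanSpace ℝ (Fin m) := EuclideanSpace.single j 1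

theorem sum_smul_stdB {m : ℕ} (x : EuclideanSpace ℝ (Fin m)) : ∑ j, x j • stdB m j = x := by
  have := (EuclideanSpace.basisFun (Fin m) ℝ).sum_repr x
  simpa [stdB] using this

namespace SphereAtlas

variable {m : ℕ} (𝒜 : SphereAtlas m)

/-- The closure of the `i`-th chart domain, in the chart. -/
def cl (i : Fin 𝒜.N) : Set (EuclideanSpace ℝ (Fin m)) := 𝒜.chart i '' closure (𝒜.dom i)

theorem image_subset_cl (i : Fin 𝒜.N) : 𝒜.chart i '' 𝒜.dom i ⊆ 𝒜.cl i :=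
  Set.image_mono subset_closure

theorem dom_subset_source (i : Fin 𝒜.N) : 𝒜.dom i ⊆ (𝒜.chart i).source :=
  subset_closure.trans (𝒜.closure_dom i)

theorem isOpen_image (i : Fin 𝒜.N) : IsOpen (𝒜.chart i '' 𝒜.dom i) :=
  (𝒜.chart i).isOpen_image_of_subset_source (𝒜.isOpen_dom i) (𝒜.dom_subset_source i)

theorem isCompact_cl (i : Fin 𝒜.N) : IsCompact (𝒜.cl i) :=
  isClosed_closure.isCompact.image_of_continuousOn
    ((𝒜.chart i).continuousOn.mono (𝒜.closure_dom i))

theorem cl_subset_target (i : Fin 𝒜.N) : 𝒜.cl i ⊆ (𝒜.chart i).target := by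
  rintro _ ⟨x, hx, rfl⟩
  exact (𝒜.chart i).map_source (𝒜.closure_dom i hx)

theorem contMDiffOn_symm (i : Fin 𝒜.N) :
    ContMDiffOn 𝓘(ℝ, EuclideanSpace ℝ (Fin m)) (𝓡 m) ∞ (𝒜.chart i).symm (𝒜.chart i).target :=
  contMDiffOn_symm_of_mem_maximalAtlas (𝒜.chart_mem i)

theorem injective_mfderiv_symm (i : Fin 𝒜.N) {z : EuclideanSpace ℝ (Fin m)}
    (hz : z ∈ (𝒜.chart i).target) : Function.Injective
      (mfderiv 𝓘(ℝ, EuclideanSpace ℝ (Fin m)) (𝓡 m) (𝒜.chart i).symm z) := by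
  have h1 : MDifferentiableAt (𝓡 m) 𝓘(ℝ, EuclideanSpace ℝ (Fin m)) (𝒜.chart i)
      ((𝒜.chart i).symm z) :=
    ((contMDiffOn_of_mem_maximalAtlas (𝒜.chart_mem i)).contMDiffAt
      ((𝒜.chart i).open_source.mem_nhds ((𝒜.chart i).map_target hz))).mdifferentiableAt (by simp)
  have h2 : MDifferentiableAt 𝓘(ℝ, EuclideanSpace ℝ (Fin m)) (𝓡 m) (𝒜.chart i).symm z :=
    ((𝒜.contMDiffOn_symm i).contMDiffAt ((𝒜.chart i).open_target.mem_nhds hz)).mdifferentiableAt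
      (by simp)
  have h3 := mfderiv_comp z h1 h2
  have h4 : (𝒜.chart i) ∘ (𝒜.chart i).symm =ᶠ[nhds z] id :=
    Filter.eventually_of_mem ((𝒜.chart i).open_target.mem_nhds hz)
      fun y hy => (𝒜.chart i).right_inv hy
  rw [h4.mfderiv_eq, mfderiv_id] at h3
  intro v w hvw
  have h5 := congrArg (fun L : EuclideanSpace ℝ (Fin m) →L[ℝ] EuclideanSpace ℝ (Fin m) => L v) h3
  have h6 := congrArg (fun L : EuclideanSpace ℝ (Fin m) →L[ℝ] EuclideanSpace ℝ (Fin m) => L w) h3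
  have h7 := congrArg (mfderiv (𝓡 m) 𝓘(ℝ, EuclideanSpace ℝ (Fin m)) (𝒜.chart i)
    ((𝒜.chart i).symm z)) hvw
  exact h5.trans (h7.trans h6.symm)

theorem contDiffOn_coeff {P : Type} [NormedAddCommGroup P] [NormedSpace ℝ P] {n : WithTop ℕ∞}
    (hn : n + 1 ≤ ∞) {D : Set P} {γ : P → SphForm m} (h : CkFamily n D γ) (i : Fin 𝒜.N)
    (jk : Fin m × Fin m) :
    ContDiffOn ℝ n (fun q : P × EuclideanSpace ℝ (Fin m) => 𝒜.coeff i (γ q.1) jk q.2)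
      (D ×ˢ (𝒜.chart i).target) :=
  h.contDiffOn_pullback (𝒜.chart i).open_target (𝒜.contMDiffOn_symm i) hn _ _

/-- The matrix of components. -/
def gram (i : Fin 𝒜.N) (g : SphForm m) (z : EuclideanSpace ℝ (Fin m)) : Matrix (Fin m) (Fin m) ℝ :=
  Matrix.of fun j k => 𝒜.coeff i g (j, k) z

theorem sum_sum_coeff (i : Fin 𝒜.N) (g : SphForm m) (z v w : EuclideanSpace ℝ (Fin m)) :
    ∑ j, ∑ k, v j * w k * 𝒜.coeff i g (j, k) z =
      g ((𝒜.chart i).symm z)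
        (mfderiv 𝓘(ℝ, EuclideanSpace ℝ (Fin m)) (𝓡 m) (𝒜.chart i).symm z v)
        (mfderiv 𝓘(ℝ, EuclideanSpace ℝ (Fin m)) (𝓡 m) (𝒜.chart i).symm z w) := by
  let L : EuclideanSpace ℝ (Fin m) →L[ℝ] EuclideanSpace ℝ (Fin m) :=
    mfderiv 𝓘(ℝ, EuclideanSpace ℝ (Fin m)) (𝓡 m) (𝒜.chart i).symm z
  let G : EuclideanSpace ℝ (Fin m) →L[ℝ] EuclideanSpace ℝ (Fin m) →L[ℝ] ℝ :=
    g ((𝒜.chart i).symm z)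
  change ∑ j, ∑ k, v j * w k * G (L (stdB m j)) (L (stdB m k)) = G (L v) (L w)
  conv_rhs => rw [← sum_smul_stdB v, ← sum_smul_stdB w]
  simp only [map_sum, map_smul, sum_apply, smul_apply,
    smul_eq_mul, Finset.mul_sum]
  rw [Finset.sum_comm]
  refine Finset.sum_congr rfl fun j _ => Finset.sum_congr rfl fun k _ => ?_
  ring

theorem posDef_gram (i : Fin 𝒜.N) {g : SphForm m} (hg : IsInnerForm g)
    {z : EuclideanSpace ℝ (Fin m)} (hz : z ∈ (𝒜.chart i).target) : (𝒜.gram i g z).PosDef := by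
  refine Matrix.PosDef.of_dotProduct_mulVec_pos ?_ fun x hx => ?_
  · ext j k
    simp only [Matrix.conjTranspose_apply, gram, Matrix.of_apply, star_trivial]
    exact hg.1 _ _ _
  · have h1 := 𝒜.sum_sum_coeff i g z (WithLp.toLp 2 x) (WithLp.toLp 2 x)
    have h2 : star x ⬝ᵥ (𝒜.gram i g z).mulVec x = ∑ j, ∑ k, x j * x k * 𝒜.coeff i g (j, k) z := by
      simp only [dotProduct, Matrix.mulVec, gram, Matrix.of_apply, Finset.mul_sum]
      refine Finset.sum_congr rfl fun j _ => Finset.sum_congr rfl fun k _ => ?_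
      simp; ring
    rw [h2]
    refine lt_of_lt_of_eq (hg.2 _ _ fun h => hx ?_) h1.symm
    have := 𝒜.injective_mfderiv_symm i hz (h.trans (map_zero _).symm)
    exact congrArg WithLp.ofLp this

/-- A uniform bound for a compact family of `C²` metrics of the sphere. -/
theorem exists_bounds_of_isCompact {D : Set ℝ} (hD : IsCompact D) {γ : ℝ → SphForm m}
    (h : CkFamily 2 D γ) (hγ : ∀ p ∈ D, IsInnerForm (γ p)) :
    ∃ C > 0, ∃ η > 0, ∀ p ∈ D, ∀ i, (∀ jk, C2Le (stdB m) (𝒜.cl i) (𝒜.coeff i (γ p) jk) C) ∧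
      ∀ z ∈ 𝒜.cl i, η ≤ (𝒜.gram i (γ p) z).det := by
  have hc := fun i jk => 𝒜.contDiffOn_coeff (n := 2) (by norm_cast) h i jk
  choose C hC using fun (q : Fin 𝒜.N × (Fin m × Fin m)) => exists_c2Le_of_isCompact
    (F := fun p => 𝒜.coeff q.1 (γ p) q.2) (stdB m) (𝒜.chart q.1).open_target (hc q.1 q.2) hD (𝒜.isCompact_cl q.1) (𝒜.cl_subset_target q.1)
  obtain ⟨B, hB⟩ := (Set.finite_range C).bddAbove
  have hdet : ∀ i, ∃ η > 0, ∀ p ∈ D, ∀ z ∈ 𝒜.cl i, η ≤ (𝒜.gram i (γ p) z).det := by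
    intro i
    have hcont : ContinuousOn (fun q : ℝ × EuclideanSpace ℝ (Fin m) =>
        (𝒜.gram i (γ q.1) q.2).det) (D ×ˢ 𝒜.cl i) := by
      refine Continuous.comp_continuousOn (g := Matrix.det) (by fun_prop) ?_
      refine continuousOn_pi.2 fun j => continuousOn_pi.2 fun k => ?_
      exact (hc i (j, k)).continuousOn.mono (Set.prod_mono subset_rfl (𝒜.cl_subset_target i))
    rcases (D ×ˢ 𝒜.cl i).eq_empty_or_nonempty with he | hne
    · refine ⟨1, one_pos, fun p hp z hz => ?_⟩
      have : (p, z) ∈ D ×ˢ 𝒜.cl i := ⟨hp, hz⟩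
      simp [he] at this
    · obtain ⟨q, hq, hmin⟩ := (hD.prod (𝒜.isCompact_cl i)).exists_isMinOn hne hcont
      exact ⟨_, (𝒜.posDef_gram i (hγ q.1 hq.1) (𝒜.cl_subset_target i hq.2)).det_pos,
        fun p hp z hz => hmin (a := (p, z)) ⟨hp, hz⟩⟩
  choose η hη0 hη using hdet
  have hηm : ∃ η' > 0, ∀ i, η' ≤ η i := by
    rcases isEmpty_or_nonempty (Fin 𝒜.N) with he | hne
    · exact ⟨1, one_pos, fun i => he.elim i⟩
    · obtain ⟨i, hi⟩ := Finite.exists_min η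
      exact ⟨η i, hη0 i, hi⟩
  obtain ⟨η', hη', hle⟩ := hηm
  refine ⟨max B 1, by positivity, η', hη', fun p hp i => ⟨fun jk => ?_, fun z hz => ?_⟩⟩
  · exact (hC (i, jk) p hp).mono ((hB ⟨(i, jk), rfl⟩).trans (le_max_left _ _))
  · exact (hle i).trans (hη i p hp z hz)

end SphereAtlas

/-! ### Bounds for positive definite matrices -/

section Matrices

open Matrix
open scoped MatrixOrder

variable {m : ℕ}

/-- B is the positive square root of G, and A is its inverse. -/
theorem Matrix.PosDef.exists_mul_transpose_mul {G : Matrix (Fin m) (Fin m) ℝ} (hG : G.PosDef) :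
    ∃ B A : Matrix (Fin m) (Fin m) ℝ, G = Bᵀ * B ∧ B * A = 1 ∧ A * B = 1 := by
  obtain ⟨B, hBs, -, hB⟩ := CFC.exists_sqrt_of_isSelfAdjoint_of_quasispectrumRestricts
    hG.posSemidef.isHermitian (QuasispectrumRestricts.nnreal_of_nonneg hG.posSemidef.nonneg)
  have hBt : Bᵀ = B := by simpa [Matrix.star_eq_conjTranspose] using hBs.star_eq
  replace hB : G = Bᵀ * B := by rw [hBt, ← hB]
  have hdet : IsUnit B.det := by
    have := hG.det_pos
    rw [hB, det_mul] at this
    exact isUnit_iff_ne_zero.2 (right_ne_zero_of_mul this.ne')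
  exact ⟨B, B⁻¹, hB, B.mul_nonsing_inv hdet, B.nonsing_inv_mul hdet⟩

/-- The trace of the adjugate is continuous in the entries, which range over a compact cube. Divided
by the determinant it is the trace of the inverse. -/
theorem exists_trace_adjugate_le (m : ℕ) (c : ℝ) : ∃ K > 0, ∀ G : Matrix (Fin m) (Fin m) ℝ,
    (∀ j k, |G j k| ≤ c) → G.adjugate.trace ≤ K := by
  have hcomp : IsCompact (Set.pi Set.univ fun _ : Fin m => Set.pi Set.univ fun _ : Fin m =>
      Set.Icc (-c) c) :=
    isCompact_univ_pi fun _ => isCompact_univ_pi fun _ => isCompact_Icc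
  have hcont : Continuous fun G : Matrix (Fin m) (Fin m) ℝ => G.adjugate.trace :=
    (continuous_id.matrix_adjugate).matrix_trace
  obtain ⟨K, hK⟩ := hcomp.exists_bound_of_continuousOn (f := fun G : Matrix (Fin m) (Fin m) ℝ =>
    G.adjugate.trace) hcont.continuousOn
  refine ⟨max K 1, by positivity, fun G hG => ?_⟩
  exact ((le_abs_self _).trans (hK G fun j _ k _ => abs_le.1 (hG j k))).trans (le_max_left _ _)

/-- A lower bound for positive definite matrices with bounded entries and determinant bounded away
from `0`. -/
theorem exists_posDef_lower_bound (m : ℕ) {c η : ℝ} (hη : 0 < η) : ∃ κ > 0,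
    ∀ G : Matrix (Fin m) (Fin m) ℝ, G.PosDef → (∀ j k, |G j k| ≤ c) → η ≤ G.det →
      ∀ x : Fin m → ℝ, κ * (x ⬝ᵥ x) ≤ x ⬝ᵥ G *ᵥ x := by
  obtain ⟨K, hK0, hK⟩ := exists_trace_adjugate_le m c
  refine ⟨η / K, by positivity, fun G hG hc hdet x => ?_⟩
  obtain ⟨B, A, hGB, hBA, hAB⟩ := hG.exists_mul_transpose_mul
  have hinv : G⁻¹ = A * Aᵀ := by
    refine Matrix.inv_eq_right_inv ?_
    rw [hGB, Matrix.mul_assoc, ← Matrix.mul_assoc B, hBA, Matrix.one_mul, ← transpose_mul, hAB,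
      transpose_one]
  have htr : (A * Aᵀ).trace ≤ K / η := by
    rw [← hinv, Matrix.inv_def, trace_smul, Ring.inverse_eq_inv, smul_eq_mul]
    have h1 := hK G hc
    have h2 : 0 ≤ G.adjugate.trace := by
      have : 0 ≤ (G⁻¹).trace := by
        rw [hinv, trace]
        refine Finset.sum_nonneg fun j _ => ?_
        simp only [diag_apply, mul_apply, transpose_apply]
        exact Finset.sum_nonneg fun k _ => mul_self_nonneg _
      rw [Matrix.inv_def, trace_smul, Ring.inverse_eq_inv, smul_eq_mul] at this
      by_contra h
      exact absurd this (not_le.2 (mul_neg_of_pos_of_neg (inv_pos.2 hG.det_pos) (not_le.1 h)))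
    rw [inv_mul_eq_div]
    exact div_le_div₀ hK0.le h1 hη hdet
  have hx : x = A *ᵥ (B *ᵥ x) := by rw [mulVec_mulVec, hAB, one_mulVec]
  set y := B *ᵥ x with hy
  have hyy : x ⬝ᵥ G *ᵥ x = y ⬝ᵥ y := by
    rw [hGB, ← mulVec_mulVec, dotProduct_mulVec, vecMul_transpose]
  -- Cauchy–Schwarz applied to each row of x = A y. The resulting factor is the trace of G⁻¹ = A Aᵀ,
  -- already bounded by K / η.
  have hcs : x ⬝ᵥ x ≤ (A * Aᵀ).trace * (y ⬝ᵥ y) := by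
    have hj : ∀ j, x j * x j ≤ (A * Aᵀ) j j * (y ⬝ᵥ y) := by
      intro j
      have h1 : x j = ∑ k, A j k * y k := congrFun hx j
      have h2 := Finset.sum_mul_sq_le_sq_mul_sq Finset.univ (A j) y
      rw [h1, ← sq]
      refine h2.trans_eq ?_
      simp only [mul_apply, transpose_apply, dotProduct, sq]
    rw [trace, Finset.sum_mul]
    exact Finset.sum_le_sum fun j _ => hj j
  rw [hyy, div_mul_eq_mul_div, div_le_iff₀ hK0]
  have hyn : 0 ≤ y ⬝ᵥ y := Finset.sum_nonneg fun k _ => mul_self_nonneg _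
  calc η * (x ⬝ᵥ x) ≤ η * (K / η * (y ⬝ᵥ y)) :=
        mul_le_mul_of_nonneg_left (hcs.trans (mul_le_mul_of_nonneg_right htr hyn)) hη.le
    _ = y ⬝ᵥ y * K := by field_simp

/-- A basis which is orthonormal for a positive definite matrix, with a bound. -/
theorem exists_orthonormal_frame {κ : ℝ} (hκ : 0 < κ) {G : Matrix (Fin m) (Fin m) ℝ}
    (hG : G.PosDef) (hGκ : ∀ x : Fin m → ℝ, κ * (x ⬝ᵥ x) ≤ x ⬝ᵥ G *ᵥ x) :
    ∃ A : Matrix (Fin m) (Fin m) ℝ, IsUnit A ∧ Aᵀ * G * A = 1 ∧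
      ∀ j k, |A j k| ≤ Real.sqrt (1 / κ) := by
  obtain ⟨B, A, hGB, hBA, hAB⟩ := hG.exists_mul_transpose_mul
  have hAGA : Aᵀ * G * A = 1 := by
    rw [hGB, ← Matrix.mul_assoc, Matrix.mul_assoc, hBA, Matrix.mul_one, ← transpose_mul, hBA,
      transpose_one]
  refine ⟨A, ⟨⟨A, B, hAB, hBA⟩, rfl⟩, hAGA, fun j k => ?_⟩
  have h1 := hGκ (fun j => A j k)
  -- The k-th column of A has G-length 1, so its Euclidean length is at most √(1/κ).
  have h2 : (fun j => A j k) ⬝ᵥ G *ᵥ (fun j => A j k) = 1 := by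
    have := congrFun (congrFun hAGA k) k
    rw [Matrix.mul_assoc, mul_apply, one_apply_eq] at this
    rw [← this]
    simp [dotProduct, mulVec, mul_apply]
  have h3 : A j k * A j k ≤ (fun j => A j k) ⬝ᵥ (fun j => A j k) :=
    Finset.single_le_sum (f := fun j => A j k * A j k) (fun i _ => mul_self_nonneg _)
      (Finset.mem_univ j)
  refine Real.abs_le_sqrt ?_
  rw [le_div_iff₀ hκ, sq]
  nlinarith

/-- Uniform continuity of the determinant on bounded sets. -/
theorem exists_det_close (m : ℕ) (c : ℝ) {η : ℝ} (hη : 0 < η) : ∃ δ > 0,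
    ∀ G H : Matrix (Fin m) (Fin m) ℝ, (∀ j k, |G j k| ≤ c) → (∀ j k, |H j k| ≤ c) →
      (∀ j k, |G j k - H j k| < δ) → |G.det - H.det| < η := by
  have hcomp : IsCompact (Set.pi Set.univ fun _ : Fin m => Set.pi Set.univ fun _ : Fin m =>
      Set.Icc (-c) c) :=
    isCompact_univ_pi fun _ => isCompact_univ_pi fun _ => isCompact_Icc
  have hcont : Continuous fun G : Fin m → Fin m → ℝ => (Matrix.of G).det := by
    have : Continuous fun G : Fin m → Fin m → ℝ => Matrix.of G := continuous_id
    exact this.matrix_det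
  have hu := hcomp.uniformContinuousOn_of_continuous hcont.continuousOn
  rw [Metric.uniformContinuousOn_iff] at hu
  obtain ⟨δ, hδ, h⟩ := hu η hη
  refine ⟨δ, hδ, fun G H hG hH hGH => ?_⟩
  refine h (fun j k => G j k) (fun j _ k _ => abs_le.1 (hG j k)) (fun j k => H j k)
    (fun j _ k _ => abs_le.1 (hH j k)) ?_
  exact (dist_pi_lt_iff hδ).2 fun j => (dist_pi_lt_iff hδ).2 fun k => hGH j k

end Matrices

/-! ### Lebesgue number of the atlas, and uniform c-boundedness -/

namespace SphereAtlas

variable {m : ℕ} (𝒜 : SphereAtlas m)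

/-- A Lebesgue number measured in chart coordinates: it holds near each point with half the radius
of a ball in the chart image, and compactness leaves finitely many conditions. -/
theorem exists_lebesgue : ∃ η > 0, ∀ x : Sph m, ∃ i, x ∈ 𝒜.dom i ∧
    Metric.ball (𝒜.chart i x) η ⊆ 𝒜.chart i '' 𝒜.dom i := by
  have h := (isCompact_univ (X := Sph m)).induction_on
    (p := fun S => ∃ η > 0, ∀ x ∈ S, ∃ i, x ∈ 𝒜.dom i ∧
      Metric.ball (𝒜.chart i x) η ⊆ 𝒜.chart i '' 𝒜.dom i) ⟨1, one_pos, by simp⟩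
    (fun S T hST ⟨η, hη, h⟩ => ⟨η, hη, fun x hx => h x (hST hx)⟩)
    (fun S T ⟨η, hη, h⟩ ⟨η', hη', h'⟩ => ⟨min η η', lt_min hη hη', fun x hx => by
      rcases hx with hx | hx
      · obtain ⟨i, hi, hb⟩ := h x hx
        exact ⟨i, hi, (Metric.ball_subset_ball (min_le_left _ _)).trans hb⟩
      · obtain ⟨i, hi, hb⟩ := h' x hx
        exact ⟨i, hi, (Metric.ball_subset_ball (min_le_right _ _)).trans hb⟩⟩) ?_
  · obtain ⟨η, hη, h⟩ := h
    exact ⟨η, hη, fun x => h x trivial⟩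
  · intro x _
    have hx : x ∈ ⋃ i, 𝒜.dom i := by rw [𝒜.cover]; trivial
    obtain ⟨i, hi⟩ := Set.mem_iUnion.1 hx
    obtain ⟨η, hη, hb⟩ := Metric.isOpen_iff.1 (𝒜.isOpen_image i) (𝒜.chart i x) ⟨x, hi, rfl⟩
    have hc : ContinuousAt (𝒜.chart i) x :=
      (𝒜.chart i).continuousAt (𝒜.dom_subset_source i hi)
    refine ⟨𝒜.dom i ∩ 𝒜.chart i ⁻¹' Metric.ball (𝒜.chart i x) (η / 2), ?_, η / 2, half_pos hη, ?_⟩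
    · exact mem_nhdsWithin_of_mem_nhds (Filter.inter_mem ((𝒜.isOpen_dom i).mem_nhds hi)
        (hc.preimage_mem_nhds (Metric.ball_mem_nhds _ (half_pos hη))))
    · rintro y ⟨hy, hyb⟩
      refine ⟨i, hy, (Metric.ball_subset_ball' ?_).trans hb⟩
      have := Metric.mem_ball.1 hyb
      linarith

theorem c2Le_coeff_of_normLT {P : Type} [NormedAddCommGroup P] [NormedSpace ℝ P] {D : Set P}
    {γ : P → SphForm m} (h : CkFamily 2 D γ) {p : P} (hp : p ∈ D) {c : ℝ} (hc : 𝒜.NormLT (γ p) c)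
    (i : Fin 𝒜.N) (jk : Fin m × Fin m) :
    C2Le (stdB m) (𝒜.chart i '' 𝒜.dom i) (𝒜.coeff i (γ p) jk) c := by
  obtain ⟨K, hK, h⟩ := (hc i).exists_c2Le fun jk z hz =>
    contDiffAt_of_param (F := fun p => 𝒜.coeff i (γ p) jk) (𝒜.chart i).open_target
      (𝒜.contDiffOn_coeff (by norm_cast) h i jk) hp
      (𝒜.cl_subset_target i (𝒜.image_subset_cl i hz))
  exact (h jk).mono hK.le

theorem coeff_sub (g h : SphForm m) (i : Fin 𝒜.N) (jk : Fin m × Fin m)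
    (z : EuclideanSpace ℝ (Fin m)) :
    𝒜.coeff i (fun x => g x - h x) jk z = 𝒜.coeff i g jk z - 𝒜.coeff i h jk z := rfl

/-- The spherical cuts of a family with a cut limit are uniformly bounded. -/
theorem exists_cBounded_of_limit {lam₀ : ℝ} {γ : ℝ → SphForm m} (h : CkFamily 2 (Set.Ici lam₀) γ)
    (hγ : ∀ p ≥ lam₀, IsInnerForm (γ p))
    {γ₀ : SphForm m} (h₀ : CkFamily 2 (Set.univ : Set ℝ) (fun _ => γ₀)) (hγ₀ : IsInnerForm γ₀)
    (hlim : ∀ δ > 0, ∃ L : ℝ, ∀ p ≥ L, 𝒜.NormLT (fun x => γ p x - γ₀ x) δ) :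
    ∃ c > 1, ∀ p ≥ lam₀, 𝒜.CBounded c (γ p) := by
  obtain ⟨C, hC0, η, hη0, hCη⟩ := 𝒜.exists_bounds_of_isCompact (isCompact_singleton (x := (0 : ℝ)))
    (h₀.mono (Set.subset_univ _)) fun _ _ => hγ₀
  replace hCη := hCη 0 rfl
  -- Being within 1 of the limit keeps all entries in the cube of size C + 1, on which the
  -- determinant is uniformly continuous; half of the limit's lower bound η survives.
  obtain ⟨δ, hδ, hdet⟩ := exists_det_close m (C + 1) (half_pos hη0)
  obtain ⟨L, hL⟩ := hlim (min δ 1) (by positivity)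
  obtain ⟨C', hC'0, η', hη'0, hCη'⟩ := 𝒜.exists_bounds_of_isCompact (isCompact_Icc (a := lam₀) (b := L))
    (h.mono fun p hp => hp.1) fun p hp => hγ p hp.1
  have hdiff : CkFamily 2 (Set.Ici lam₀) (fun p x => γ p x - γ₀ x) := by
    refine (h.add ((h₀.mono (Set.subset_univ _)).smul (f := fun _ => -1) contDiffOn_const)).congr
      fun p _ => ?_
    funext x
    ext v w
    change _ - _ = _ + (-1 : ℝ) * _
    ring
  have key : ∀ p ≥ lam₀, ∀ i, (∀ jk, C2Le (stdB m) (𝒜.chart i '' 𝒜.dom i) (𝒜.coeff i (γ p) jk)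
      (max C' (C + 1))) ∧ ∀ z ∈ 𝒜.chart i '' 𝒜.dom i, min η' (η / 2) ≤ (𝒜.gram i (γ p) z).det := by
    intro p hp i
    rcases le_total p L with hpL | hpL
    · refine ⟨fun jk => ?_, fun z hz => ?_⟩
      · exact (((hCη' p ⟨hp, hpL⟩ i).1 jk).mono_set (𝒜.image_subset_cl i)).mono (le_max_left _ _)
      · exact (min_le_left _ _).trans ((hCη' p ⟨hp, hpL⟩ i).2 z (𝒜.image_subset_cl i hz))
    · have h1 := fun jk => 𝒜.c2Le_coeff_of_normLT hdiff hp (hL p hpL) i jk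
      have h2 := fun jk => (((hCη i).1 jk).mono_set (𝒜.image_subset_cl i))
      have h3 : ∀ jk, C2Le (stdB m) (𝒜.chart i '' 𝒜.dom i) (𝒜.coeff i (γ p) jk) (C + 1) := by
        intro jk
        refine (((h2 jk).add (h1 jk)).mono (by gcongr; exact min_le_right _ _)).congr
          (𝒜.isOpen_image i) fun z _ => ?_
        rw [𝒜.coeff_sub (γ p) γ₀]
        ring
      refine ⟨fun jk => (h3 jk).mono (le_max_right _ _), fun z hz => ?_⟩
      have h4 := (hCη i).2 z (𝒜.image_subset_cl i hz)
      obtain ⟨K, hK, h5⟩ := hL p hpL i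
      have h6 := hdet (𝒜.gram i (γ p) z) (𝒜.gram i γ₀ z) (fun j k => (h3 (j, k)).val z hz)
        (fun j k => ((h2 (j, k)).val z hz).trans (by linarith)) fun j k => by
          have := h5 z hz (j, k) 0 (by norm_num) Fin.elim0
          rw [iteratedFDeriv_zero_apply] at this
          exact this.trans_lt (hK.trans_le (min_le_left _ _))
      rw [abs_lt] at h6
      exact (min_le_right _ _).trans (by linarith)
  set K := max C' (C + 1)
  set ν := min η' (η / 2)
  have hν : 0 < ν := by positivity
  -- Large enough to exceed the C²-bound K and to have reciprocal below the determinant bound ν.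
  refine ⟨max (K + 1) (1 / ν + 1) + 1, ?_, fun p hp => ⟨fun i => ?_, fun i z hz => ?_⟩⟩
  · have : 0 < 1 / ν := by positivity
    have := le_max_right (K + 1) (1 / ν + 1)
    linarith
  · refine C2NormLT.of_c2Le (fun jk => (key p hp i).1 jk) ?_
    have := le_max_left (K + 1) (1 / ν + 1)
    linarith
  · refine lt_of_lt_of_le ?_ (((key p hp i).2 z hz).trans (le_abs_self _))
    rw [div_lt_iff₀ (by positivity), ← div_lt_iff₀' hν]
    have := le_max_right (K + 1) (1 / ν + 1)
    linarith

end SphereAtlas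

/-! ### Small oscillation under rescaling, cutoffs and exponentials -/

section Small

variable {V W J I : Type*} [NormedAddCommGroup V] [NormedSpace ℝ V] [NormedAddCommGroup W]
  [NormedSpace ℝ W] [Fintype J] {b : J → V} {T : Set V} {f : V → ℝ} {K κ : ℝ} {b' : I → W}
  {s : Set W}

/-- Composition with an affine map with small linear part. -/
theorem C2Le.comp_affine_sub (hf : C2Le b T f K) (hT : Convex ℝ T) {z₀ : V} (hz₀ : z₀ ∈ T)
    (L : W →L[ℝ] V) (hL : ∀ z ∈ s, z₀ + L z ∈ T) (α : I → J → ℝ)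
    (hα : ∀ i, L (b' i) = ∑ j, α i j • b j) (hκ : ∀ i, ∑ j, |α i j| ≤ κ) (β : W → J → ℝ)
    (hβ : ∀ z ∈ s, L z = ∑ j, β z j • b j) (hβκ : ∀ z ∈ s, ∑ j, |β z j| ≤ κ) (hκ1 : κ ≤ 1) :
    C2Le b' s (fun z => f (z₀ + L z) - f z₀) (κ * K) := by
  have hK : 0 ≤ K := (abs_nonneg _).trans (hf.2 _ hz₀)
  have h1 := hf.comp_affine z₀ L hL α hα fun i => (hκ i).trans hκ1
  have h2 := hf.comp_affine_fst z₀ L hL α hα hκ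
  have h3 := hf.comp_affine_snd z₀ L hL α hα hκ
  have e : fderiv ℝ (fun z => f (z₀ + L z) - f z₀) = fderiv ℝ (fun z => f (z₀ + L z)) := by
    funext z; exact fderiv_sub_const _
  refine ⟨fun z hz => (h1.1 z hz).sub contDiffAt_const, fun z hz => ?_, fun z hz i => ?_,
    fun z hz i j => ?_⟩
  -- The value is bounded by the mean value inequality along the segment from z₀. The derivatives do
  -- not see the subtracted constant; the second gains κ², at most κ.
  · have hseg : ∀ u ∈ Set.Icc (0 : ℝ) 1, z₀ + u • L z ∈ T := fun u hu => by
      have := hT.add_smul_mem hz₀ (hL z hz) hu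
      exact this
    have hd : ∀ u ∈ Set.Icc (0 : ℝ) 1, HasDerivWithinAt (fun u : ℝ => f (z₀ + u • L z))
        (fderiv ℝ f (z₀ + u • L z) (L z)) (Set.Icc 0 1) u := fun u hu => by
      have h4 : HasDerivAt (fun u : ℝ => z₀ + u • L z) (L z) u := by
        simpa using ((hasDerivAt_id u).smul_const (L z)).const_add z₀
      exact (((hf.1 _ (hseg u hu)).differentiableAt (by norm_num)).hasFDerivAt.comp_hasDerivAt u
        h4).hasDerivWithinAt
    have h5 := norm_image_sub_le_of_norm_deriv_le_segment_01' hd (C := κ * K) fun u hu => by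
      rw [hβ z hz]
      have := abs_sum_smul_le (α := β z) (fderiv ℝ f (z₀ + u • L z)).toLinearMap
        (hf.3 _ (hseg u (Set.Ico_subset_Icc_self hu))) (hβκ z hz) hK
      rw [← hβ z hz] at this ⊢
      exact this
    simpa using h5
  · rw [e]; exact h2 z hz i
  · rw [e]
    have hκ0 : 0 ≤ κ := (Finset.sum_nonneg fun j _ => abs_nonneg _).trans (hκ i)
    refine (h3 z hz i j).trans (mul_le_of_le_one_left (by positivity) hκ1)

omit [Fintype J] in
theorem C2Le.union {s t : Set V} (h : C2Le b s f K) (h' : C2Le b t f K) : C2Le b (s ∪ t) f K :=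
  ⟨fun z hz => hz.elim (h.1 z) (h'.1 z), fun z hz => hz.elim (h.2 z) (h'.2 z),
    fun z hz => hz.elim (h.3 z) (h'.3 z), fun z hz => hz.elim (h.4 z) (h'.4 z)⟩

end Small

/-- The basis of `ℝ`. -/
def unitB : Unit → ℝ := fun _ => 1

theorem exists_c2Le_Icc {f : ℝ → ℝ} (hf : ContDiff ℝ 2 f) (x y : ℝ) :
    ∃ K, C2Le unitB (Set.Icc x y) f K := by
  obtain ⟨K, hK⟩ := exists_c2Le_of_isCompact (P := ℝ) (F := fun _ => f) (D := {0}) unitB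
    isOpen_univ (hf.comp contDiff_snd).contDiffOn isCompact_singleton
    (isCompact_Icc (a := x) (b := y)) (Set.subset_univ _)
  exact ⟨K, hK 0 rfl⟩

/-- The cutoff is constant off [0, 1], so a bound on that compact interval is global. -/
theorem exists_c2Le_cutoff {ρ : ℝ → ℝ} (hρ : ContDiff ℝ ∞ ρ) (h0 : ∀ t ≤ 0, ρ t = 0)
    (h1 : ∀ t, 1 ≤ t → ρ t = 1) : ∃ K, 1 ≤ K ∧ C2Le unitB Set.univ ρ K := by
  obtain ⟨K, hK⟩ := exists_c2Le_Icc (hρ.of_le (by norm_cast)) 0 1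
  have a1 : C2Le unitB (Set.Iio 0) ρ |0| :=
    (C2Le.const 0).congr isOpen_Iio fun z hz => h0 z (le_of_lt hz)
  have a2 : C2Le unitB (Set.Ioi 1) ρ |1| :=
    (C2Le.const 1).congr isOpen_Ioi fun z hz => h1 z (le_of_lt hz)
  refine ⟨max K 1, le_max_right _ _, ?_⟩
  have h := ((a1.mono (L := max K 1) (by simp)).union (hK.mono (le_max_left K 1))).union
    (a2.mono (L := max K 1) (by simp))
  refine h.mono_set fun t _ => ?_
  rcases lt_or_ge t 0 with h | h
  · exact Or.inl (Or.inl h)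
  · rcases le_or_gt t 1 with h' | h'
    · exact Or.inl (Or.inr ⟨h, h'⟩)
    · exact Or.inr h'

/-- A function of the last variable of the model. -/
theorem C2Le.comp_snd {m : ℕ} {f : ℝ → ℝ} {T : Set ℝ} {K : ℝ} (hf : C2Le unitB T f K)
    {s : Set (EuclideanSpace ℝ (Fin m) × ℝ)} {t₀ ℓ : ℝ} (hℓ : |ℓ| ≤ 1)
    (hs : ∀ z ∈ s, t₀ + ℓ * z.2 ∈ T) : C2Le (modelBasis m) s (fun z => f (t₀ + ℓ * z.2)) K := by
  refine hf.comp_affine t₀ (ℓ • ContinuousLinearMap.snd ℝ (EuclideanSpace ℝ (Fin m)) ℝ) hs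
    (fun i _ => ℓ * (modelBasis m i).2) (fun i => ?_) fun i => ?_
  · simp [unitB]
  · rcases i with i | i <;> simp [modelBasis, hℓ]

/-- A function of a slowly moving argument is nearly constant. Charts of excess ξ - 1 have |t| < ξ,
whence the factor |ℓ| ξ. -/
theorem C2Le.comp_snd_sub {m : ℕ} {f : ℝ → ℝ} {K ξ : ℝ} (hξ : 1 ≤ ξ) (hf : C2Le unitB Set.univ f K)
    {t₀ ℓ : ℝ} (hℓ : |ℓ| * ξ ≤ 1) :
    C2Le (modelBasis m) (modelT m (ξ - 1)) (fun z => f (t₀ + ℓ * z.2) - f t₀) (|ℓ| * ξ * K) := by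
  have hz : ∀ z ∈ modelT m (ξ - 1), |z.2| ≤ ξ := fun z hz => by
    have h := hz.2
    rw [abs_le]; constructor <;> linarith [h.1, h.2]
  refine hf.comp_affine_sub convex_univ trivial
    (ℓ • ContinuousLinearMap.snd ℝ (EuclideanSpace ℝ (Fin m)) ℝ) (fun _ _ => trivial)
    (fun i _ => ℓ * (modelBasis m i).2) (fun i => ?_) (fun i => ?_) (fun z _ => ℓ * z.2)
    (fun z _ => ?_) (fun z hz' => ?_) hℓ
  · simp [unitB]
  · have : |ℓ| ≤ |ℓ| * ξ := le_mul_of_one_le_right (abs_nonneg _) hξ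
    rcases i with i | i <;> simp [modelBasis, this]
    positivity
  · simp [unitB]
  · simpa [abs_mul] using mul_le_mul_of_nonneg_left (hz z hz') (abs_nonneg ℓ)

theorem c2Le_exp (ℓ ξ : ℝ) (hℓ : 1 ≤ |ℓ|) {m : ℕ} : C2Le (modelBasis m) (modelT m (ξ - 1))
    (fun z => Real.exp (ℓ * z.2)) (ℓ ^ 2 * Real.exp (|ℓ| * ξ)) := by
  have h1 : ∀ t : ℝ, fderiv ℝ (fun t => Real.exp (ℓ * t)) t 1 = ℓ * Real.exp (ℓ * t) := fun t => by
    rw [fderiv_apply_one_eq_deriv]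
    have := ((hasDerivAt_id t).const_mul ℓ).exp
    simpa [mul_comm] using this.deriv
  have h2 : ∀ z ∈ modelT m (ξ - 1), Real.exp (ℓ * z.2) ≤ Real.exp (|ℓ| * ξ) := fun z hz => by
    refine Real.exp_le_exp.2 ((le_abs_self _).trans ?_)
    rw [abs_mul]
    refine mul_le_mul_of_nonneg_left ?_ (abs_nonneg _)
    rw [abs_le]; constructor <;> linarith [hz.2.1, hz.2.2]
  have hsq : 1 ≤ |ℓ| ^ 2 := one_le_pow₀ hℓ
  -- Since |ℓ| ≥ 1, the factor ℓ² from two differentiations dominates those from fewer.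
  have hl : |ℓ| ≤ |ℓ| ^ 2 := le_self_pow₀ hℓ (by norm_num)
  have h3 : C2Le unitB {t | Real.exp (ℓ * t) ≤ Real.exp (|ℓ| * ξ)} (fun t => Real.exp (ℓ * t))
      (ℓ ^ 2 * Real.exp (|ℓ| * ξ)) := by
    rw [← sq_abs]
    refine ⟨fun t _ => by fun_prop, fun t ht => ?_, fun t ht _ => ?_, fun t ht _ _ => ?_⟩
    · rw [Real.abs_exp]
      exact ht.out.trans (le_mul_of_one_le_left (Real.exp_pos _).le hsq)
    · rw [show unitB _ = 1 from rfl, h1, abs_mul, Real.abs_exp]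
      exact mul_le_mul hl ht (Real.exp_pos _).le (by positivity)
    · rw [fderiv_fderiv_apply (by fun_prop)]
      simp only [show ∀ j, unitB j = 1 from fun _ => rfl, h1]
      rw [fderiv_const_mul (by fun_prop), smul_apply, h1, smul_eq_mul, ← mul_assoc, abs_mul,
        Real.abs_exp, abs_mul, ← sq]
      exact mul_le_mul_of_nonneg_left ht (by positivity)
  have h4 : C2Le (modelBasis m) (modelT m (ξ - 1)) (fun z => Real.exp (ℓ * (0 + 1 * z.2)))
      (ℓ ^ 2 * Real.exp (|ℓ| * ξ)) :=
    h3.comp_snd (t₀ := 0) (ℓ := 1) (by simp) fun z hz => by simpa using h2 z hz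
  simpa using h4

theorem EuclideanSpace.norm_le_sum_abs {m : ℕ} (x : EuclideanSpace ℝ (Fin m)) :
    ‖x‖ ≤ ∑ j, |x j| := by
  conv_lhs => rw [← sum_smul_stdB x]
  refine (norm_sum_le _ _).trans (Finset.sum_le_sum fun j _ => ?_)
  simp [norm_smul, stdB]

/-- The linear map of `ℝ^m` with matrix `s A`. -/
def scaledMap {m : ℕ} (s : ℝ) (A : Matrix (Fin m) (Fin m) ℝ) :
    EuclideanSpace ℝ (Fin m) →L[ℝ] EuclideanSpace ℝ (Fin m) :=
  s • Matrix.toEuclideanCLM (𝕜 := ℝ) A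

theorem scaledMap_apply {m : ℕ} (s : ℝ) (A : Matrix (Fin m) (Fin m) ℝ)
    (x : EuclideanSpace ℝ (Fin m)) (j : Fin m) : scaledMap s A x j = s * ∑ k, A j k * x k := by
  have := congrFun (Matrix.ofLp_toEuclideanCLM (𝕜 := ℝ) A x) j
  change s * (Matrix.toEuclideanCLM (𝕜 := ℝ) A x) j = _
  rw [this]
  rfl

theorem scaledMap_stdB {m : ℕ} (s : ℝ) (A : Matrix (Fin m) (Fin m) ℝ) (j k : Fin m) :
    scaledMap s A (stdB m k) j = s * A j k := by
  rw [scaledMap_apply]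
  simp [stdB]

theorem injective_scaledMap {m : ℕ} {s : ℝ} (hs : s ≠ 0) {A : Matrix (Fin m) (Fin m) ℝ}
    (hA : IsUnit A) : Function.Injective (scaledMap s A) := by
  intro x y hxy
  have h : s • Matrix.toEuclideanCLM (𝕜 := ℝ) A x = s • Matrix.toEuclideanCLM (𝕜 := ℝ) A y := hxy
  have h1 := smul_right_injective _ hs h
  have h2 : A.mulVec x.ofLp = A.mulVec y.ofLp := by
    have := congrArg WithLp.ofLp h1
    rwa [Matrix.ofLp_toEuclideanCLM, Matrix.ofLp_toEuclideanCLM] at this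
  have h3 := Matrix.mulVec_injective_iff_isUnit.2 hA h2
  exact WithLp.ofLp_injective 2 h3

theorem sum_abs_scaledMap_le {m : ℕ} {s α : ℝ} (hs : 0 ≤ s) {A : Matrix (Fin m) (Fin m) ℝ}
    (hA : ∀ j k, |A j k| ≤ α) {x : EuclideanSpace ℝ (Fin m)} (hx : ‖x‖ ≤ 1) :
    ∑ j, |scaledMap s A x j| ≤ s * (m * (m * α)) := by
  have h : ∀ j ∈ Finset.univ, |scaledMap s A x j| ≤ s * (m * α) := by
    intro j _
    rw [scaledMap_apply, abs_mul, abs_of_nonneg hs]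
    refine mul_le_mul_of_nonneg_left ((Finset.abs_sum_le_sum_abs _ _).trans ?_) hs
    refine (Finset.sum_le_card_nsmul _ _ α fun k _ => ?_).trans_eq (by simp)
    rw [abs_mul]
    have : |x k| ≤ 1 := (PiLp.norm_apply_le x k).trans hx
    calc |A j k| * |x k| ≤ |A j k| * 1 := by gcongr
      _ ≤ α := by simpa using hA j k
  refine (Finset.sum_le_card_nsmul _ _ _ h).trans_eq ?_
  simp; ring

theorem norm_scaledMap_le {m : ℕ} {s α : ℝ} (hs : 0 ≤ s) {A : Matrix (Fin m) (Fin m) ℝ}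
    (hA : ∀ j k, |A j k| ≤ α) {x : EuclideanSpace ℝ (Fin m)} (hx : ‖x‖ ≤ 1) :
    ‖scaledMap s A x‖ ≤ s * (m * (m * α)) :=
  (EuclideanSpace.norm_le_sum_abs _).trans (sum_abs_scaledMap_le hs hA hx)

/-- A function on a chart of the sphere, rescaled around a point. -/
theorem C2Le.comp_scaled {m : ℕ} {f : EuclideanSpace ℝ (Fin m) → ℝ} {K η s α : ℝ} {ξ : ℝ}
    {z₀ : EuclideanSpace ℝ (Fin m)} (hη : 0 < η) (hf : C2Le (stdB m) (Metric.ball z₀ η) f K)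
    (hs : 0 ≤ s) {A : Matrix (Fin m) (Fin m) ℝ} (hA : ∀ j k, |A j k| ≤ α)
    (h1 : s * (m * (m * α)) ≤ 1) (h2 : s * (m * (m * α)) < η) :
    C2Le (modelBasis m) (modelT m ξ) (fun z => f (z₀ + scaledMap s A z.1)) K ∧
    C2Le (modelBasis m) (modelT m ξ) (fun z => f (z₀ + scaledMap s A z.1) - f z₀)
      (s * (m * (m * α)) * K) := by
  set L : EuclideanSpace ℝ (Fin m) × ℝ →L[ℝ] EuclideanSpace ℝ (Fin m) :=
    (scaledMap s A).comp (ContinuousLinearMap.fst ℝ _ ℝ) with hL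
  have hLz : ∀ z, L z = scaledMap s A z.1 := fun z => rfl
  have hz : ∀ z ∈ modelT m ξ, ‖z.1‖ ≤ 1 := fun z hz => by
    have := hz.1
    rw [mem_ball_zero_iff] at this
    exact this.le
  have hb : ∀ i, ‖(modelBasis m i).1‖ ≤ 1 := by
    rintro (i | i) <;> simp [modelBasis]
  have hmem : ∀ z ∈ modelT m ξ, z₀ + L z ∈ Metric.ball z₀ η := fun z hz' => by
    rw [mem_ball_iff_norm, add_sub_cancel_left]
    exact (norm_scaledMap_le hs hA (hz z hz')).trans_lt h2
  have hα : ∀ i, L (modelBasis m i) = ∑ j, (L (modelBasis m i)) j • stdB m j := fun i =>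
    (sum_smul_stdB _).symm
  have hκ : ∀ i, ∑ j, |(L (modelBasis m i)) j| ≤ s * (m * (m * α)) := fun i =>
    sum_abs_scaledMap_le hs hA (hb i)
  refine ⟨hf.comp_affine z₀ L hmem _ hα fun i => (hκ i).trans h1, ?_⟩
  exact hf.comp_affine_sub (convex_ball _ _) (Metric.mem_ball_self hη) L hmem _ hα hκ
    (fun z j => L z j) (fun z _ => (sum_smul_stdB _).symm)
    (fun z hz' => sum_abs_scaledMap_le hs hA (hz z hz')) h1

/-! ### Interpolation between the round metric and a bounded metric -/

section Interp

variable {m : ℕ}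

/-- The form `(1 - θ) g₀ + θ g₁`. -/
def interpForm (θ : ℝ) (g₀ g₁ : SphForm m) : SphForm m := fun x => (1 - θ) • g₀ x + θ • g₁ x

theorem IsInnerForm.interp {θ : ℝ} (h0 : 0 ≤ θ) (h1 : θ ≤ 1) {g₀ g₁ : SphForm m}
    (hg₀ : IsInnerForm g₀) (hg₁ : θ ≠ 0 → IsInnerForm g₁) : IsInnerForm (interpForm θ g₀ g₁) := by
  rcases eq_or_lt_of_le h0 with h | h
  · have : interpForm θ g₀ g₁ = g₀ := by
      funext x
      ext v w
      change (1 - θ) * g₀ x v w + θ * g₁ x v w = g₀ x v w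
      rw [← h]; ring
    rwa [this]
  · have hg := hg₁ h.ne'
    refine ⟨fun x v w => ?_, fun x v hv => ?_⟩
    · change (1 - θ) * g₀ x v w + θ * g₁ x v w = (1 - θ) * g₀ x w v + θ * g₁ x w v
      rw [hg₀.1 x v w, hg.1 x v w]
    · change 0 < (1 - θ) * g₀ x v v + θ * g₁ x v v
      have a1 := hg₀.2 x v hv
      have a2 := hg.2 x v hv
      have a3 : 0 ≤ (1 - θ) * g₀ x v v := mul_nonneg (by linarith) a1.le
      have a4 := mul_pos h a2
      linarith

theorem IsInnerForm.smul {c : ℝ} (hc : 0 < c) {g : SphForm m} (hg : IsInnerForm g) :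
    IsInnerForm (fun x => c • g x) := by
  refine ⟨fun x v w => ?_, fun x v hv => mul_pos hc (hg.2 x v hv)⟩
  change c * g x v w = c * g x w v
  rw [hg.1 x v w]

/-- With subscript 0 for values at the center, the difference is (f - f₀) + (ρ - ρ₀)(g - f) + ρ₀ ((g
- g₀) - (f - f₀)). The outer terms are small by rescaling, the middle one by the slow cutoff. -/
theorem C2Le.interp {ρ : ℝ → ℝ} {K C ξ t₀ ℓ η s α : ℝ} (hξ : 1 ≤ ξ)
    (hρ : C2Le unitB Set.univ ρ K) (hρ01 : |ρ t₀| ≤ 1) (hℓ0 : 0 ≤ ℓ) (hℓ : ℓ * ξ ≤ 1)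
    {f g : EuclideanSpace ℝ (Fin m) → ℝ} {z₀ : EuclideanSpace ℝ (Fin m)} (hη : 0 < η)
    (hf : C2Le (stdB m) (Metric.ball z₀ η) f C) (hg : C2Le (stdB m) (Metric.ball z₀ η) g C)
    (hs : 0 ≤ s) {A : Matrix (Fin m) (Fin m) ℝ} (hA : ∀ j k, |A j k| ≤ α)
    (h1 : s * (m * (m * α)) ≤ 1) (h2 : s * (m * (m * α)) < η) :
    C2Le (modelBasis m) (modelT m (ξ - 1)) (fun z =>
      ((1 - ρ (t₀ + ℓ * z.2)) * f (z₀ + scaledMap s A z.1)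
        + ρ (t₀ + ℓ * z.2) * g (z₀ + scaledMap s A z.1)) - ((1 - ρ t₀) * f z₀ + ρ t₀ * g z₀))
      (3 * (s * (m * (m * α))) * C + 8 * (ℓ * ξ * K) * C) := by
  obtain ⟨f1, f2⟩ := hf.comp_scaled (ξ := ξ - 1) hη hs hA h1 h2
  obtain ⟨g1, g2⟩ := hg.comp_scaled (ξ := ξ - 1) hη hs hA h1 h2
  have hρ' := hρ.comp_snd_sub (m := m) hξ (t₀ := t₀) (ℓ := ℓ) (by rwa [abs_of_nonneg hℓ0])
  rw [abs_of_nonneg hℓ0] at hρ'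
  have hC : 0 ≤ s * (m * (m * α)) * C := by
    have h0 : (0, 0) ∈ modelT m (ξ - 1) := zero_mem_modelT m (by linarith)
    exact (abs_nonneg _).trans (f2.2 _ h0)
  have key := (f2.add (hρ'.mul (g1.sub f1))).add ((g2.sub f2).const_mul (ρ t₀))
  refine (key.mono ?_).congr (isOpen_modelT _ _) fun z _ => by ring
  have : |ρ t₀| * (s * (m * (m * α)) * C + s * (m * (m * α)) * C)
      ≤ 1 * (s * (m * (m * α)) * C + s * (m * (m * α)) * C) := by gcongr
  linarith

/-- Expand (1 - x)² - 1 = -2x + x² with x = e^{-2(t+a)}. The two terms contribute 8 and 16, which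
gives 24. -/
theorem c2Le_warp_sub (ξ : ℝ) (hξ : 0 ≤ ξ) {a : ℝ} (ha : 0 < a) :
    C2Le (modelBasis m) (modelT m (ξ - 1)) (fun z => (1 - Real.exp (-2 * (z.2 + a))) ^ 2 - 1)
      (24 * Real.exp (4 * ξ) * Real.exp (-a)) := by
  have h1 := (c2Le_exp (m := m) (-2) ξ (by norm_num)).const_mul (-2 * Real.exp (-2 * a))
  have h2 := (c2Le_exp (m := m) (-4) ξ (by norm_num)).const_mul (Real.exp (-4 * a))
  refine ((h1.add h2).mono ?_).congr (isOpen_modelT _ _) fun z _ => ?_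
  · rw [abs_mul, Real.abs_exp, Real.abs_exp]
    have e1 : Real.exp (-2 * a) ≤ Real.exp (-a) := Real.exp_le_exp.2 (by linarith)
    have e2 : Real.exp (-4 * a) ≤ Real.exp (-a) := Real.exp_le_exp.2 (by linarith)
    have e3 : Real.exp (|(-2)| * ξ) ≤ Real.exp (4 * ξ) := Real.exp_le_exp.2 (by norm_num; linarith)
    have e4 : Real.exp (|(-4)| * ξ) = Real.exp (4 * ξ) := by norm_num
    rw [e4]
    have e5 : Real.exp (-2 * a) * Real.exp (|(-2)| * ξ) ≤ Real.exp (-a) * Real.exp (4 * ξ) := by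
      gcongr
    have e6 : Real.exp (-4 * a) * Real.exp (4 * ξ) ≤ Real.exp (-a) * Real.exp (4 * ξ) := by
      gcongr
    norm_num at e5 e6 ⊢
    linarith
  · have e1 : Real.exp (-2 * (z.2 + a)) = Real.exp (-2 * a) * Real.exp (-2 * z.2) := by
      rw [← Real.exp_add]; ring_nf
    have e2 : Real.exp (-4 * a) = Real.exp (-2 * a) ^ 2 := by
      rw [← Real.exp_nat_mul]; ring_nf
    have e3 : Real.exp (-4 * z.2) = Real.exp (-2 * z.2) ^ 2 := by
      rw [← Real.exp_nat_mul]; ring_nf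
    rw [e1, e2, e3]; ring

/-- Separates the model factor e^{2t} from the scale defect (s e^a / 2)², which is 1 for s =
2e^{-a}, and from the defect of sinh against half an exponential. -/
theorem sinh_sq_eq (a t s : ℝ) : Real.sinh (t + a) ^ 2 * s ^ 2 =
    Real.exp (2 * t) * ((s * Real.exp a / 2) ^ 2 * (1 - Real.exp (-2 * (t + a))) ^ 2) := by
  have e1 : Real.exp (-(t + a)) = Real.exp (t + a) * Real.exp (-2 * (t + a)) := by
    rw [← Real.exp_add]; ring_nf
  have e2 : Real.exp (2 * t) = Real.exp t ^ 2 := by rw [← Real.exp_nat_mul]; ring_nf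
  rw [Real.sinh_eq, e1, e2, Real.exp_add]
  ring

/-- With μ the scale defect and q = (1 - e^{-2(t+a)})², the difference is e^{2t} (μ q (S - δ) + δ (μ
(q - 1) + (μ - 1))). The scale s may fall below 2e^{-a}, provided 1 - μ is still O(e^{-a}). -/
theorem c2Le_warped {ξ a s K ε : ℝ} (hξ : 0 < ξ) (ha : 0 < a) (hs : 0 < s)
    (hs2 : s ≤ 2 * Real.exp (-a)) (hsK : 1 - (s * Real.exp a / 2) ^ 2 ≤ K * Real.exp (-a))
    {S : EuclideanSpace ℝ (Fin m) × ℝ → ℝ} {δ : ℝ} (hδ : |δ| ≤ 1)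
    (hS : C2Le (modelBasis m) (modelT m (ξ - 1)) (fun z => S z - δ) ε) :
    C2Le (modelBasis m) (modelT m (ξ - 1))
      (fun z => Real.sinh (z.2 + a) ^ 2 * s ^ 2 * S z - Real.exp (2 * z.2) * δ)
      (16 * Real.exp (2 * ξ) * ((4 * (24 * Real.exp (4 * ξ) + 1)) * ε
        + (24 * Real.exp (4 * ξ) + K) * Real.exp (-a))) := by
  have h0 : (0, 0) ∈ modelT m (ξ - 1) := zero_mem_modelT m (by linarith)
  have hε : 0 ≤ ε := (abs_nonneg _).trans (hS.2 _ h0)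
  set μ := (s * Real.exp a / 2) ^ 2 with hμ
  have hμ0 : 0 ≤ μ := sq_nonneg _
  have hμ1 : μ ≤ 1 := by
    refine pow_le_one₀ (by positivity) ?_
    have : s * Real.exp a ≤ 2 * Real.exp (-a) * Real.exp a := by gcongr
    rw [mul_assoc, ← Real.exp_add] at this
    simp at this
    linarith
  have hq := c2Le_warp_sub (m := m) ξ hξ.le ha
  set E := 24 * Real.exp (4 * ξ) with hE
  have hE0 : 0 < E := by positivity
  have hex : Real.exp (-a) ≤ 1 := Real.exp_le_one_iff.2 (by linarith)
  have hq1 : C2Le (modelBasis m) (modelT m (ξ - 1))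
      (fun z => (1 - Real.exp (-2 * (z.2 + a))) ^ 2) (E + 1) := by
    refine ((hq.add (C2Le.const 1)).mono ?_).congr (isOpen_modelT _ _) fun z _ => by ring
    have : E * Real.exp (-a) ≤ E * 1 := by gcongr
    simpa using this
  have k1 := (hq1.mul hS).const_mul μ
  have k2 := (hq.const_mul μ).add (C2Le.const (b := modelBasis m) (s := modelT m (ξ - 1)) (μ - 1))
  have k3 := (c2Le_exp (m := m) 2 ξ (by norm_num)).mul (k1.add (k2.const_mul δ))
  refine (k3.mono ?_).congr (isOpen_modelT _ _) fun z _ => ?_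
  · rw [abs_of_nonneg hμ0, abs_of_nonpos (by linarith : μ - 1 ≤ 0)]
    have e1 : μ * (4 * (E + 1) * ε) ≤ 1 * (4 * (E + 1) * ε) := by gcongr
    have e2 : μ * (E * Real.exp (-a)) ≤ 1 * (E * Real.exp (-a)) := by gcongr
    have e3 : |δ| * (μ * (E * Real.exp (-a)) + -(μ - 1))
        ≤ 1 * (1 * (E * Real.exp (-a)) + K * Real.exp (-a)) := by
      refine mul_le_mul hδ (by linarith) ?_ (by norm_num)
      have : 0 ≤ μ * (E * Real.exp (-a)) := by positivity
      linarith
    have e4 : |(2 : ℝ)| = 2 := by norm_num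
    rw [e4]
    have e5 : 4 * (2 ^ 2 * Real.exp (2 * ξ)) = 16 * Real.exp (2 * ξ) := by ring
    rw [e5]
    refine mul_le_mul_of_nonneg_left ?_ (by positivity)
    linarith
  · rw [sinh_sq_eq]
    ring

end Interp

/-! ### New charts away from the forcing zone -/

section CaseB

variable {m : ℕ}

theorem radialCoeff_scaled (𝒜 : SphereAtlas m) (i : Fin 𝒜.N) {z₀ : EuclideanSpace ℝ (Fin m)}
    {s : ℝ} {A : Matrix (Fin m) (Fin m) ℝ} {z : EuclideanSpace ℝ (Fin m) × ℝ}
    (hz : z₀ + scaledMap s A z.1 ∈ (𝒜.chart i).target) (h : ℝ → SphForm m) (a : ℝ) (j k : Fin m) :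
    radialCoeff h (fun y => (𝒜.chart i).symm (z₀ + scaledMap s A y)) a (stdB m j) (stdB m k) z
      = s ^ 2 * ∑ p, ∑ q, A p j * A q k * 𝒜.coeff i (h (z.2 + a)) (p, q)
          (z₀ + scaledMap s A z.1) := by
  have h1 : MDifferentiableAt 𝓘(ℝ, EuclideanSpace ℝ (Fin m)) (𝓡 m) (𝒜.chart i).symm
      (z₀ + scaledMap s A z.1) :=
    ((𝒜.contMDiffOn_symm i).contMDiffAt
      ((𝒜.chart i).open_target.mem_nhds hz)).mdifferentiableAt (by simp)
  have h2 : HasFDerivAt (fun y => z₀ + scaledMap s A y) (scaledMap s A) z.1 :=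
    (scaledMap s A).hasFDerivAt.const_add z₀
  have h3 : mfderiv 𝓘(ℝ, EuclideanSpace ℝ (Fin m)) (𝓡 m)
      (fun y => (𝒜.chart i).symm (z₀ + scaledMap s A y)) z.1 =
      (mfderiv 𝓘(ℝ, EuclideanSpace ℝ (Fin m)) (𝓡 m) (𝒜.chart i).symm
        (z₀ + scaledMap s A z.1)).comp (scaledMap s A) :=
    (HasMFDerivAt.comp (f := fun y => z₀ + scaledMap s A y) z.1 h1.hasMFDerivAt
      h2.hasMFDerivAt).mfderiv
  rw [radialCoeff, h3]
  refine (𝒜.sum_sum_coeff i (h (z.2 + a)) (z₀ + scaledMap s A z.1) (scaledMap s A (stdB m j))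
    (scaledMap s A (stdB m k))).symm.trans ?_
  simp only [scaledMap_stdB, Finset.mul_sum]
  refine Finset.sum_congr rfl fun p _ => Finset.sum_congr rfl fun q _ => ?_
  ring

theorem scaled_chart_spec (𝒜 : SphereAtlas m) (i : Fin 𝒜.N) {z₀ : EuclideanSpace ℝ (Fin m)}
    {s : ℝ} (hs : s ≠ 0) {A : Matrix (Fin m) (Fin m) ℝ} (hA : IsUnit A)
    (hz : ∀ y ∈ Metric.ball (0 : EuclideanSpace ℝ (Fin m)) 1,
      z₀ + scaledMap s A y ∈ (𝒜.chart i).target) :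
    ContMDiffOn 𝓘(ℝ, EuclideanSpace ℝ (Fin m)) (𝓡 m) ∞
      (fun y => (𝒜.chart i).symm (z₀ + scaledMap s A y)) (Metric.ball 0 1) ∧
    Set.InjOn (fun y => (𝒜.chart i).symm (z₀ + scaledMap s A y)) (Metric.ball 0 1) ∧
    ∀ y ∈ Metric.ball (0 : EuclideanSpace ℝ (Fin m)) 1, Function.Injective
      (mfderiv 𝓘(ℝ, EuclideanSpace ℝ (Fin m)) (𝓡 m)
        (fun y => (𝒜.chart i).symm (z₀ + scaledMap s A y)) y) := by
  have h0 : ContMDiff 𝓘(ℝ, EuclideanSpace ℝ (Fin m)) 𝓘(ℝ, EuclideanSpace ℝ (Fin m)) ∞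
      (fun y => z₀ + scaledMap s A y) := ContDiff.contMDiff (by fun_prop)
  refine ⟨(𝒜.contMDiffOn_symm i).comp h0.contMDiffOn hz, fun y hy y' hy' hyy => ?_,
    fun y hy => ?_⟩
  · have := (𝒜.chart i).symm.injOn (hz y hy) (hz y' hy') hyy
    exact injective_scaledMap hs hA (add_left_cancel this)
  · have h1 : MDifferentiableAt 𝓘(ℝ, EuclideanSpace ℝ (Fin m)) (𝓡 m) (𝒜.chart i).symm
        (z₀ + scaledMap s A y) :=
      ((𝒜.contMDiffOn_symm i).contMDiffAt
        ((𝒜.chart i).open_target.mem_nhds (hz y hy))).mdifferentiableAt (by simp)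
    have h2 : HasFDerivAt (fun y => z₀ + scaledMap s A y) (scaledMap s A) y :=
      (scaledMap s A).hasFDerivAt.const_add z₀
    have h3 := (HasMFDerivAt.comp (f := fun y => z₀ + scaledMap s A y) y h1.hasMFDerivAt
      h2.hasMFDerivAt).mfderiv
    rw [show (fun y => (𝒜.chart i).symm (z₀ + scaledMap s A y)) =
      (𝒜.chart i).symm ∘ fun y => z₀ + scaledMap s A y from rfl, h3]
    exact (𝒜.injective_mfderiv_symm i (hz y hy)).comp (injective_scaledMap hs hA)

/-- The metric which interpolates in the radial direction between the round metric and a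
`c`-bounded metric is close to hyperbolic, if it is warped with `sinh²`. -/
theorem exists_close_of_cBounded {ρ : ℝ → ℝ} (hρ : IsTrickCutoff ρ) {ξ : ℝ} (hξ : 1 < ξ)
    (𝒜 : SphereAtlas m) {c : ℝ} (hc : 1 < c) :
    ∃ C > 0, ∀ γ : SphForm m, CkFamily 2 (Set.univ : Set ℝ) (fun _ => γ) → IsInnerForm γ →
      𝒜.CBounded c γ → ∀ (x : Sph m) (a b d : ℝ), 0 < a → 4 * (1 + ξ) ≤ d →
      ∃ φ₁ : EuclideanSpace ℝ (Fin m) → Sph m,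
        ContMDiffOn 𝓘(ℝ, EuclideanSpace ℝ (Fin m)) (𝓡 m) ∞ φ₁ (Metric.ball 0 1) ∧
        Set.InjOn φ₁ (Metric.ball 0 1) ∧
        (∀ y ∈ Metric.ball (0 : EuclideanSpace ℝ (Fin m)) 1,
          Function.Injective (mfderiv 𝓘(ℝ, EuclideanSpace ℝ (Fin m)) (𝓡 m) φ₁ y)) ∧
        φ₁ 0 = x ∧ ∀ j k : Fin m, C2Le (modelBasis m) (modelT m (ξ - 1))
          (fun z => radialCoeff (fun r x => Real.sinh r ^ 2 •
              interpForm (ρ (2 * (r - b) / d)) (roundMetric m) γ x) φ₁ a (stdB m j) (stdB m k) z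
            - Real.exp (2 * z.2) * inner ℝ (stdB m j) (stdB m k))
          (C * (Real.exp (-a) + 1 / d)) := by
  obtain ⟨Kρ, hKρ1, hKρ⟩ := exists_c2Le_cutoff hρ.smooth hρ.zero hρ.one
  have hround : CkFamily 2 {(0 : ℝ)} fun _ => roundMetric m :=
    ContMDiffOn.of_le (ckFamily_roundMetric m {(0 : ℝ)}) (by norm_cast)
  obtain ⟨Cσ, hCσ, ησ, hησ, hσ⟩ := 𝒜.exists_bounds_of_isCompact isCompact_singleton hround
    fun _ _ => isInnerForm_roundMetric m
  replace hσ := hσ 0 rfl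
  obtain ⟨κ₁, hκ₁, hlow₁⟩ := exists_posDef_lower_bound m (c := Cσ) hησ
  obtain ⟨κ₂, hκ₂, hlow₂⟩ := exists_posDef_lower_bound m (c := c) (η := 1 / c) (by positivity)
  obtain ⟨η, hη, hleb⟩ := 𝒜.exists_lebesgue
  set κ := min κ₁ κ₂ with hκdef
  have hκ : 0 < κ := lt_min hκ₁ hκ₂
  set α := Real.sqrt (1 / κ) with hαdef
  have hα : 0 ≤ α := Real.sqrt_nonneg _
  set β : ℝ := m * (m * α) with hβdef
  have hβ : 0 ≤ β := by positivity
  set C₀ := max Cσ c with hC₀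
  have hC₀0 : 0 < C₀ := hCσ.trans_le (le_max_left _ _)
  -- Any s ≤ s₀ keeps the rescaled unit ball inside the ball of radius η in the atlas chart and the
  -- linear part of ℓ¹-norm at most 1. Here β = m²α bounds the ℓ¹-norm of A on unit vectors.
  set s₀ := min 1 η / (2 * (β + 1)) with hs₀def
  have hmin : 0 < min 1 η := lt_min one_pos hη
  have hs₀ : 0 < s₀ := by positivity
  have hs₀β : s₀ * β < min 1 η := by
    rw [hs₀def, div_mul_eq_mul_div, div_lt_iff₀ (by positivity)]
    nlinarith
  set E := 24 * Real.exp (4 * ξ) with hE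
  set D₁ := 6 * β * C₀ + 16 * (ξ * Kρ) * C₀ with hD₁
  have hD₁0 : 0 ≤ D₁ := by positivity
  set D := 16 * Real.exp (2 * ξ) * (4 * (E + 1) * (β * α * D₁) + (E + 2 / s₀)) with hD
  refine ⟨D + 1, by positivity, fun γ hγ hγi hγc x a b d ha hd => ?_⟩
  have hd0 : 0 < d := by linarith
  obtain ⟨i, hxi, hball⟩ := hleb x
  set z₀ := 𝒜.chart i x with hz₀
  have hz₀i : z₀ ∈ 𝒜.chart i '' 𝒜.dom i := ⟨x, hxi, rfl⟩
  have himt : 𝒜.chart i '' 𝒜.dom i ⊆ (𝒜.chart i).target :=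
    (𝒜.image_subset_cl i).trans (𝒜.cl_subset_target i)
  have hz₀t := himt hz₀i
  set θ := ρ (2 * (a - b) / d) with hθ
  have hθ01 := hρ.mem (2 * (a - b) / d)
  have hf : ∀ pq, C2Le (stdB m) (Metric.ball z₀ η) (𝒜.coeff i (roundMetric m) pq) C₀ := fun pq =>
    ((hσ i).1 pq).mono_set (hball.trans (𝒜.image_subset_cl i)) |>.mono (le_max_left _ _)
  have hg : ∀ pq, C2Le (stdB m) (Metric.ball z₀ η) (𝒜.coeff i γ pq) C₀ := fun pq =>
    (𝒜.c2Le_coeff_of_normLT hγ (p := 0) trivial hγc.1 i pq).mono_set hball |>.mono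
      (le_max_right _ _)
  have hlowσ := hlow₁ _ (𝒜.posDef_gram i (isInnerForm_roundMetric m) hz₀t)
    (fun j k => ((hσ i).1 (j, k)).2 z₀ (𝒜.image_subset_cl i hz₀i))
    ((hσ i).2 z₀ (𝒜.image_subset_cl i hz₀i))
  have hlowγ := hlow₂ _ (𝒜.posDef_gram i hγi hz₀t)
    (fun j k => (𝒜.c2Le_coeff_of_normLT hγ (p := 0) trivial hγc.1 i (j, k)).2 z₀ hz₀i) (by
      have h1 := hγc.2 i z₀ hz₀i
      have h2 := (𝒜.posDef_gram i hγi hz₀t).det_pos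
      rw [SphereAtlas.gram] at h2
      rw [abs_of_pos h2] at h1
      exact h1.le)
  -- The interpolated form frozen at the center of the chart. Its lower bound κ does not depend on
  -- θ, since it is a convex combination of two forms bounded below by κ.
  set G := 𝒜.gram i (interpForm θ (roundMetric m) γ) z₀ with hG
  have hGeq : G = (1 - θ) • 𝒜.gram i (roundMetric m) z₀ + θ • 𝒜.gram i γ z₀ := rfl
  have hGpos : G.PosDef := 𝒜.posDef_gram i
    (IsInnerForm.interp hθ01.1 hθ01.2 (isInnerForm_roundMetric m) fun _ => hγi) hz₀t
  have hGlow : ∀ v : Fin m → ℝ, κ * (v ⬝ᵥ v) ≤ v ⬝ᵥ G.mulVec v := by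
    intro v
    have hv : 0 ≤ v ⬝ᵥ v := Finset.sum_nonneg fun _ _ => mul_self_nonneg _
    have l1 : κ * (v ⬝ᵥ v) ≤ κ₁ * (v ⬝ᵥ v) :=
      mul_le_mul_of_nonneg_right (min_le_left _ _) hv
    have l2 : κ * (v ⬝ᵥ v) ≤ κ₂ * (v ⬝ᵥ v) :=
      mul_le_mul_of_nonneg_right (min_le_right _ _) hv
    rw [hGeq, Matrix.add_mulVec, Matrix.smul_mulVec, Matrix.smul_mulVec, dotProduct_add,
      dotProduct_smul, dotProduct_smul, smul_eq_mul, smul_eq_mul]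
    have l3 := mul_le_mul_of_nonneg_left (l1.trans (hlowσ v)) (sub_nonneg.2 hθ01.2)
    have l4 := mul_le_mul_of_nonneg_left (l2.trans (hlowγ v)) hθ01.1
    linarith
  obtain ⟨A, hAu, hAGA, hAα⟩ := exists_orthonormal_frame hκ hGpos hGlow
  -- The ideal scale is 2e^{-a}, capped by s₀ when a is small.
  set s := min (2 * Real.exp (-a)) s₀ with hs
  have hs0 : 0 < s := lt_min (by positivity) hs₀
  have hsβ : s * β < min 1 η :=
    (mul_le_mul_of_nonneg_right (min_le_right _ _) hβ).trans_lt hs₀β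
  have hmem : ∀ y ∈ Metric.ball (0 : EuclideanSpace ℝ (Fin m)) 1,
      z₀ + scaledMap s A y ∈ (𝒜.chart i).target := fun y hy => by
    refine himt (hball ?_)
    rw [mem_ball_iff_norm, add_sub_cancel_left]
    exact (norm_scaledMap_le hs0.le hAα (mem_ball_zero_iff.1 hy).le).trans_lt
      (hsβ.trans_le (min_le_right _ _))
  obtain ⟨p1, p2, p3⟩ := scaled_chart_spec 𝒜 i hs0.ne' hAu hmem
  refine ⟨fun y => (𝒜.chart i).symm (z₀ + scaledMap s A y), p1, p2, p3, ?_, fun j k => ?_⟩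
  · change (𝒜.chart i).symm (z₀ + scaledMap s A 0) = x
    rw [map_zero, add_zero]
    exact (𝒜.chart i).left_inv (𝒜.dom_subset_source i hxi)
  -- Oscillation of the coefficients over the chart: the first term in y, the second in t through
  -- the cutoff, whose argument moves at speed 2 / d.
  set ε₁ := 3 * (s * β) * C₀ + 8 * (2 / d * ξ * Kρ) * C₀ with hε₁
  have hG' : ∀ p q, C2Le (modelBasis m) (modelT m (ξ - 1))
      (fun z => 𝒜.coeff i (interpForm (ρ (2 * (z.2 + a - b) / d)) (roundMetric m) γ) (p, q)
        (z₀ + scaledMap s A z.1) - G p q) ε₁ := by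
    intro p q
    have hℓ : 2 / d * ξ ≤ 1 := by
      rw [div_mul_eq_mul_div, div_le_one hd0]; linarith
    refine (C2Le.interp (t₀ := 2 * (a - b) / d) (ℓ := 2 / d) hξ.le hKρ
      (abs_le.2 ⟨by linarith [hθ01.1], hθ01.2⟩) (by positivity) hℓ hη (hf (p, q)) (hg (p, q))
      hs0.le hAα (hsβ.le.trans (min_le_left _ _)) (hsβ.trans_le (min_le_right _ _))).congr
      (isOpen_modelT _ _) fun z _ => ?_
    have e : 2 * (z.2 + a - b) / d = 2 * (a - b) / d + 2 / d * z.2 := by field_simp; ring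
    rw [e]
    rfl
  set S : EuclideanSpace ℝ (Fin m) × ℝ → ℝ := fun z => ∑ p, ∑ q, A p j * A q k *
    𝒜.coeff i (interpForm (ρ (2 * (z.2 + a - b) / d)) (roundMetric m) γ) (p, q)
        (z₀ + scaledMap s A z.1) with hS
  set δ : ℝ := inner ℝ (stdB m j) (stdB m k) with hδ
  have hδeq : δ = ∑ p, ∑ q, A p j * A q k * G p q := by
    have h1 := congrFun (congrFun hAGA j) k
    have h2 : δ = (1 : Matrix (Fin m) (Fin m) ℝ) j k := by
      simp [hδ, stdB, Matrix.one_apply, EuclideanSpace.inner_single_left]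
    rw [h2, ← h1]
    simp only [Matrix.mul_apply, Matrix.transpose_apply, Finset.sum_mul]
    rw [Finset.sum_comm]
    refine Finset.sum_congr rfl fun p _ => Finset.sum_congr rfl fun q _ => ?_
    ring
  have hε₁0 : 0 ≤ ε₁ := by positivity
  have hSδ : C2Le (modelBasis m) (modelT m (ξ - 1)) (fun z => S z - δ) (β * α * ε₁) := by
    have h1 := C2Le.sum Finset.univ fun p _ => C2Le.sum Finset.univ fun q _ =>
      (hG' p q).const_mul (A p j * A q k)
    refine (h1.mono ?_).congr (isOpen_modelT _ _) fun z _ => ?_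
    · have h2 : ∀ p q, |A p j * A q k| * ε₁ ≤ α * α * ε₁ := fun p q => by
        rw [abs_mul]
        exact mul_le_mul_of_nonneg_right (mul_le_mul (hAα p j) (hAα q k) (abs_nonneg _) hα) hε₁0
      refine (Finset.sum_le_sum fun p _ => Finset.sum_le_sum fun q _ => h2 p q).trans_eq ?_
      simp [hβdef]; ring
    · rw [hδeq, hS]
      simp only [← Finset.sum_sub_distrib, mul_sub]
  have hδ1 : |δ| ≤ 1 := by
    refine (abs_real_inner_le_norm _ _).trans ?_
    simp [stdB]
  -- Without the cap the defect vanishes. With the cap, e^{-a} is bounded below and the right side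
  -- is already at least 1.
  have hμ : 1 - (s * Real.exp a / 2) ^ 2 ≤ 2 / s₀ * Real.exp (-a) := by
    rcases le_total (2 * Real.exp (-a)) s₀ with h | h
    · have : s * Real.exp a / 2 = 1 := by
        rw [hs, min_eq_left h, mul_assoc, ← Real.exp_add]; simp
      rw [this]
      have : 0 ≤ 2 / s₀ * Real.exp (-a) := by positivity
      linarith
    · have h1 : 1 ≤ 2 / s₀ * Real.exp (-a) := by
        rw [div_mul_eq_mul_div, one_le_div hs₀]; exact h
      have := sq_nonneg (s * Real.exp a / 2)
      linarith
  have key := c2Le_warped (a := a) (by linarith : 0 < ξ) ha hs0 (min_le_left _ _) hμ hδ1 hSδ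
  refine (key.mono ?_).congr (isOpen_modelT _ _) fun z hz => ?_
  · have hs2 : s ≤ 2 * Real.exp (-a) := min_le_left _ _
    set ϖ := Real.exp (-a) + 1 / d with hϖ
    have hd' : 0 < 1 / d := by positivity
    have hϖ1 : Real.exp (-a) ≤ ϖ := by linarith
    have hϖ2 : 1 / d ≤ ϖ := by linarith [Real.exp_pos (-a)]
    have hϖ0 : 0 ≤ ϖ := hd'.le.trans hϖ2
    have b1 : ε₁ ≤ D₁ * ϖ := by
      have b2 : 3 * (s * β) * C₀ ≤ 6 * β * C₀ * ϖ := by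
        calc 3 * (s * β) * C₀ ≤ 3 * (2 * ϖ * β) * C₀ := by
              gcongr; linarith
          _ = _ := by ring
      have b3 : 8 * (2 / d * ξ * Kρ) * C₀ ≤ 16 * (ξ * Kρ) * C₀ * ϖ := by
        calc 8 * (2 / d * ξ * Kρ) * C₀ = 16 * (ξ * Kρ) * C₀ * (1 / d) := by ring
          _ ≤ _ := by gcongr
      rw [hD₁, add_mul]; linarith
    calc _ ≤ 16 * Real.exp (2 * ξ) * (4 * (E + 1) * (β * α * (D₁ * ϖ)) + (E + 2 / s₀) * ϖ) := by
          gcongr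
      _ = D * ϖ := by rw [hD]; ring
      _ ≤ (D + 1) * ϖ := by linarith
  · have hz' := hmem z.1 hz.1
    rw [radialCoeff_scaled 𝒜 i hz', hS]
    congr 1
    rw [mul_comm (Real.sinh (z.2 + a) ^ 2), mul_assoc]
    congr 1
    rw [Finset.mul_sum]
    refine Finset.sum_congr rfl fun p _ => ?_
    rw [Finset.mul_sum]
    refine Finset.sum_congr rfl fun q _ => ?_
    rw [mul_left_comm]
    rfl

end CaseB

/-! ### Building and restricting radial charts -/

section Charts

variable {m : ℕ} {M : Type*} [TopologicalSpace M]
  [ChartedSpace (EuclideanSpace ℝ (Fin (m + 1))) M]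
  (Φ : EuclideanSpace ℝ (Fin (m + 1)) ≃ₘ⟮𝓡 (m + 1), 𝓡 (m + 1)⟯ M)

/-- The chart `(y, t) ↦ (t + a) φ₁(y)` in polar coordinates. -/
def radialChart (φ₁ : EuclideanSpace ℝ (Fin m) → Sph m) (a : ℝ)
    (z : EuclideanSpace ℝ (Fin m) × ℝ) : M :=
  Φ ((z.2 + a) • (φ₁ z.1 : EuclideanSpace ℝ (Fin (m + 1))))

variable {φ₁ : EuclideanSpace ℝ (Fin m) → Sph m} {a : ℝ}

theorem radius_radialChart {z : EuclideanSpace ℝ (Fin m) × ℝ} (hz : 0 < z.2 + a) :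
    radius Φ (radialChart Φ φ₁ a z) = z.2 + a := by
  simp [radius, radialChart, norm_smul, abs_of_pos hz]

theorem angle_radialChart {z : EuclideanSpace ℝ (Fin m) × ℝ} (hz : 0 < z.2 + a) :
    angle Φ (radialChart Φ φ₁ a z) = φ₁ z.1 := by
  rw [angle_eq, radialChart, Diffeomorph.symm_apply_apply, radialProj_smul hz]

theorem contMDiffOn_radialChart {U : Set (EuclideanSpace ℝ (Fin m))}
    (h : ContMDiffOn 𝓘(ℝ, EuclideanSpace ℝ (Fin m)) (𝓡 m) ∞ φ₁ U) (I : Set ℝ) :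
    ContMDiffOn 𝓘(ℝ, EuclideanSpace ℝ (Fin m) × ℝ) (𝓡 (m + 1)) ∞ (radialChart Φ φ₁ a)
      (U ×ˢ I) := by
  have h1 : ContMDiffOn 𝓘(ℝ, EuclideanSpace ℝ (Fin m) × ℝ) (𝓡 m) ∞
      (fun z : EuclideanSpace ℝ (Fin m) × ℝ => φ₁ z.1) (U ×ˢ I) :=
    h.comp contDiff_fst.contDiffOn.contMDiffOn fun z hz => hz.1
  have h2 : ContMDiffOn 𝓘(ℝ, EuclideanSpace ℝ (Fin m) × ℝ) 𝓘(ℝ, ℝ) ∞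
      (fun z : EuclideanSpace ℝ (Fin m) × ℝ => z.2 + a) (U ×ˢ I) :=
    ContDiffOn.contMDiffOn (by fun_prop)
  exact Φ.contMDiff.comp_contMDiffOn (h2.smul ((contMDiff_coe_sph m ∞).comp_contMDiffOn h1))

theorem radialCoeff_zero_left (h : ℝ → SphForm m) (w : EuclideanSpace ℝ (Fin m))
    (z : EuclideanSpace ℝ (Fin m) × ℝ) : radialCoeff h φ₁ a 0 w z = 0 := by
  have h0 : (mfderiv 𝓘(ℝ, EuclideanSpace ℝ (Fin m)) (𝓡 m) φ₁ z.1)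
      (0 : EuclideanSpace ℝ (Fin m)) = 0 := ContinuousLinearMap.map_zero _
  rw [radialCoeff, h0, map_zero]
  rfl

theorem radialCoeff_zero_right (h : ℝ → SphForm m) (v : EuclideanSpace ℝ (Fin m))
    (z : EuclideanSpace ℝ (Fin m) × ℝ) : radialCoeff h φ₁ a v 0 z = 0 := by
  have h0 : (mfderiv 𝓘(ℝ, EuclideanSpace ℝ (Fin m)) (𝓡 m) φ₁ z.1)
      (0 : EuclideanSpace ℝ (Fin m)) = 0 := ContinuousLinearMap.map_zero _
  rw [radialCoeff, h0, map_zero]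

/-- Components involving ∂_t agree exactly with the model, so only the spherical ones need an
estimate. -/
theorem c2NormLT_of_radial {φ : EuclideanSpace ℝ (Fin m) × ℝ → M} {ξ K ε : ℝ}
    (hφ : ContMDiffOn 𝓘(ℝ, EuclideanSpace ℝ (Fin m) × ℝ) (𝓡 (m + 1)) ∞ φ (modelT m ξ))
    (hpos : ∀ z ∈ modelT m ξ, 0 < radius Φ (φ z))
    (hrad : ∀ z ∈ modelT m ξ, angle Φ (φ z) = φ₁ z.1 ∧ radius Φ (φ z) = z.2 + a)
    {h : ℝ → SphForm m} (hK : 0 ≤ K) (hKε : K < ε)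
    (H : ∀ j k : Fin m, C2Le (modelBasis m) (modelT m ξ) (fun z =>
      radialCoeff h φ₁ a (stdB m j) (stdB m k) z
        - Real.exp (2 * z.2) * inner ℝ (stdB m j) (stdB m k)) K) :
    C2NormLT (modelBasis m) (modelT m ξ)
      (fun jk z => pullbackCoeff Φ h φ jk z - modelMetric m jk z) ε := by
  refine C2NormLT.of_c2Le (fun jk => ?_) hKε
  have h0 : C2Le (modelBasis m) (modelT m ξ) (fun _ => 0) K := (C2Le.const 0).mono (by simpa)
  have hc := fun z hz => pullbackCoeff_sub_modelMetric (z := z) Φ hφ hpos hrad h jk hz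
  rcases jk with ⟨j | j, k | k⟩
  · exact (H j k).congr (isOpen_modelT m ξ) hc
  all_goals
    refine h0.congr (isOpen_modelT m ξ) fun z hz => ?_
    rw [hc z hz]
    simp [modelBasis, radialCoeff_zero_left, radialCoeff_zero_right]

/-- The condition 1 + ξ ≤ a keeps t + a positive, so the chart avoids the center. Injectivity and
immersion are read off from radius and angle. -/
theorem isRadialHypChart_radialChart {ξ K ε : ℝ} (hξ : 0 ≤ ξ) (ha : 1 + ξ ≤ a)
    (hφ₁ : ContMDiffOn 𝓘(ℝ, EuclideanSpace ℝ (Fin m)) (𝓡 m) ∞ φ₁ (Metric.ball 0 1))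
    (hinj : Set.InjOn φ₁ (Metric.ball 0 1))
    (himm : ∀ y ∈ Metric.ball (0 : EuclideanSpace ℝ (Fin m)) 1,
      Function.Injective (mfderiv 𝓘(ℝ, EuclideanSpace ℝ (Fin m)) (𝓡 m) φ₁ y))
    {p : M} (hp : radius Φ p = a) (hp₁ : φ₁ 0 = angle Φ p)
    {h : ℝ → SphForm m} (hK : 0 ≤ K) (hKε : K < ε)
    (H : ∀ j k : Fin m, C2Le (modelBasis m) (modelT m ξ) (fun z =>
      radialCoeff h φ₁ a (stdB m j) (stdB m k) z
        - Real.exp (2 * z.2) * inner ℝ (stdB m j) (stdB m k)) K) :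
    IsRadialHypChart Φ 0 h ε ξ p (radialChart Φ φ₁ a) := by
  have hpos : ∀ z ∈ modelT m ξ, 0 < z.2 + a := fun z hz => by linarith [hz.2.1]
  have hr := fun z hz => radius_radialChart Φ (φ₁ := φ₁) (hpos z hz)
  have hang := fun z hz => angle_radialChart Φ (φ₁ := φ₁) (hpos z hz)
  have hsm : ContMDiffOn 𝓘(ℝ, EuclideanSpace ℝ (Fin m) × ℝ) (𝓡 (m + 1)) ∞
    (radialChart Φ φ₁ a) (modelT m ξ) := contMDiffOn_radialChart Φ hφ₁ _
  have hpos' : ∀ z ∈ modelT m ξ, 0 < radius Φ (radialChart Φ φ₁ a z) := fun z hz => by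
    rw [hr z hz]; exact hpos z hz
  refine ⟨hsm, fun z hz z' hz' hzz => ?_, fun z hz v w hvw => ?_, ?_, hpos',
    ⟨φ₁, a, fun z hz => ⟨hang z hz, hr z hz⟩⟩,
    c2NormLT_of_radial Φ hsm hpos' (fun z hz => ⟨hang z hz, hr z hz⟩) hK hKε H⟩
  · have h1 := congrArg (radius Φ) hzz
    have h2 := congrArg (angle Φ) hzz
    rw [hr z hz, hr z' hz'] at h1
    rw [hang z hz, hang z' hz'] at h2
    exact Prod.ext (hinj hz.1 hz'.1 h2) (add_right_cancel h1)
  · have hz' := (isOpen_modelT m ξ).mem_nhds hz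
    have hd := (hsm.contMDiffAt hz').mdifferentiableAt (by simp)
    have e1 := fun v => mfderiv_angle_of_radial Φ (hpos' z hz) hd
      (Filter.eventually_of_mem hz' fun z' hz' => hang z' hz') v
    have e2 := fun v => mvfderiv_radius_of_radial Φ (hpos' z hz) hd
      (Filter.eventually_of_mem hz' fun z' hz' => hr z' hz') v
    refine Prod.ext (himm z.1 hz.1 ?_) ?_
    · exact (e1 v).symm.trans ((congrArg (mfderiv (𝓡 (m + 1)) (𝓡 m) (angle Φ)
        (radialChart Φ φ₁ a z)) hvw).trans (e1 w))
    · exact (e2 v).symm.trans ((congrArg (mvfderiv (𝓡 (m + 1)) (radius Φ)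
        (radialChart Φ φ₁ a z)) hvw).trans (e2 w))
  · have hpp : 0 < radius Φ p := by rw [hp]; linarith
    have := radius_smul_angle Φ hpp
    rw [radialChart, hp₁]
    simp only [zero_add]
    rw [← hp, this, Diffeomorph.apply_symm_apply]

/-- Restriction of a radial chart, with a change of the metric. -/
theorem IsRadialHypChart.restrict {R ξ ξ' ε ε' : ℝ} {g h : ℝ → SphForm m} {p : M}
    {φ : EuclideanSpace ℝ (Fin m) × ℝ → M} (hφ : IsRadialHypChart Φ R g ε ξ p φ) (hR : 0 ≤ R)
    (hξ : ξ' ≤ ξ) (hclose : C2NormLT (modelBasis m) (modelT m ξ')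
      (fun jk z => pullbackCoeff Φ h φ jk z - modelMetric m jk z) ε') :
    IsRadialHypChart Φ 0 h ε' ξ' p φ := by
  have hs := modelT_mono m hξ
  obtain ⟨φ₁, a, hr⟩ := hφ.radial
  exact ⟨hφ.smooth.mono hs, hφ.injOn.mono hs, fun z hz => hφ.immersion z (hs hz), hφ.center,
    fun z hz => hR.trans_lt (hφ.range z (hs hz)), ⟨φ₁, a, fun z hz => hr z (hs hz)⟩, hclose⟩

theorem IsRadialHypChart.exists_c2Le {R ξ ε : ℝ} (hξ : -1 < ξ) {g : ℝ → SphForm m} {p : M}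
    {φ : EuclideanSpace ℝ (Fin m) × ℝ → M} (hφ : IsRadialHypChart Φ R g ε ξ p φ) (hR : 0 ≤ R)
    (hg : CkFamily 2 (Set.Ioi R) g) :
    ∃ φ₁ : EuclideanSpace ℝ (Fin m) → Sph m, ∃ K, 0 ≤ K ∧ K < ε ∧
      (∀ z ∈ modelT m ξ, angle Φ (φ z) = φ₁ z.1 ∧ radius Φ (φ z) = z.2 + radius Φ p) ∧
      ∀ j k : Fin m, C2Le (modelBasis m) (modelT m ξ) (fun z =>
        radialCoeff g φ₁ (radius Φ p) (stdB m j) (stdB m k) z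
          - Real.exp (2 * z.2) * inner ℝ (stdB m j) (stdB m k)) K := by
  obtain ⟨φ₁, a, hr⟩ := hφ.radial
  -- The chart is centered at p, so evaluating at the origin forces the shift to be the radius of p.
  have ha : a = radius Φ p := by
    have := (hr (0, 0) (zero_mem_modelT m hξ)).2
    rw [hφ.center] at this
    simpa using this.symm
  rw [ha] at hr
  have hpos : ∀ z ∈ modelT m ξ, 0 < radius Φ (φ z) := fun z hz => hR.trans_lt (hφ.range z hz)
  have hφ₁ := contMDiffOn_of_radial Φ hξ hφ.smooth hpos fun z hz => (hr z hz).1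
  obtain ⟨K, hK, hKc⟩ := hφ.close
  have hK0 : 0 ≤ K := (abs_nonneg _).trans
    (hKc (0, 0) (zero_mem_modelT m hξ) (Sum.inr (), Sum.inr ()) 0 (by norm_num) Fin.elim0)
  refine ⟨φ₁, K, hK0, hK, hr, fun j k => ?_⟩
  -- The norm inequality alone does not give differentiability, because derivatives default to 0
  -- where they do not exist. It comes from the smoothness of the chart and the family.
  have hC2 : ∀ z ∈ modelT m ξ, ContDiffAt ℝ 2 (fun z =>
        radialCoeff g φ₁ (radius Φ p) (stdB m j) (stdB m k) z
          - Real.exp (2 * z.2) * inner ℝ (stdB m j) (stdB m k)) z := by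
    intro z hz
    have h1 := contDiffOn_radialCoeff (by norm_cast) hg Metric.isOpen_ball hφ₁ (radius Φ p)
      (stdB m j) (stdB m k)
    have h2 : ContDiffAt ℝ 2 (radialCoeff g φ₁ (radius Φ p) (stdB m j) (stdB m k)) z := by
      refine (h1.mono fun z hz => ⟨hz.1, ?_⟩).contDiffAt ((isOpen_modelT m ξ).mem_nhds hz)
      rw [Set.mem_Ioi, ← (hr z hz).2]
      exact hφ.range z hz
    exact h2.sub (by fun_prop)
  have hc := fun z hz => pullbackCoeff_sub_modelMetric (z := z) Φ hφ.smooth hpos hr g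
    (Sum.inl j, Sum.inl k) hz
  refine C2Le.of_iteratedFDeriv hC2 fun z hz n hn l => ?_
  have h1 := hKc z hz (Sum.inl j, Sum.inl k) n hn l
  have h2 : (fun z => pullbackCoeff Φ g φ (Sum.inl j, Sum.inl k) z
      - modelMetric m (Sum.inl j, Sum.inl k) z) =ᶠ[nhds z] fun z =>
        radialCoeff g φ₁ (radius Φ p) (stdB m j) (stdB m k) z
          - Real.exp (2 * z.2) * inner ℝ (stdB m j) (stdB m k) :=
    Filter.eventually_of_mem ((isOpen_modelT m ξ).mem_nhds hz) hc
  have h3 := (h2.iteratedFDeriv ℝ n).self_of_nhds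
  dsimp only at h1 h3
  rwa [h3] at h1

end Charts

/-! ### Warp forcing in a given hyperbolic chart -/

section Forcing

/-- `sinh (x + lam) / sinh lam` is close to `e^x` for large `lam`. -/
theorem sinh_add_div_sinh {x lam : ℝ} (hlam : 1 ≤ lam) :
    Real.sinh (x + lam) / Real.sinh lam
      = Real.exp x + Real.exp (-lam) / Real.sinh lam * Real.sinh x := by
  have h : Real.sinh lam ≠ 0 := (Real.sinh_pos_iff.2 (by linarith)).ne'
  rw [Real.sinh_add, ← Real.cosh_sub_sinh lam, ← Real.cosh_add_sinh x]
  field_simp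
  ring

theorem C2Le.comp_fst {m : ℕ} {ξ ξ' t₀ K : ℝ} {u : EuclideanSpace ℝ (Fin m) × ℝ → ℝ}
    (hu : C2Le (modelBasis m) (modelT m ξ) u K) (ht₀ : t₀ ∈ Set.Ioo (-(1 + ξ)) (1 + ξ)) :
    C2Le (modelBasis m) (modelT m ξ') (fun z => u (z.1, t₀)) K := by
  set L : EuclideanSpace ℝ (Fin m) × ℝ →L[ℝ] EuclideanSpace ℝ (Fin m) × ℝ :=
    (ContinuousLinearMap.inl ℝ _ ℝ).comp (ContinuousLinearMap.fst ℝ _ ℝ) with hL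
  have hLz : ∀ z : EuclideanSpace ℝ (Fin m) × ℝ, ((0 : EuclideanSpace ℝ (Fin m)), t₀) + L z
      = (z.1, t₀) := fun z => by simp [hL]
  have := hu.comp_affine (s := modelT m ξ') (b' := modelBasis m) (0, t₀) L
    (fun z hz => by rw [hLz]; exact ⟨hz.1, ht₀⟩)
    (fun i => Sum.elim (fun j => Pi.single (Sum.inl j) 1) (fun _ => 0) i) (fun i => ?_) fun i => ?_
  · simpa only [hLz] using this
  · rcases i with i | i
    · simp [Pi.single_apply, hL, modelBasis]
    · simp [hL, modelBasis]
  · rcases i with i | i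
    · simp [Pi.single_apply, apply_ite abs]
    · simp

/-- The terms in δ satisfy (1 - ρ) e^{2(t-t₀)} e^{2t₀} δ + ρ e^{2t} δ = e^{2t} δ exactly, so only u
and the defect of sinh(x + lam)/sinh lam against e^x remain. The constant is fixed before the
dimension m. -/
theorem exists_c2Le_forced {ρ : ℝ → ℝ} (hρ : ContDiff ℝ ∞ ρ) {ξ : ℝ} (hξ : 1 < ξ) :
    ∃ C ≥ 1, ∀ (m : ℕ) (u : EuclideanSpace ℝ (Fin m) × ℝ → ℝ) (K δ t₀ lam : ℝ),
      C2Le (modelBasis m) (modelT m ξ) u K → |δ| ≤ 1 → t₀ ∈ Set.Ioo (-(1 + ξ)) (1 + ξ) →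
      1 ≤ lam → C2Le (modelBasis m) (modelT m (ξ - 1)) (fun z =>
        (1 - ρ (z.2 - t₀)) * (Real.sinh (z.2 - t₀ + lam) / Real.sinh lam) ^ 2
            * (u (z.1, t₀) + Real.exp (2 * t₀) * δ)
          + ρ (z.2 - t₀) * (u z + Real.exp (2 * z.2) * δ) - Real.exp (2 * z.2) * δ)
        (C * (K + Real.exp (-lam))) := by
  have hρ2 : ContDiff ℝ 2 ρ := hρ.of_le (by norm_cast)
  have hs : ContDiff ℝ 2 Real.sinh := Real.contDiff_sinh
  have he : ContDiff ℝ 2 Real.exp := Real.contDiff_exp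
  -- The first three functions are the coefficients of (1 - ρ(x)) (e^x + μ sinh x)² in powers of μ.
  -- The argument x = t - t₀ has |x| ≤ 2ξ + 1, since |t| < ξ and |t₀| < 1 + ξ.
  obtain ⟨K₁, h₁⟩ := exists_c2Le_Icc (f := fun x => (1 - ρ x) * Real.exp x ^ 2) (by fun_prop)
    (-(2 * ξ + 1)) (2 * ξ + 1)
  obtain ⟨K₂, h₂⟩ := exists_c2Le_Icc (f := fun x => (1 - ρ x) * (2 * Real.exp x * Real.sinh x))
    (by fun_prop) (-(2 * ξ + 1)) (2 * ξ + 1)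
  obtain ⟨K₃, h₃⟩ := exists_c2Le_Icc (f := fun x => (1 - ρ x) * Real.sinh x ^ 2)
    (by fun_prop) (-(2 * ξ + 1)) (2 * ξ + 1)
  obtain ⟨K₄, h₄⟩ := exists_c2Le_Icc hρ2 (-(2 * ξ + 1)) (2 * ξ + 1)
  have h0 : (0 : ℝ) ∈ Set.Icc (-(2 * ξ + 1)) (2 * ξ + 1) := ⟨by linarith, by linarith⟩
  have p₁ : 0 ≤ K₁ := (abs_nonneg _).trans (h₁.2 0 h0)
  have p₂ : 0 ≤ K₂ := (abs_nonneg _).trans (h₂.2 0 h0)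
  have p₃ : 0 ≤ K₃ := (abs_nonneg _).trans (h₃.2 0 h0)
  have p₄ : 0 ≤ K₄ := (abs_nonneg _).trans (h₄.2 0 h0)
  have hE := Real.exp_pos (2 * (1 + ξ))
  refine ⟨4 * (K₁ + K₂ + K₃) + 4 * K₄ + Real.exp (2 * (1 + ξ)) * (K₂ + K₃) + 1,
    le_add_of_nonneg_left (by positivity), fun m u K δ t₀ lam hu hδ ht₀ hlam => ?_⟩
  have hK : 0 ≤ K := (abs_nonneg _).trans (hu.2 _ (zero_mem_modelT m (by linarith)))
  have hsinh : 1 ≤ Real.sinh lam := hlam.trans (Real.self_le_sinh_iff.2 (by linarith))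
  set μ := Real.exp (-lam) / Real.sinh lam with hμ
  have hμ0 : 0 ≤ μ := by positivity
  have hμe : μ ≤ Real.exp (-lam) := div_le_self (Real.exp_pos _).le hsinh
  have hμ1 : μ ≤ 1 := hμe.trans (Real.exp_le_one_iff.2 (by linarith))
  have hmem : ∀ z ∈ modelT m (ξ - 1), -t₀ + 1 * z.2 ∈ Set.Icc (-(2 * ξ + 1)) (2 * ξ + 1) :=
    fun z hz => ⟨by linarith [hz.2.1, ht₀.2], by linarith [hz.2.2, ht₀.1]⟩
  have c₁ := h₁.comp_snd (by simp) hmem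
  have c₂ := (h₂.comp_snd (by simp) hmem).const_mul μ
  have c₃ := (h₃.comp_snd (by simp) hmem).const_mul (μ ^ 2)
  have c₄ := h₄.comp_snd (by simp) hmem
  have hμ2 : μ ^ 2 ≤ μ := by nlinarith
  rw [abs_of_nonneg hμ0] at c₂
  rw [abs_of_nonneg (sq_nonneg μ)] at c₃
  have cu := hu.mono_set (modelT_mono m (by linarith : ξ - 1 ≤ ξ))
  have key := ((((c₁.add c₂).add c₃).mul (hu.comp_fst (ξ' := ξ - 1) ht₀)).add (c₄.mul cu)).add
    ((c₂.add c₃).const_mul (Real.exp (2 * t₀) * δ))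
  refine (key.mono ?_).congr (isOpen_modelT _ _) fun z _ => ?_
  · have e1 : |Real.exp (2 * t₀) * δ| ≤ Real.exp (2 * (1 + ξ)) := by
      rw [abs_mul, Real.abs_exp]
      have : Real.exp (2 * t₀) ≤ Real.exp (2 * (1 + ξ)) :=
        Real.exp_le_exp.2 (by linarith [ht₀.2])
      calc Real.exp (2 * t₀) * |δ| ≤ Real.exp (2 * (1 + ξ)) * 1 := by gcongr
        _ = _ := mul_one _
    have e2 : μ * K₂ + μ ^ 2 * K₃ ≤ Real.exp (-lam) * (K₂ + K₃) := by
      have : μ * K₂ ≤ Real.exp (-lam) * K₂ := by gcongr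
      have : μ ^ 2 * K₃ ≤ Real.exp (-lam) * K₃ := by gcongr; linarith
      linarith
    have e3 : μ * K₂ + μ ^ 2 * K₃ ≤ K₂ + K₃ := by
      have : μ * K₂ ≤ 1 * K₂ := by gcongr
      have : μ ^ 2 * K₃ ≤ 1 * K₃ := by gcongr; linarith
      linarith
    have e4 : |Real.exp (2 * t₀) * δ| * (μ * K₂ + μ ^ 2 * K₃)
        ≤ Real.exp (2 * (1 + ξ)) * (Real.exp (-lam) * (K₂ + K₃)) := by gcongr
    have e5 : 4 * (K₁ + μ * K₂ + μ ^ 2 * K₃) * K ≤ 4 * (K₁ + K₂ + K₃) * K := by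
      gcongr 4 * ?_ * K; linarith
    have el := Real.exp_pos (-lam)
    have e6 : 0 ≤ (4 * (K₁ + K₂ + K₃) + 4 * K₄ + 1) * Real.exp (-lam)
      + (Real.exp (2 * (1 + ξ)) * (K₂ + K₃) + 1) * K := by positivity
    linarith
  · rw [sinh_add_div_sinh hlam, ← hμ]
    have e1 : -t₀ + 1 * z.2 = z.2 - t₀ := by ring
    have e2 : Real.exp (2 * z.2) = Real.exp (2 * t₀) * Real.exp (z.2 - t₀) ^ 2 := by
      rw [← Real.exp_nat_mul, ← Real.exp_add]; congr 1; push_cast; ring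
    rw [e1, e2]
    ring

variable {m : ℕ}

theorem warpingTrick_of_one {ρ : ℝ → ℝ} {a d r : ℝ} (h : ρ (2 * (r - a) / d) = 1)
    (g : ℝ → SphForm m) : warpingTrick ρ a d g r = g r := by
  funext x
  ext v w
  change ((1 - ρ (2 * (r - a) / d)) * Real.sinh r ^ 2) * roundMetric m x v w
    + ρ (2 * (r - a) / d) * g r x v w = g r x v w
  rw [h]
  ring

theorem hypForcing_of_one {ρT ρW : ℝ → ℝ} {lam d r : ℝ} (h : ρT (2 * (r - (lam - d)) / d) = 1)
    (g : ℝ → SphForm m) (x : Sph m) (v w : TangentSpace (𝓡 m) x) :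
    hypForcing ρT ρW lam d g r x v w =
      (1 - ρW (r - lam)) * (Real.sinh r / Real.sinh lam) ^ 2 * g lam x v w
        + ρW (r - lam) * g r x v w := by
  rw [hypForcing, warpingTrick_of_one h]
  change ((1 - ρW (r - lam)) * Real.sinh r ^ 2) * (1 / Real.sinh lam ^ 2 * g lam x v w)
    + ρW (r - lam) * g r x v w = _
  rw [div_pow]
  ring

/-- The sphere r = lam sits at t = lam - a, so the spherical cut is read in the same chart by
freezing t there. -/
theorem radialCoeff_hypForcing_of_one {ρT ρW : ℝ → ℝ} {lam d a : ℝ}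
    {z : EuclideanSpace ℝ (Fin m) × ℝ} (h : ρT (2 * (z.2 + a - (lam - d)) / d) = 1)
    (g : ℝ → SphForm m) (φ₁ : EuclideanSpace ℝ (Fin m) → Sph m) (v w : EuclideanSpace ℝ (Fin m)) :
    radialCoeff (hypForcing ρT ρW lam d g) φ₁ a v w z =
      (1 - ρW (z.2 - (lam - a))) * (Real.sinh (z.2 - (lam - a) + lam) / Real.sinh lam) ^ 2
          * radialCoeff g φ₁ a v w (z.1, lam - a)
        + ρW (z.2 - (lam - a)) * radialCoeff g φ₁ a v w z := by
  have e1 : z.2 + a - lam = z.2 - (lam - a) := by ring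
  have e2 : z.2 - (lam - a) + lam = z.2 + a := by ring
  have e3 : lam - a + a = lam := by ring
  simp only [radialCoeff]
  rw [hypForcing_of_one h, e1, e2, e3]

end Forcing

/-- The given chart is kept, with its excess lowered by one. Either its full version contains the
sphere r = lam, or the lowered version lies beyond lam + 1/2, where forcing changes nothing. -/
theorem exists_isRadialHypChart_hypForcing_of_le {ρT ρW : ℝ → ℝ} (hρT : IsTrickCutoff ρT)
    (hρW : IsForcingCutoff ρW) {ξ : ℝ} (hξ : 1 < ξ) :
    ∃ C ≥ 1, ∀ {m : ℕ} {M : Type u} [TopologicalSpace M]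
      [ChartedSpace (EuclideanSpace ℝ (Fin (m + 1))) M]
      (Φ : EuclideanSpace ℝ (Fin (m + 1)) ≃ₘ⟮𝓡 (m + 1), 𝓡 (m + 1)⟯ M)
      {R ε ε' lam d : ℝ} {g : ℝ → SphForm m} {p : M} {φ : EuclideanSpace ℝ (Fin m) × ℝ → M},
      IsRadialHypChart Φ R g ε ξ p φ → 0 ≤ R → CkFamily 2 (Set.Ioi R) g → 1 ≤ lam →
      4 * (1 + ξ) ≤ d → lam - ξ ≤ radius Φ p → C * Real.exp (-lam) ≤ ε' →
      IsRadialHypChart Φ 0 (hypForcing ρT ρW lam d g) (ε' + C * ε) (ξ - 1) p φ := by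
  obtain ⟨C, hC, H⟩ := exists_c2Le_forced hρW.smooth hξ
  refine ⟨C, hC, fun {m M} _ _ Φ {R ε ε' lam d g p φ} hφ hR hg hlam hd hp hε' => ?_⟩
  obtain ⟨φ₁, K, hK0, hKε, hr, hK⟩ := hφ.exists_c2Le Φ (by linarith) hR hg
  have hs := modelT_mono m (by linarith : ξ - 1 ≤ ξ)
  have hC0 : 0 < C := by linarith
  have hCK : C * K < C * ε := by gcongr
  have hel := Real.exp_pos (-lam)
  -- On the smaller chart r > lam - 2ξ, and d / 2 ≥ 2(1 + ξ) places this beyond the end of the trick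
  -- zone at lam - d / 2.
  have hone : ∀ z ∈ modelT m (ξ - 1), ρT (2 * (z.2 + radius Φ p - (lam - d)) / d) = 1 :=
    fun z hz => hρT.one _ <| by
      rw [le_div_iff₀ (by linarith)]
      linarith [hz.2.1]
  refine hφ.restrict Φ hR (by linarith) (c2NormLT_of_radial (K := C * (K + Real.exp (-lam))) Φ
    (hφ.smooth.mono hs) (fun z hz => hR.trans_lt (hφ.range z (hs hz)))
    (fun z hz => hr z (hs hz)) (by positivity) (by linarith) fun j k => ?_)
  rcases lt_or_ge (radius Φ p) (lam + ξ + 1 / 2) with h | h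
  · have hδ : |inner ℝ (stdB m j) (stdB m k)| ≤ 1 := by
      refine (abs_real_inner_le_norm _ _).trans ?_
      simp [stdB]
    refine (H m _ K _ (lam - radius Φ p) lam (hK j k) hδ ⟨by linarith, by linarith⟩ hlam).congr
      (isOpen_modelT _ _) fun z hz => ?_
    rw [radialCoeff_hypForcing_of_one (hone z hz)]
    simp only [sub_add_cancel]
  · refine (((hK j k).mono_set hs).mono ?_).congr (isOpen_modelT _ _) fun z hz => ?_
    · nlinarith
    · obtain ⟨δ, hδ, -, h1⟩ := hρW.flat
      rw [radialCoeff_hypForcing_of_one (hone z hz), h1 _ (by linarith [hz.2.1])]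
      ring

/-! ### The forced metric: regional formulas, positivity, smoothness -/

section Fields

variable {m : ℕ} {ρT ρW : ℝ → ℝ} {lam d r : ℝ} {g : ℝ → SphForm m}

theorem hypForcing_eq_interpForm : hypForcing ρT ρW lam d g r =
    interpForm (ρT (2 * (r - (lam - d)) / d)) (fun x => Real.sinh r ^ 2 • roundMetric m x)
      (interpForm (ρW (r - lam)) (fun x => Real.sinh r ^ 2 • sphericalCut g lam x) (g r)) := by
  funext x
  ext v w
  change ((1 - ρT (2 * (r - (lam - d)) / d)) * Real.sinh r ^ 2) * roundMetric m x v w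
    + ρT (2 * (r - (lam - d)) / d) * (((1 - ρW (r - lam)) * Real.sinh r ^ 2)
      * sphericalCut g lam x v w + ρW (r - lam) * g r x v w)
    = (1 - ρT (2 * (r - (lam - d)) / d)) * (Real.sinh r ^ 2 * roundMetric m x v w)
      + ρT (2 * (r - (lam - d)) / d) * ((1 - ρW (r - lam))
        * (Real.sinh r ^ 2 * sphericalCut g lam x v w) + ρW (r - lam) * g r x v w)
  ring

theorem hypForcing_of_forcing_zero (h : ρW (r - lam) = 0) : hypForcing ρT ρW lam d g r =
    fun x => Real.sinh r ^ 2 • interpForm (ρT (2 * (r - (lam - d)) / d)) (roundMetric m)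
      (sphericalCut g lam) x := by
  rw [hypForcing_eq_interpForm, h]
  funext x
  ext v w
  change (1 - ρT (2 * (r - (lam - d)) / d)) * (Real.sinh r ^ 2 * roundMetric m x v w)
      + ρT (2 * (r - (lam - d)) / d) * ((1 - 0)
        * (Real.sinh r ^ 2 * sphericalCut g lam x v w) + 0 * g r x v w)
    = Real.sinh r ^ 2 * ((1 - ρT (2 * (r - (lam - d)) / d)) * roundMetric m x v w
      + ρT (2 * (r - (lam - d)) / d) * sphericalCut g lam x v w)
  ring

theorem hypForcing_of_trick_zero (h : ρT (2 * (r - (lam - d)) / d) = 0) :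
    hypForcing ρT ρW lam d g r = fun x => Real.sinh r ^ 2 • roundMetric m x := by
  rw [hypForcing_eq_interpForm, h]
  funext x
  ext v w
  change (1 - 0) * (Real.sinh r ^ 2 * roundMetric m x v w)
      + 0 * interpForm (ρW (r - lam)) (fun x => Real.sinh r ^ 2 • sphericalCut g lam x) (g r) x v w
    = Real.sinh r ^ 2 * roundMetric m x v w
  ring

theorem IsInnerForm.sphericalCut (hlam : 0 < lam) (hg : IsInnerForm (g lam)) :
    IsInnerForm (sphericalCut g lam) := by
  have := Real.sinh_pos_iff.2 hlam
  exact hg.smul (by positivity)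

/-- A nested convex combination of inner forms. The form g_r is needed only where the forcing cutoff
is nonzero, which forces r > lam. -/
theorem isInnerForm_hypForcing (hρT : IsTrickCutoff ρT) (hρW : IsForcingCutoff ρW)
    (hlam : 0 < lam) (hr : 0 < r) (hg : ∀ r ≥ lam, IsInnerForm (g r)) :
    IsInnerForm (hypForcing ρT ρW lam d g r) := by
  have hs := Real.sinh_pos_iff.2 hr
  have hs2 : 0 < Real.sinh r ^ 2 := by positivity
  rw [hypForcing_eq_interpForm]
  refine ((isInnerForm_roundMetric m).smul hs2).interp (hρT.mem _).1 (hρT.mem _).2 fun _ => ?_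
  refine (((hg lam le_rfl).sphericalCut hlam).smul hs2).interp (hρW.mem _).1 (hρW.mem _).2
    fun h => hg r ?_
  obtain ⟨δ, hδ, h0, -⟩ := hρW.flat
  by_contra! hlt
  exact h (h0 _ (by linarith))

theorem ckFamily_sphericalCut_const {n : WithTop ℕ∞} {D : Set ℝ} (hg : CkFamily n D g)
    (hD : lam ∈ D) (D' : Set ℝ) : CkFamily n D' (fun _ => sphericalCut g lam) :=
  (hg.comp (f := fun _ => lam) (D' := D') contDiffOn_const fun _ _ => hD).smul
    (f := fun _ => 1 / Real.sinh lam ^ 2) contDiffOn_const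

/-- The cutoff vanishes for r ≤ lam + δ, so the product extends smoothly by zero across radii where
g_r carries no information. -/
theorem ckFamily_cutoff_smul (hρW : IsForcingCutoff ρW) {R : ℝ} (hR : R < lam)
    (hg : CkFamily ∞ (Set.Ioi R) g) :
    CkFamily ∞ (Set.univ : Set ℝ) (fun r x => ρW (r - lam) • g r x) := by
  have hρ := hρW.smooth
  obtain ⟨δ, hδ, h0, -⟩ := hρW.flat
  refine CkFamily.of_locally fun r _ => ?_
  rcases lt_or_ge r (lam + δ) with h | h
  · refine ⟨Set.Iio (lam + δ), isOpen_Iio, h, CkFamily.congr ((ckFamily_roundMetric m _).smul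
      (f := fun _ => 0) contDiffOn_const) fun q hq => ?_⟩
    have hq : q < lam + δ := hq.2
    funext x
    ext v w
    change ρW (q - lam) * g q x v w = 0 * roundMetric m x v w
    rw [h0 _ (by linarith)]
    ring
  · refine ⟨Set.Ioi R, isOpen_Ioi, ?_, (hg.mono fun q hq => hq.2).smul
      (f := fun r => ρW (r - lam)) (ContDiff.contDiffOn (by fun_prop))⟩
    exact lt_of_lt_of_le (by linarith) h

theorem smoothFamily_hypForcing (hρT : IsTrickCutoff ρT) (hρW : IsForcingCutoff ρW) {R : ℝ}
    (hR : R < lam) (hg : CkFamily ∞ (Set.Ioi R) g) (D : Set ℝ) :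
    SmoothFamily D (hypForcing ρT ρW lam d g) := by
  have hρ1 := hρT.smooth
  have hρ2 := hρW.smooth
  have hs : ContDiff ℝ ∞ Real.sinh := Real.contDiff_sinh
  have h1 := (ckFamily_roundMetric m D).smul
    (f := fun r => (1 - ρT (2 * (r - (lam - d)) / d)) * Real.sinh r ^ 2)
    (ContDiff.contDiffOn (by fun_prop))
  have h2 := (ckFamily_sphericalCut_const hg hR D).smul
    (f := fun r => (1 - ρW (r - lam)) * Real.sinh r ^ 2) (ContDiff.contDiffOn (by fun_prop))
  have h3 := (ckFamily_cutoff_smul hρW hR hg).mono (Set.subset_univ D)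
  exact h1.add ((h2.add h3).smul (f := fun r => ρT (2 * (r - (lam - d)) / d))
    (ContDiff.contDiffOn (by fun_prop)))

end Fields

/-! ### One-parameter families and the main theorem -/

section Odot

variable {m : ℕ} {ξ lam₀ : ℝ} {R : ℝ → ℝ} {g : ℝ → ℝ → SphForm m}

theorem IsOdotFamily.R_lt (h : IsOdotFamily ξ lam₀ R g) (hξ : -1 < ξ) {lam : ℝ}
    (hlam : lam₀ ≤ lam) : R lam < lam := by
  have := (h.domain lam hlam).2
  linarith

theorem IsOdotFamily.ckFamily (h : IsOdotFamily ξ lam₀ R g) {lam : ℝ} (hlam : lam₀ ≤ lam) :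
    CkFamily ∞ (Set.Ioi (R lam)) (g lam) := by
  have hs : CkFamily ∞ {q : ℝ × ℝ | lam₀ ≤ q.1 ∧ R q.1 < q.2} (fun q => g q.1 q.2) := h.smooth
  exact hs.comp (f := fun r : ℝ => (lam, r)) (ContDiff.contDiffOn (by fun_prop))
    fun _ hr => ⟨hlam, hr⟩

theorem IsOdotFamily.ckFamily_sphericalCut (h : IsOdotFamily ξ lam₀ R g) (hξ : -1 < ξ) :
    CkFamily ∞ (Set.Ici lam₀) (fun lam => sphericalCut (g lam) lam) := by
  have hs : CkFamily ∞ {q : ℝ × ℝ | lam₀ ≤ q.1 ∧ R q.1 < q.2} (fun q => g q.1 q.2) := h.smooth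
  have h1 : CkFamily ∞ (Set.Ici lam₀) (fun lam => g lam lam) :=
    hs.comp (f := fun r : ℝ => (r, r)) (ContDiff.contDiffOn (by fun_prop))
      fun _ hr => ⟨hr, h.R_lt hξ hr⟩
  refine h1.smul (f := fun lam => 1 / Real.sinh lam ^ 2) ?_
  have hs : ContDiff ℝ ∞ Real.sinh := Real.contDiff_sinh
  refine contDiffOn_const.div (ContDiff.contDiffOn (by fun_prop)) fun lam hlam => ?_
  have h2 := h.lam₀_gt
  have : 0 < Real.sinh lam := Real.sinh_pos_iff.2 (by linarith [hlam.out])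
  positivity

theorem IsOdotFamily.isInnerForm_sphericalCut (h : IsOdotFamily ξ lam₀ R g) (hξ : -1 < ξ)
    {lam : ℝ} (hlam : lam₀ ≤ lam) : IsInnerForm (sphericalCut (g lam) lam) := by
  have h2 := h.lam₀_gt
  exact (h.inner_form lam hlam lam (h.R_lt hξ hlam)).sphericalCut (by linarith)

theorem IsOdotFamily.exists_cBounded (h : IsOdotFamily ξ lam₀ R g) (hξ : -1 < ξ)
    {𝒜 : SphereAtlas m} (hg : HasCutLimitAtZero 𝒜 g) :
    ∃ c > 1, ∀ lam ≥ lam₀, 𝒜.CBounded c (sphericalCut (g lam) lam) := by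
  obtain ⟨gInf, hlim⟩ := hg
  -- The limit metric is only C², so the boundedness argument runs with C² families.
  have h₀ : CkFamily 2 (Set.univ : Set ℝ) (fun _ => gInf.inner) :=
    gInf.contMDiff.comp_contMDiffOn contMDiffOn_snd
  refine 𝒜.exists_cBounded_of_limit (ContMDiffOn.of_le (h.ckFamily_sphericalCut hξ) (by norm_cast))
    (fun lam hlam => h.isInnerForm_sphericalCut hξ hlam) h₀ ⟨gInf.symm, gInf.pos⟩ hlim

end Odot

/-- Provides a point at which a given chart exists, which makes ε positive. -/
theorem exists_radius_eq {m : ℕ} {M : Type*} [TopologicalSpace M]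
    [ChartedSpace (EuclideanSpace ℝ (Fin (m + 1))) M]
    (Φ : EuclideanSpace ℝ (Fin (m + 1)) ≃ₘ⟮𝓡 (m + 1), 𝓡 (m + 1)⟯ M) {a : ℝ} (ha : 0 ≤ a) :
    ∃ p, radius Φ p = a :=
  ⟨Φ (EuclideanSpace.single 0 a), by simp [radius, abs_of_nonneg ha]⟩

theorem polarForm_congr {m : ℕ} {M : Type*} [TopologicalSpace M]
    [ChartedSpace (EuclideanSpace ℝ (Fin (m + 1))) M]
    (Φ : EuclideanSpace ℝ (Fin (m + 1)) ≃ₘ⟮𝓡 (m + 1), 𝓡 (m + 1)⟯ M) {g h : ℝ → SphForm m} {p : M}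
    (hgh : g (radius Φ p) = h (radius Φ p)) : polarForm Φ g p = polarForm Φ h p := by
  funext v w
  rw [polarForm, polarForm, hgh]

/-- Charts for the hyperbolic forcing inside the ball of radius `lam - ξ`. -/
theorem exists_isRadialHypChart_hypForcing_of_lt {m : ℕ} {ρT ρW : ℝ → ℝ} (hρT : IsTrickCutoff ρT)
    (hρW : IsForcingCutoff ρW) {ξ : ℝ} (hξ : 1 < ξ) (𝒜 : SphereAtlas m) {c : ℝ} (hc : 1 < c) :
    ∃ C > 0, ∀ {M : Type u} [TopologicalSpace M] [ChartedSpace (EuclideanSpace ℝ (Fin (m + 1))) M]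
      (Φ : EuclideanSpace ℝ (Fin (m + 1)) ≃ₘ⟮𝓡 (m + 1), 𝓡 (m + 1)⟯ M)
      {ε lam d : ℝ} {g : ℝ → SphForm m} {p : M},
      CkFamily 2 (Set.univ : Set ℝ) (fun _ => sphericalCut g lam) →
      IsInnerForm (sphericalCut g lam) → 𝒜.CBounded c (sphericalCut g lam) →
      4 * (1 + ξ) ≤ d → ξ ≤ radius Φ p → radius Φ p ≤ lam - ξ →
      C * (Real.exp (-radius Φ p) + 1 / d) < ε →
      ∃ φ, IsRadialHypChart Φ 0 (hypForcing ρT ρW lam d g) ε (ξ - 1) p φ := by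
  obtain ⟨C, hC, H⟩ := exists_close_of_cBounded hρT hξ 𝒜 hc
  refine ⟨C, hC, fun {M} _ _ Φ {ε lam d g p} hγ hγi hγc hd hp hp' hε => ?_⟩
  obtain ⟨φ₁, h1, h2, h3, h4, h5⟩ := H _ hγ hγi hγc (angle Φ p) (radius Φ p) (lam - d) d
    (by linarith) hd
  obtain ⟨δ, hδ, h0, -⟩ := hρW.flat
  have hd0 : 0 < d := by linarith
  refine ⟨_, isRadialHypChart_radialChart Φ (by linarith) (by linarith) h1 h2 h3 rfl h4
    (K := C * (Real.exp (-radius Φ p) + 1 / d)) (by positivity) hε fun j k => ?_⟩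
  refine (h5 j k).congr (isOpen_modelT _ _) fun z hz => ?_
  simp only [radialCoeff]
  rw [hypForcing_of_forcing_zero (h0 _ (by linarith [hz.2.2]))]

end

theorem mainTheorem3 (ρT ρW : ℝ → ℝ) (hρT : IsTrickCutoff ρT) (hρW : IsForcingCutoff ρW)
    (ξ : ℝ) (hξ : 1 < ξ) :
    ∃ C₂ : ℝ, 0 < C₂ ∧ ∀ (m : ℕ) (𝒜 : SphereAtlas m),
    ∃ C₁ : ℝ → ℝ, (∀ c > 1, 0 < C₁ c) ∧
    ∀ (M : Type u) [TopologicalSpace M] [ChartedSpace (EuclideanSpace ℝ (Fin (m + 1))) M]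
      [IsManifold (𝓡 (m + 1)) ∞ M]
      (Φ : EuclideanSpace ℝ (Fin (m + 1)) ≃ₘ⟮𝓡 (m + 1), 𝓡 (m + 1)⟯ M)
      (lam₀ : ℝ) (R : ℝ → ℝ) (g : ℝ → ℝ → SphForm m) (ε : ℝ),
      IsOdotFamily ξ lam₀ R g →
      HasCutLimitAtZero 𝒜 g →
      (∀ lam ≥ lam₀, RadiallyClose Φ (R lam) (g lam) ε ξ (outsideBall Φ (lam - (1 + ξ)))) →
      (∃ c > 1, ∀ lam ≥ lam₀, 𝒜.CBounded c (sphericalCut (g lam) lam)) ∧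
      ∀ c > 1, (∀ lam ≥ lam₀, 𝒜.CBounded c (sphericalCut (g lam) lam)) →
        ∀ ε' > 0, ∀ lam ≥ lam₀, ∀ d : ℝ, 4 * (1 + ξ) ≤ d → 2 * ξ ≤ lam - d →
          Real.log (2 * C₁ c / ε') < lam - d → 2 * C₁ c / ε' ≤ d →
          BallCloseToHyperbolic Φ (hypForcing ρT ρW lam d (g lam)) (lam - d) (ε' + C₂ * ε)
            (ξ - 1) := by
  obtain ⟨A, hA, HA⟩ := exists_isRadialHypChart_hypForcing_of_le.{u} hρT hρW hξ
  refine ⟨A, by linarith, fun m 𝒜 => ?_⟩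
  choose! B hB HB using fun (c : ℝ) (hc : 1 < c) =>
    exists_isRadialHypChart_hypForcing_of_lt.{u} hρT hρW hξ 𝒜 hc
  have heξ : 1 ≤ Real.exp ξ := Real.one_le_exp (by linarith)
  have hC₁ : ∀ c > 1, 0 < A + Real.exp ξ * B c := fun c hc => by
    have := hB c hc
    positivity
  -- The summand A absorbs the error e^{-lam} near the forcing zone. The factor e^ξ accounts for
  -- centers lying up to ξ inside the ball of radius lam - d.
  refine ⟨fun c => A + Real.exp ξ * B c, hC₁, fun M _ _ _ Φ lam₀ R g ε hfam hlim hclose =>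
    ⟨hfam.exists_cBounded (by linarith) hlim, fun c hc hcb ε' hε' lam hlam d hd hdξ hlog hdC => ?_⟩⟩
  have hlam₀ := hfam.lam₀_gt
  obtain ⟨hR0, hR1⟩ := hfam.domain lam hlam
  have hRlam : R lam < lam := hfam.R_lt (by linarith) hlam
  have hck := hfam.ckFamily hlam
  have hck2 : CkFamily 2 (Set.Ioi (R lam)) (g lam) := ContMDiffOn.of_le hck (by norm_cast)
  set C := A + Real.exp ξ * B c with hC
  have hC0 : 0 < C := hC₁ c hc
  have hBc := hB c hc
  have hd0 : 0 < d := by linarith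
  have hexp : Real.exp (-(lam - d)) < ε' / (2 * C) := by
    have h := (Real.log_lt_iff_lt_exp (by positivity)).1 hlog
    rw [Real.exp_neg, ← inv_div (2 * C) ε']
    exact inv_strictAnti₀ (by positivity) h
  have hdinv : 1 / d ≤ ε' / (2 * C) := by
    rw [← inv_div (2 * C) ε', ← one_div]
    exact one_div_le_one_div_of_le (by positivity) hdC
  have hquot : C * (ε' / (2 * C)) = ε' / 2 := by field_simp
  refine ⟨smoothFamily_hypForcing hρT hρW hRlam hck _, fun r hr => isInnerForm_hypForcing hρT hρW
    (by linarith) hr fun r' hr' => hfam.inner_form lam hlam r' (by linarith), fun p _ hp =>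
    polarForm_congr Φ (hypForcing_of_trick_zero (hρT.zero _ ?_)), fun p hp => ?_⟩
  · exact div_nonpos_of_nonpos_of_nonneg (by linarith) hd0.le
  have hp : lam - d - 1 - (ξ - 1) ≤ radius Φ p := hp
  rcases le_or_gt (lam - ξ) (radius Φ p) with h | h
  · obtain ⟨φ, hφ⟩ := hclose lam hlam p (by change lam - (1 + ξ) ≤ radius Φ p; linarith)
    refine ⟨φ, HA Φ hφ hR0 hck2 (by linarith) hd h ?_⟩
    have h1 : Real.exp (-lam) ≤ ε' / (2 * C) :=
      (Real.exp_le_exp.2 (by linarith)).trans hexp.le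
    have h2 : A ≤ C := by rw [hC]; nlinarith
    calc A * Real.exp (-lam) ≤ C * (ε' / (2 * C)) := by gcongr
      _ ≤ ε' := by linarith
  -- The terms e^{-r} and 1 / d may use up all of ε', one half each. The strict inequality then
  -- comes from C₂ ε > 0, and ε is positive because it strictly exceeds a norm in an existing chart.
  · have hε : 0 < ε := by
      obtain ⟨q, hq⟩ := exists_radius_eq Φ (a := lam) (by linarith)
      obtain ⟨φ, hφ⟩ := hclose lam hlam q (by change lam - (1 + ξ) ≤ radius Φ q; linarith)
      obtain ⟨-, K, hK0, hK, -⟩ := hφ.exists_c2Le Φ (by linarith) hR0 hck2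
      linarith
    refine HB c hc Φ (ckFamily_sphericalCut_const hck2 hRlam _)
      (hfam.isInnerForm_sphericalCut (by linarith) hlam) (hcb lam hlam) hd (by linarith) h.le ?_
    have h1 : Real.exp (-radius Φ p) ≤ Real.exp ξ * Real.exp (-(lam - d)) := by
      rw [← Real.exp_add]
      exact Real.exp_le_exp.2 (by linarith)
    have h2 : B c * (Real.exp (-radius Φ p) + 1 / d)
        ≤ B c * (Real.exp ξ * (ε' / (2 * C)) + Real.exp ξ * (ε' / (2 * C))) := by
      have h3 : 1 / d ≤ Real.exp ξ * (ε' / (2 * C)) :=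
        hdinv.trans (le_mul_of_one_le_left (by positivity) heξ)
      have h4 : Real.exp ξ * Real.exp (-(lam - d)) ≤ Real.exp ξ * (ε' / (2 * C)) := by gcongr
      gcongr
      exact h1.trans h4
    have h5 : B c * (Real.exp ξ * (ε' / (2 * C))) ≤ C * (ε' / (2 * C)) := by
      rw [← mul_assoc]
      gcongr
      linarith [mul_comm (B c) (Real.exp ξ)]
    have h6 : 0 < A * ε := by positivity
    linarith
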